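/- Let $\mathcal X_n$ be Culler–Vogtmann's Outer space of marked metric graphs $(\Gamma,f,\ell)$ of rank $n$: all vertices of $\Gamma$ have valence $>2$, $f$ is a homotopy equivalence from the rose with $n$ petals to $\Gamma$, the edge lengths satisfy $\ell\ge 0$ and $\sum_e\ell(e)=1$, the edges of length $0$ form a forest, and triples are identified under collapsing forests of edges of length $0$ and under isometries of graphs that commute with the markings up to homotopy. Let $$d(x,y)=\min_\phi\log\sigma(\phi)$$ be the (asymmetric) Lipschitz metric, where $\phi$ ranges over the maps from the graph of $x$ to the graph of $y$ that are linear on edges and commute with the markings up to homotopy, and $\sigma(\phi)$ is the largest slope of $\phi$. For $\varepsilon>0$ let $\mathcal X_{\ge\varepsilon}\subset\mathcal X_n$ be the set of points whose graph contains no (homotopically nontrivial) loop shorter than $\varepsilon$. A path $\gamma:[0,1]\to\mathcal X_n$ is piecewise linear if $[0,1]$ can be divided into finitely many closed intervals on each of which $\gamma$ is an affine path of metrics on a fixed marked graph. Let $-\gamma(t)=\gamma(1-t)$ and $$\mathrm{len}(\gamma)=\sup\Big\{\sum_{i=1}^p d(\gamma(t_{i-1}),\gamma(t_i))\ :\ 0=t_0<t_1<\dots<t_p=1\Big\}.$$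 Put $K=(2^n-1)(2^{2n-1}-1)$ and $A=3(K+1)$, which depend only on $n$. **Theorem.** For every $\varepsilon>0$ there is a constant $B$ (depending only on $n$ and $\varepsilon$) such that for all $x,y\in\mathcal X_{\ge\varepsilon}$ and every piecewise linear path $\gamma$ in $\mathcal X_n$ from $x$ to $y$, the lengths $\mathrm{len}(\gamma)$ and $\mathrm{len}(-\gamma)$ are finite and $$\frac1A\,\mathrm{len}(\gamma)-B\ \le\ \mathrm{len}(-\gamma)\ \le\ A\,\mathrm{len}(\gamma)+B .$$ Moreover, there is a constant $D$ (depending only on $n$ and $\varepsilon$) such that for all $x,y\in\mathcal X_{\ge\varepsilon}$ $$d(y,x)\le D\,d(x,y).$$ -/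

import Mathlib

open scoped unitInterval

noncomputable section

namespace LipOuter

/-! ### Finite graphs and homotopy classes of edge paths -/

/-- A finite graph (loops and multiple edges allowed), each edge with a chosen orientation.
Connectedness and the condition on valences are imposed in `MarkedGraph`. -/
structure FinGraph where
  V : Type
  E : Type
  [fintypeV : Fintype V]
  [decV : DecidableEq V]
  [fintypeE : Fintype E]
  [decE : DecidableEq E]
  src : E → V
  tgt : E → V

attribute [instance] FinGraph.fintypeV FinGraph.decV FinGraph.fintypeE FinGraph.decE

namespace FinGraph

variable (Γ : FinGraph)

/-- Oriented edges are pairs `(e, b)`; `(e, true)` is `e` with its chosen orientation and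
`(e, false)` is `e` reversed. This is the initial vertex of an oriented edge. -/
def init (d : Γ.E × Bool) : Γ.V := if d.2 then Γ.src d.1 else Γ.tgt d.1

/-- The terminal vertex of an oriented edge. -/
def term (d : Γ.E × Bool) : Γ.V := if d.2 then Γ.tgt d.1 else Γ.src d.1

/-- `Γ.IsWalk u v L`: the list `L` of oriented edges is an edge path from `u` to `v`. -/
def IsWalk : Γ.V → Γ.V → List (Γ.E × Bool) → Prop
  | u, v, [] => u = v
  | u, v, d :: L => Γ.init d = u ∧ IsWalk (Γ.term d) v L

/-- The homotopy classes, relative to the endpoints, of paths from `u` to `v` in `Γ`.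
Two edge paths with the same endpoints are homotopic if and only if they differ by insertions and
deletions of backtracks `d d⁻¹`, i.e. if and only if they define the same element of the free group
on the edges; the reduced word of that element is the tight representative. -/
def pathClass (u v : Γ.V) : Set (FreeGroup Γ.E) :=
  {g | ∃ L, Γ.IsWalk u v L ∧ FreeGroup.mk L = g}

/-- Every two vertices are joined by an edge path. -/
def Connected : Prop := ∀ u v : Γ.V, ∃ L, Γ.IsWalk u v L

/-- The valence of a vertex: the number of oriented edges issuing from it (loops count twice). -/
def valence (v : Γ.V) : ℕ := Fintype.card {d : Γ.E × Bool // Γ.init d = v}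

/-- The subgraph formed by the edges in `S` contains no circle: there is no nontrivial reduced
closed edge path all of whose edges are in `S`. -/
def IsForest (S : Set Γ.E) : Prop :=
  ∀ v, ∀ g ∈ Γ.pathClass v v, (∀ d ∈ g.toWord, d.1 ∈ S) → g = 1

/-- The length, with respect to the edge lengths `ℓ`, of the tight edge path in the class `g`. -/
def pathLength {Γ : FinGraph} (ℓ : Γ.E → ℝ) (g : FreeGroup Γ.E) : ℝ :=
  (g.toWord.map fun d => ℓ d.1).sum

/-- `ℓ` is a metric on `Γ`, i.e. a point of the simplex with missing faces `Σ_Γ`. -/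
structure IsMetric (ℓ : Γ.E → ℝ) : Prop where
  nonneg : ∀ e, 0 ≤ ℓ e
  sum_eq_one : ∑ e, ℓ e = 1
  forest : Γ.IsForest {e | ℓ e = 0}

/-- A point of the graph: the point of the edge `edge` which divides it from its initial
vertex on in the proportion `pos : 1 - pos`. (Vertices are the points with `pos` equal to
`0` or `1`.) -/
structure Point where
  edge : Γ.E
  pos : I

/-- The initial vertex of the edge on which the point is given. -/
def Point.root {Γ : FinGraph} (p : Γ.Point) : Γ.V := Γ.src p.edge

/-- Homotopy classes of paths from `p` to `q`, relative to the endpoints, correspond to elements `w`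
of `Γ.pathClass p.root q.root`: the path runs along its edge from `p` back to `p.root`, then
along `w`, then along the edge of `q` from `q.root` to `q`. This is the length of the tight
(equivalently, shortest) path in this class. If `p` and `q` are on one edge and the class is that of
the segment between them, it is that segment; otherwise the tight path leaves the edge of `p`
through one of its two ends and enters the edge of `q` through one of its two ends. -/
def Point.tightLength {Γ : FinGraph} (ℓ : Γ.E → ℝ) (p : Γ.Point) (w : FreeGroup Γ.E)
    (q : Γ.Point) : ℝ :=
  let a : FreeGroup Γ.E := FreeGroup.of p.edge
  let b : FreeGroup Γ.E := FreeGroup.of q.edge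
  let s : ℝ := p.pos * ℓ p.edge
  let s' : ℝ := (1 - p.pos) * ℓ p.edge
  let t : ℝ := q.pos * ℓ q.edge
  let t' : ℝ := (1 - q.pos) * ℓ q.edge
  if p.edge = q.edge ∧ w = 1 then |s - t|
  else
    min (min (s + pathLength ℓ w + t) (s' + pathLength ℓ (a⁻¹ * w) + t))
      (min (s + pathLength ℓ (w * b) + t') (s' + pathLength ℓ (a⁻¹ * w * b) + t'))

/-- A map from `Γ` to `Γ'` that collapses each component of a forest in `Γ` to a point and is
otherwise a homeomorphism: `Γ'` is obtained from `Γ` by collapsing a forest. Edges with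
value `none` are collapsed; the value `some d` is the oriented edge of `Γ'` to which the edge
is mapped. For the empty forest this is an isomorphism of graphs. -/
structure Collapse (Γ Γ' : FinGraph) where
  onV : Γ.V → Γ'.V
  onE : Γ.E → Option (Γ'.E × Bool)
  onV_surjective : Function.Surjective onV
  onV_src : ∀ e d, onE e = some d → onV (Γ.src e) = Γ'.init d
  onV_tgt : ∀ e d, onE e = some d → onV (Γ.tgt e) = Γ'.term d
  onE_bijective : ∀ e', ∃! e, ∃ b, onE e = some (e', b)
  onV_eq_iff : ∀ u v, onV u = onV v ↔
    ∃ L, Γ.IsWalk u v L ∧ ∀ d ∈ L, onE d.1 = none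
  forest : Γ.IsForest {e | onE e = none}

/-- The effect of a collapse on homotopy classes of paths. -/
def Collapse.onPath {Γ Γ' : FinGraph} (c : Collapse Γ Γ') : FreeGroup Γ.E →* FreeGroup Γ'.E :=
  FreeGroup.lift fun e => match c.onE e with
    | none => 1
    | some d => FreeGroup.mk [d]

end FinGraph

/-! ### Outer space -/

/-- A marked graph of rank `n`: a graph `Γ` with a homotopy equivalence from the rose with `n` petals
to `Γ`. Up to homotopy it sends the vertex of the rose to a vertex `base` of `Γ`, and it is then
given, up to homotopy relative to that vertex, by the isomorphism `f` which it induces from the free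
group of rank `n` to the fundamental group of `Γ` at `base`. -/
structure MarkedGraph (n : ℕ) where
  Γ : FinGraph
  connected : Γ.Connected
  two_lt_valence : ∀ v, 2 < Γ.valence v
  base : Γ.V
  f : FreeGroup (Fin n) →* FreeGroup Γ.E
  f_injective : Function.Injective f
  f_range : Set.range f = Γ.pathClass base base

/-- A marked metric graph `(Γ, f, ℓ)`. -/
structure MarkedMetricGraph (n : ℕ) extends MarkedGraph n where
  ℓ : Γ.E → ℝ
  isMetric : Γ.IsMetric ℓ

/-- `Collapses x y`: there is a collapse `c` of a forest from the graph of `x` to the graph of `y`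
(possibly an isomorphism) such that the metric of `x` is that of `y`, extended by zero on the
forest, and `c ∘ f` is freely homotopic to the marking of `y`, the base point moving along `p`. -/
def Collapses {n : ℕ} (x y : MarkedMetricGraph n) : Prop :=
  ∃ c : FinGraph.Collapse x.Γ y.Γ,
    (∀ e, c.onE e = none → x.ℓ e = 0) ∧
    (∀ e d, c.onE e = some d → x.ℓ e = y.ℓ d.1) ∧
    ∃ p ∈ y.Γ.pathClass (c.onV x.base) y.base, ∀ g, y.f g = p⁻¹ * c.onPath (x.f g) * p

/-- Outer space: the disjoint union of the simplices with missing faces `Σ_Γ` over all marked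
graphs, where equivalent marked graphs, and faces that correspond to collapses of forests, are
identified (`Quot` takes the quotient by the equivalence relation generated by `Collapses`). -/
def OuterSpace (n : ℕ) : Type 1 := Quot (@Collapses n)

/-- The point of Outer space represented by a marked metric graph. -/
def MarkedMetricGraph.toOuterSpace {n : ℕ} (x : MarkedMetricGraph n) : OuterSpace n :=
  Quot.mk _ x

/-! ### The Lipschitz metric -/

/-- A difference of markings `φ` from the graph of `x` to the graph of `y` that is linear on edges.
It is given by the images `φ v` of the vertices and by the homotopy classes, relative to the
endpoints, of the images of the edges, recorded as in `Point.tightLength`; an edge is mapped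
with constant speed onto the tight path in its class. The last field says `φ ∘ f ≃ f'`. -/
structure DifferenceOfMarkings {n : ℕ} (x y : MarkedMetricGraph n) where
  onV : x.Γ.V → y.Γ.Point
  onE : x.Γ.E → FreeGroup y.Γ.E
  onE_mem : ∀ e, onE e ∈ y.Γ.pathClass (onV (x.Γ.src e)).root (onV (x.Γ.tgt e)).root
  homotopic : ∃ p ∈ y.Γ.pathClass (onV x.base).root y.base,
    ∀ g, y.f g = p⁻¹ * FreeGroup.lift onE (x.f g) * p

/-- The length of the image of an edge. -/
def DifferenceOfMarkings.imageLength {n : ℕ} {x y : MarkedMetricGraph n}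
    (φ : DifferenceOfMarkings x y) (e : x.Γ.E) : ℝ :=
  FinGraph.Point.tightLength y.ℓ (φ.onV (x.Γ.src e)) (φ.onE e) (φ.onV (x.Γ.tgt e))

/-- The largest slope `σ(φ)` is at most `c`. (An edge of length zero, which is a point of the
collapsed graph, has to have an image of length zero.) -/
def DifferenceOfMarkings.SlopeLE {n : ℕ} {x y : MarkedMetricGraph n}
    (φ : DifferenceOfMarkings x y) (c : ℝ) : Prop :=
  ∀ e, φ.imageLength e ≤ c * x.ℓ e

/-- The Lipschitz metric `d(x, y) = min log σ(φ)`, over all differences of markings `φ` between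
representatives of `x` and `y`. -/
def lipDist {n : ℕ} (x y : OuterSpace n) : ℝ :=
  sInf {r : ℝ | ∃ x' y' : MarkedMetricGraph n, x'.toOuterSpace = x ∧ y'.toOuterSpace = y ∧
    ∃ φ : DifferenceOfMarkings x' y', φ.SlopeLE (Real.exp r)}

/-- The thick part: the points represented by marked metric graphs without (homotopically
nontrivial) loops shorter than `ε`. -/
def thickPart (n : ℕ) (ε : ℝ) : Set (OuterSpace n) :=
  {x | ∃ x' : MarkedMetricGraph n, x'.toOuterSpace = x ∧
    ∀ v, ∀ g ∈ x'.Γ.pathClass v v, g ≠ 1 → ε ≤ FinGraph.pathLength x'.ℓ g}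

/-! ### Paths -/

/-- A path in Outer space is piecewise linear if `[0, 1]` can be divided into finitely many
intervals `[t i, t (i + 1)]` on each of which it is an affine path `s ↦ a + s b` in the simplex
`Σ_Γ` of some marked graph. -/
def IsPiecewiseLinear {n : ℕ} (γ : I → OuterSpace n) : Prop :=
  ∃ (k : ℕ) (t : Fin (k + 1) → I), StrictMono t ∧ t 0 = 0 ∧ t (Fin.last k) = 1 ∧
    ∀ i : Fin k, ∃ (M : MarkedGraph n) (a b : M.Γ.E → ℝ),
      ∀ s : I, t i.castSucc ≤ s → s ≤ t i.succ →
        ∃ h : M.Γ.IsMetric (fun e => a e + (s : ℝ) * b e),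
          γ s = MarkedMetricGraph.toOuterSpace ⟨M, fun e => a e + (s : ℝ) * b e, h⟩

/-- The sums `∑ d(γ(t_{i-1}), γ(t_i))` over all `0 = t_0 < t_1 < ⋯ < t_p = 1`. -/
def lipSums {n : ℕ} (γ : I → OuterSpace n) : Set ℝ :=
  {S | ∃ (p : ℕ) (t : Fin (p + 1) → I), StrictMono t ∧ t 0 = 0 ∧ t (Fin.last p) = 1 ∧
    S = ∑ i : Fin p, lipDist (γ (t i.castSucc)) (γ (t i.succ))}

/-- The Lipschitz length of a path. -/
def lipLength {n : ℕ} (γ : I → OuterSpace n) : ℝ := sSup (lipSums γ)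

/-- The reverse path `t ↦ γ (1 - t)`. -/
def reversePath {n : ℕ} (γ : I → OuterSpace n) : I → OuterSpace n := fun t => γ (σ t)

/-- The number `K = (2 ^ n - 1) (2 ^ (2 n - 1) - 1)` of pairs of a nontrivial double cover of a graph
of rank `n` and a nonzero class in its first homology with `ℤ/2`-coefficients. -/
def constK (n : ℕ) : ℝ := (2 ^ n - 1) * (2 ^ (2 * n - 1) - 1)

/-- The constant `A = 3 (K + 1)` of quasi-symmetry; it depends only on the rank. -/
def constA (n : ℕ) : ℝ := 3 * (constK n + 1)

end LipOuter

end

open scoped unitInterval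
set_option linter.unusedSectionVars false
noncomputable section
namespace LipOuter

/-! ### Weighted word length and translation length in a free group -/

section WordSum

variable {E : Type}

/-! Everything is expressed by translation lengths. Write tr_x(g) for the length at x of the
shortest loop in the class of g. A map of slope at most c multiplies no tr by more than c;
conversely, if tr_y ≤ c · tr_x, there are maps of slope arbitrarily close to c (`exists_slopeLE`).
So d(x, y) is the logarithm of the least such c (`tr_le_exp_lipDist`, `lipDist_le`).

The asymmetry of d is controlled by a potential. A class is a double cover of the rose (possibly
trivial) with a nonzero mod 2 chain in it, and its length at x is the least tr_x(g) among the g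
whose lifts are closed with that chain. Let P(x) be the product of all these lengths and N the
number of factors minus one. The core is `lipDist_reverse_le`: d(y, x) ≤ N d(x, y) + log P(x) − log
P(y). Along a subdivided path the potentials log P telescope, so only their values at the two ends
remain, and these are bounded on the thick part: each factor lies between min(ε, 1) and 4. Finally N
≤ A.

The core inequality is first proved for two metrics ℓ, ℓ' on one graph, where ℓ'-translation lengths
are at most c times ℓ-translation lengths. The ratio ℓ/ℓ' is largest on some loop that either
crosses each edge at most once or is a dumbbell, and such a loop lifts to a double cover crossing
each edge at most once (`exists_liftsSimply`). It is then shortest in its class for every metric,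
since any other loop of the class crosses the same edges of the cover, up to a deck transformation,
an odd number of times (`exists_classLen_eq`). The largest ratio is therefore a quotient of two
corresponding factors of P and P'; the N other factors of P' are at most c times those of P. Hence
ratio · P' ≤ c^N · P (`PreMarked.tl_mul_prodLen_le`).

A map from x to y factors into a change of metric on the graph of x, namely to the lengths of the
images of edges, and a sequence of collapses and folds. A fold is again a change of metric on one
graph, the folded one, whose new edge had length zero before. Folds do not increase tr, so they
satisfy the inequality with c = 1, and only the first change of metric costs a power of the slope.

For d(y, x) ≤ D d(x, y), distances bounded below are handled by the potential. For small distances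
in the thick part, a loop of length L meets a vertex at most L/ε times. Changing the metric or
folding thus shortens loops by a proportion of at most 2/ε times the volume lost. All graphs
labelled by words describing y have volume at least 1 (`one_le_vol`), so at most c − 1 is lost. -/

/-- The total weight of a word. -/
def lsum (ℓ : E → ℝ) (L : List (E × Bool)) : ℝ := (L.map fun d => ℓ d.1).sum

@[simp] lemma lsum_nil (ℓ : E → ℝ) : lsum ℓ [] = 0 := rfl

@[simp] lemma lsum_cons (ℓ : E → ℝ) (d : E × Bool) (L : List (E × Bool)) :
    lsum ℓ (d :: L) = ℓ d.1 + lsum ℓ L := by simp [lsum]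

@[simp] lemma lsum_append (ℓ : E → ℝ) (L M : List (E × Bool)) :
    lsum ℓ (L ++ M) = lsum ℓ L + lsum ℓ M := by simp [lsum]

@[simp] lemma lsum_invRev (ℓ : E → ℝ) (L : List (E × Bool)) :
    lsum ℓ (FreeGroup.invRev L) = lsum ℓ L := by
  simp [lsum, FreeGroup.invRev, Function.comp_def]

lemma lsum_nonneg {ℓ : E → ℝ} (hℓ : ∀ e, 0 ≤ ℓ e) (L : List (E × Bool)) : 0 ≤ lsum ℓ L :=
  List.sum_nonneg (by simp only [List.mem_map]; rintro _ ⟨d, -, rfl⟩; exact hℓ _)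

lemma lsum_sublist {ℓ : E → ℝ} (hℓ : ∀ e, 0 ≤ ℓ e) {L M : List (E × Bool)} (h : L.Sublist M) :
    lsum ℓ L ≤ lsum ℓ M := by
  induction h with
  | slnil => simp
  | cons a _ ih => simp only [lsum_cons]; linarith [hℓ a.1]
  | cons_cons a _ ih => simp only [lsum_cons]; linarith

lemma lsum_perm (ℓ : E → ℝ) {L M : List (E × Bool)} (h : L.Perm M) : lsum ℓ L = lsum ℓ M :=
  (h.map _).sum_eq

lemma lsum_flatten_replicate (ℓ : E → ℝ) (k : ℕ) (L : List (E × Bool)) :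
    lsum ℓ (List.replicate k L).flatten = k * lsum ℓ L := by
  induction k with
  | zero => simp
  | succ k ih => simp [List.replicate_succ, ih]; ring

lemma lsum_mono {ℓ ℓ' : E → ℝ} (h : ∀ e, ℓ e ≤ ℓ' e) (L : List (E × Bool)) :
    lsum ℓ L ≤ lsum ℓ' L := by
  induction L with
  | nil => simp
  | cons d L ih => simp only [lsum_cons]; linarith [h d.1]

lemma lsum_smul (c : ℝ) (ℓ : E → ℝ) (L : List (E × Bool)) :
    lsum (fun e => c * ℓ e) L = c * lsum ℓ L := by
  induction L with
  | nil => simp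
  | cons d L ih => simp [ih]; ring

lemma lsum_add (ℓ ℓ' : E → ℝ) (L : List (E × Bool)) :
    lsum (fun e => ℓ e + ℓ' e) L = lsum ℓ L + lsum ℓ' L := by
  induction L with
  | nil => simp
  | cons d L ih => simp [ih]; ring

lemma lsum_sub (ℓ ℓ' : E → ℝ) (L : List (E × Bool)) :
    lsum (fun e => ℓ e - ℓ' e) L = lsum ℓ L - lsum ℓ' L := by
  induction L with
  | nil => simp
  | cons d L ih => simp [ih]; ring

lemma lsum_const (c : ℝ) (L : List (E × Bool)) : lsum (fun _ => c) L = c * L.length := by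
  induction L with
  | nil => simp
  | cons d L ih => simp [ih]; ring

lemma lsum_eq_zero {ℓ : E → ℝ} {L : List (E × Bool)} (h : ∀ d ∈ L, ℓ d.1 = 0) :
    lsum ℓ L = 0 := by
  induction L with
  | nil => simp
  | cons d L ih =>
    rw [lsum_cons, h d (by simp), ih fun d hd => h d (List.mem_cons_of_mem _ hd), add_zero]

lemma le_lsum_of_mem {ℓ : E → ℝ} (hℓ : ∀ e, 0 ≤ ℓ e) {L : List (E × Bool)} {d : E × Bool}
    (h : d ∈ L) : ℓ d.1 ≤ lsum ℓ L := by
  have := lsum_sublist hℓ (List.singleton_sublist.2 h)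
  simpa using this

end WordSum

section WordLength

variable {E E' : Type} [DecidableEq E] [DecidableEq E']

/-- The weighted length of an element of a free group. -/
def wlen (ℓ : E → ℝ) (g : FreeGroup E) : ℝ := lsum ℓ g.toWord

lemma wlen_nonneg {ℓ : E → ℝ} (hℓ : ∀ e, 0 ≤ ℓ e) (g : FreeGroup E) : 0 ≤ wlen ℓ g :=
  lsum_nonneg hℓ _

@[simp] lemma wlen_one (ℓ : E → ℝ) : wlen ℓ (1 : FreeGroup E) = 0 := by simp [wlen]

@[simp] lemma wlen_of (ℓ : E → ℝ) (e : E) : wlen ℓ (FreeGroup.of e) = ℓ e := by simp [wlen]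

@[simp] lemma wlen_inv (ℓ : E → ℝ) (g : FreeGroup E) : wlen ℓ g⁻¹ = wlen ℓ g := by
  simp [wlen, FreeGroup.toWord_inv]

lemma wlen_mk_le {ℓ : E → ℝ} (hℓ : ∀ e, 0 ≤ ℓ e) (L : List (E × Bool)) :
    wlen ℓ (FreeGroup.mk L) ≤ lsum ℓ L := by
  rw [wlen, FreeGroup.toWord_mk]
  exact lsum_sublist hℓ FreeGroup.reduce.red.sublist

lemma wlen_mk_of_isReduced (ℓ : E → ℝ) {L : List (E × Bool)} (h : FreeGroup.IsReduced L) :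
    wlen ℓ (FreeGroup.mk L) = lsum ℓ L := by
  rw [wlen, FreeGroup.toWord_mk, h.reduce_eq]

lemma wlen_mul_le {ℓ : E → ℝ} (hℓ : ∀ e, 0 ≤ ℓ e) (g h : FreeGroup E) :
    wlen ℓ (g * h) ≤ wlen ℓ g + wlen ℓ h := by
  rw [wlen, wlen, wlen, ← lsum_append]
  exact lsum_sublist hℓ (FreeGroup.toWord_mul_sublist g h)

lemma wlen_mono {ℓ ℓ' : E → ℝ} (h : ∀ e, ℓ e ≤ ℓ' e) (g : FreeGroup E) :
    wlen ℓ g ≤ wlen ℓ' g := lsum_mono h _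

lemma wlen_hom_le {ℓ : E → ℝ} {ℓ' : E' → ℝ} (hℓ' : ∀ e, 0 ≤ ℓ' e)
    (φ : FreeGroup E →* FreeGroup E') (h : ∀ e, wlen ℓ' (φ (FreeGroup.of e)) ≤ ℓ e)
    (g : FreeGroup E) : wlen ℓ' (φ g) ≤ wlen ℓ g := by
  have key : ∀ L : List (E × Bool), wlen ℓ' (φ (FreeGroup.mk L)) ≤ lsum ℓ L := by
    intro L
    induction L with
    | nil => simp [← FreeGroup.one_eq_mk]
    | cons d L ih =>
      have : FreeGroup.mk (d :: L) = FreeGroup.mk [d] * FreeGroup.mk L := by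
        rw [FreeGroup.mul_mk]; rfl
      rw [this, map_mul, lsum_cons]
      refine (wlen_mul_le hℓ' _ _).trans (add_le_add ?_ ih)
      obtain ⟨e, b⟩ := d
      cases b
      · have : FreeGroup.mk [(e, false)] = (FreeGroup.of e)⁻¹ := by
          simp [FreeGroup.of, FreeGroup.inv_mk, FreeGroup.invRev]
        rw [this, map_inv, wlen_inv]; exact h e
      · exact h e
  have := key g.toWord
  rwa [FreeGroup.mk_toWord] at this

/-- The translation length of an element of a free group acting on its weighted Cayley tree. -/
def tl (ℓ : E → ℝ) (g : FreeGroup E) : ℝ := lsum ℓ (FreeGroup.reduceCyclically g.toWord)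

lemma tl_nonneg {ℓ : E → ℝ} (hℓ : ∀ e, 0 ≤ ℓ e) (g : FreeGroup E) : 0 ≤ tl ℓ g :=
  lsum_nonneg hℓ _

/-- In a power of a conjugated cyclically reduced word only the conjugators of neighbouring factors
cancel. So `tl` is the growth rate of word length under powers. -/
lemma wlen_pow (ℓ : E → ℝ) (g : FreeGroup E) (k : ℕ) : wlen ℓ (g ^ (k + 1)) =
    2 * lsum ℓ (FreeGroup.reduceCyclically.conjugator g.toWord) + (k + 1) * tl ℓ g := by
  rw [wlen, FreeGroup.toWord_pow,
    FreeGroup.reduceCyclically.reduce_flatten_replicate_succ FreeGroup.isReduced_toWord]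
  simp only [lsum_append, lsum_flatten_replicate, lsum_invRev, tl]
  push_cast; ring

lemma tl_le_wlen {ℓ : E → ℝ} (hℓ : ∀ e, 0 ≤ ℓ e) (g : FreeGroup E) : tl ℓ g ≤ wlen ℓ g := by
  have := wlen_pow ℓ g 0
  simp only [zero_add, pow_one, Nat.cast_zero, one_mul] at this
  linarith [lsum_nonneg hℓ (FreeGroup.reduceCyclically.conjugator g.toWord)]

/-- Bounded errors disappear in the growth rate. This turns estimates of words into estimates of
translation lengths, without cyclic reduction. -/
lemma tl_le_of_wlen_pow_le {ℓ : E → ℝ} {ℓ' : E' → ℝ} (hℓ' : ∀ e, 0 ≤ ℓ' e)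
    {g : FreeGroup E} {h : FreeGroup E'} {c C : ℝ}
    (H : ∀ k : ℕ, wlen ℓ' (h ^ k) ≤ c * wlen ℓ (g ^ k) + C) : tl ℓ' h ≤ c * tl ℓ g := by
  by_contra! hlt
  obtain ⟨k, hk⟩ := exists_nat_gt
    ((c * (2 * lsum ℓ (FreeGroup.reduceCyclically.conjugator g.toWord)) + C) /
      (tl ℓ' h - c * tl ℓ g))
  rw [div_lt_iff₀ (by linarith)] at hk
  have := H (k + 1)
  rw [wlen_pow, wlen_pow] at this
  nlinarith [lsum_nonneg hℓ' (FreeGroup.reduceCyclically.conjugator h.toWord)]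

lemma tl_hom_le {ℓ : E → ℝ} {ℓ' : E' → ℝ} (hℓ' : ∀ e, 0 ≤ ℓ' e)
    (φ : FreeGroup E →* FreeGroup E') (h : ∀ e, wlen ℓ' (φ (FreeGroup.of e)) ≤ ℓ e)
    (g : FreeGroup E) : tl ℓ' (φ g) ≤ tl ℓ g := by
  have := tl_le_of_wlen_pow_le (ℓ := ℓ) hℓ' (g := g) (h := φ g) (c := 1) (C := 0) fun k => by
    rw [← map_pow]; linarith [wlen_hom_le hℓ' φ h (g ^ k)]
  linarith

lemma tl_hom_le_mul {ℓ : E → ℝ} {ℓ' : E' → ℝ} (hℓ' : ∀ e, 0 ≤ ℓ' e)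
    (φ : FreeGroup E →* FreeGroup E') {c : ℝ}
    (h : ∀ e, wlen ℓ' (φ (FreeGroup.of e)) ≤ c * ℓ e)
    (g : FreeGroup E) : tl ℓ' (φ g) ≤ c * tl ℓ g := by
  have := tl_hom_le hℓ' φ h g
  rwa [tl, tl, lsum_smul] at this

lemma tl_mono {ℓ ℓ' : E → ℝ} (h : ∀ e, ℓ e ≤ ℓ' e) (g : FreeGroup E) :
    tl ℓ g ≤ tl ℓ' g := lsum_mono h _

lemma tl_conj_le {ℓ : E → ℝ} (hℓ : ∀ e, 0 ≤ ℓ e) (g p : FreeGroup E) :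
    tl ℓ (p * g * p⁻¹) ≤ tl ℓ g := by
  have := tl_le_of_wlen_pow_le (ℓ := ℓ) hℓ (g := g) (h := p * g * p⁻¹) (c := 1)
    (C := 2 * wlen ℓ p) fun k => by
      rw [conj_pow]
      have h1 := wlen_mul_le hℓ (p * g ^ k) p⁻¹
      have h2 := wlen_mul_le hℓ p (g ^ k)
      rw [wlen_inv] at h1
      linarith
  linarith

@[simp] lemma tl_conj {ℓ : E → ℝ} (hℓ : ∀ e, 0 ≤ ℓ e) (g p : FreeGroup E) :
    tl ℓ (p * g * p⁻¹) = tl ℓ g := by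
  refine le_antisymm (tl_conj_le hℓ g p) ?_
  have := tl_conj_le hℓ (p * g * p⁻¹) p⁻¹
  rwa [show p⁻¹ * (p * g * p⁻¹) * p⁻¹⁻¹ = g by group] at this

lemma tl_conj_inv {ℓ : E → ℝ} (hℓ : ∀ e, 0 ≤ ℓ e) (g p : FreeGroup E) :
    tl ℓ (p⁻¹ * g * p) = tl ℓ g := by
  simpa using tl_conj hℓ g p⁻¹

@[simp] lemma tl_one (ℓ : E → ℝ) : tl ℓ (1 : FreeGroup E) = 0 := by simp [tl]

lemma tl_mk_of_isCyclicallyReduced {ℓ : E → ℝ} (hℓ : ∀ e, 0 ≤ ℓ e) {L : List (E × Bool)}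
    (h : FreeGroup.IsCyclicallyReduced L) : tl ℓ (FreeGroup.mk L) = lsum ℓ L := by
  have key : ∀ k : ℕ, wlen ℓ ((FreeGroup.mk L) ^ k) = k * lsum ℓ L := by
    intro k
    rw [wlen, FreeGroup.toWord_pow, FreeGroup.toWord_mk, h.isReduced.reduce_eq,
      (h.flatten_replicate k).isReduced.reduce_eq, lsum_flatten_replicate]
  refine le_antisymm ?_ ?_
  · have := tl_le_wlen hℓ (FreeGroup.mk L)
    rwa [wlen_mk_of_isReduced _ h.isReduced] at this
  · by_contra! hlt
    obtain ⟨k, hk⟩ := exists_nat_gt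
      ((2 * lsum ℓ (FreeGroup.reduceCyclically.conjugator (FreeGroup.mk L).toWord)) /
        (lsum ℓ L - tl ℓ (FreeGroup.mk L)))
    rw [div_lt_iff₀ (by linarith)] at hk
    have := key (k + 1)
    rw [wlen_pow] at this
    push_cast at this
    nlinarith

lemma mk_cons (d : E × Bool) (L : List (E × Bool)) :
    FreeGroup.mk (d :: L) = FreeGroup.mk [d] * FreeGroup.mk L := by
  rw [FreeGroup.mul_mk]; rfl

lemma mk_append (L M : List (E × Bool)) :
    FreeGroup.mk (L ++ M) = FreeGroup.mk L * FreeGroup.mk M := FreeGroup.mul_mk.symm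

lemma mk_singleton_false (e : E) : FreeGroup.mk [(e, false)] = (FreeGroup.of e)⁻¹ := by
  simp [FreeGroup.of, FreeGroup.inv_mk, FreeGroup.invRev]

lemma mk_singleton_true (e : E) : FreeGroup.mk [(e, true)] = FreeGroup.of e := rfl

end WordLength


/-! ### Edge paths and loops in a finite graph -/

namespace FinGraph

variable {Γ : FinGraph}

/-- The reverse of an oriented edge. -/
def bar {E : Type} (d : E × Bool) : E × Bool := (d.1, !d.2)

@[simp] lemma bar_bar {E : Type} (d : E × Bool) : bar (bar d) = d := by simp [bar]

@[simp] lemma bar_fst {E : Type} (d : E × Bool) : (bar d).1 = d.1 := rfl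

lemma bar_ne {E : Type} (d : E × Bool) : bar d ≠ d := by
  obtain ⟨e, b⟩ := d; cases b <;> simp [bar]

lemma bar_injective {E : Type} : Function.Injective (bar : E × Bool → E × Bool) :=
  fun a b h => by simpa using congrArg bar h

lemma eq_or_eq_bar {E : Type} {a b : E × Bool} (h : a.1 = b.1) : a = b ∨ a = bar b := by
  obtain ⟨e, x⟩ := a; obtain ⟨e', y⟩ := b
  obtain rfl : e = e' := h
  cases x <;> cases y <;> simp [bar]

@[simp] lemma init_bar (d : Γ.E × Bool) : Γ.init (bar d) = Γ.term d := by
  obtain ⟨e, b⟩ := d; cases b <;> simp [bar, init, term]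

@[simp] lemma term_bar (d : Γ.E × Bool) : Γ.term (bar d) = Γ.init d := by
  obtain ⟨e, b⟩ := d; cases b <;> simp [bar, init, term]

lemma invRev_eq {E : Type} (L : List (E × Bool)) : FreeGroup.invRev L = (L.map bar).reverse := rfl

@[simp] lemma isWalk_nil {u v : Γ.V} : Γ.IsWalk u v [] ↔ u = v := Iff.rfl

@[simp] lemma isWalk_cons {u v : Γ.V} {d : Γ.E × Bool} {L : List (Γ.E × Bool)} :
    Γ.IsWalk u v (d :: L) ↔ Γ.init d = u ∧ Γ.IsWalk (Γ.term d) v L := Iff.rfl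

lemma isWalk_append {u v : Γ.V} {L M : List (Γ.E × Bool)} :
    Γ.IsWalk u v (L ++ M) ↔ ∃ w, Γ.IsWalk u w L ∧ Γ.IsWalk w v M := by
  induction L generalizing u with
  | nil => simp
  | cons d L ih => simp [ih, and_assoc]

lemma isWalk_end_unique {u v w : Γ.V} {L : List (Γ.E × Bool)} (h : Γ.IsWalk u v L)
    (h' : Γ.IsWalk u w L) : v = w := by
  induction L generalizing u with
  | nil => exact h.symm.trans h'
  | cons d L ih => exact ih h.2 h'.2

lemma isWalk_invRev {u v : Γ.V} {L : List (Γ.E × Bool)} (h : Γ.IsWalk u v L) :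
    Γ.IsWalk v u (FreeGroup.invRev L) := by
  induction L generalizing u with
  | nil => simpa [FreeGroup.invRev] using (Eq.symm h : v = u)
  | cons d L ih =>
    rw [invRev_eq, List.map_cons, List.reverse_cons, isWalk_append]
    refine ⟨_, ih h.2, ?_⟩
    simp [h.1]

lemma isWalk_red {u v : Γ.V} {L M : List (Γ.E × Bool)} (h : Γ.IsWalk u v L)
    (hr : FreeGroup.Red L M) : Γ.IsWalk u v M := by
  induction hr with
  | refl => exact h
  | tail _ hs ih =>
    cases hs with
    | @not L₁ L₂ x b =>
      obtain ⟨w, h1, h2, h3, h4⟩ := isWalk_append.1 ih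
      refine isWalk_append.2 ⟨w, h1, ?_⟩
      have : Γ.term (x, !b) = w := by
        rw [← h2]; exact term_bar (x, b)
      rwa [this] at h4

lemma isWalk_toWord {u v : Γ.V} {g : FreeGroup Γ.E} (h : g ∈ Γ.pathClass u v) :
    Γ.IsWalk u v g.toWord := by
  obtain ⟨L, hL, rfl⟩ := h
  rw [FreeGroup.toWord_mk]
  exact isWalk_red hL FreeGroup.reduce.red

lemma mk_mem_pathClass {u v : Γ.V} {L : List (Γ.E × Bool)} (h : Γ.IsWalk u v L) :
    FreeGroup.mk L ∈ Γ.pathClass u v := ⟨L, h, rfl⟩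

lemma one_mem_pathClass (u : Γ.V) : (1 : FreeGroup Γ.E) ∈ Γ.pathClass u u := ⟨[], rfl, rfl⟩

lemma one_mem_pathClass_of_eq {u v : Γ.V} (h : u = v) :
    (1 : FreeGroup Γ.E) ∈ Γ.pathClass u v := h ▸ one_mem_pathClass u

lemma mul_mem_pathClass {u v w : Γ.V} {g h : FreeGroup Γ.E} (hg : g ∈ Γ.pathClass u v)
    (hh : h ∈ Γ.pathClass v w) : g * h ∈ Γ.pathClass u w := by
  obtain ⟨L, hL, rfl⟩ := hg
  obtain ⟨M, hM, rfl⟩ := hh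
  exact ⟨L ++ M, isWalk_append.2 ⟨v, hL, hM⟩, mk_append L M⟩

lemma inv_mem_pathClass {u v : Γ.V} {g : FreeGroup Γ.E} (hg : g ∈ Γ.pathClass u v) :
    g⁻¹ ∈ Γ.pathClass v u := by
  obtain ⟨L, hL, rfl⟩ := hg
  exact ⟨_, isWalk_invRev hL, FreeGroup.inv_mk.symm⟩

lemma of_mem_pathClass (e : Γ.E) : FreeGroup.of e ∈ Γ.pathClass (Γ.src e) (Γ.tgt e) :=
  ⟨[(e, true)], by simp [init, term], rfl⟩

lemma mk_singleton_mem_pathClass (d : Γ.E × Bool) :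
    FreeGroup.mk [d] ∈ Γ.pathClass (Γ.init d) (Γ.term d) := ⟨[d], by simp, rfl⟩

/-- A statement about homotopy classes of paths that holds for edges, for constant paths, and for
products and inverses, holds for all. -/
lemma pathClass_induction {P : Γ.V → Γ.V → FreeGroup Γ.E → Prop}
    (one : ∀ u, P u u 1) (of : ∀ e, P (Γ.src e) (Γ.tgt e) (FreeGroup.of e))
    (mul : ∀ u v w g h, P u v g → P v w h → P u w (g * h))
    (inv : ∀ u v g, P u v g → P v u g⁻¹) {u v : Γ.V} {g : FreeGroup Γ.E}
    (hg : g ∈ Γ.pathClass u v) : P u v g := by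
  obtain ⟨L, hL, rfl⟩ := hg
  induction L generalizing u with
  | nil => obtain rfl : u = v := hL; exact one u
  | cons d L ih =>
    rw [mk_cons]
    obtain ⟨h1, h2⟩ := hL
    refine mul _ _ _ _ _ ?_ (ih h2)
    obtain ⟨e, b⟩ := d
    subst h1
    cases b
    · rw [mk_singleton_false]; exact inv _ _ _ (of e)
    · exact of e

lemma hom_mem_pathClass {Γ' : FinGraph} (φ : FreeGroup Γ.E →* FreeGroup Γ'.E) (φV : Γ.V → Γ'.V)
    (h : ∀ e, φ (FreeGroup.of e) ∈ Γ'.pathClass (φV (Γ.src e)) (φV (Γ.tgt e)))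
    {u v : Γ.V} {g : FreeGroup Γ.E} (hg : g ∈ Γ.pathClass u v) :
    φ g ∈ Γ'.pathClass (φV u) (φV v) := by
  refine pathClass_induction (P := fun u v g => φ g ∈ Γ'.pathClass (φV u) (φV v))
    ?_ h ?_ ?_ hg
  · intro u; rw [map_one]; exact one_mem_pathClass _
  · intro u v w g h hg hh; rw [map_mul]; exact mul_mem_pathClass hg hh
  · intro u v g hg; rw [map_inv]; exact inv_mem_pathClass hg

/-- If a homomorphism changes edges by a gauge `c`, it changes all paths by `c`. -/
lemma hom_gauge {G : Type} [Group G] (φ ψ : FreeGroup Γ.E →* G) (c : Γ.V → G)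
    (h : ∀ e, φ (FreeGroup.of e) = (c (Γ.src e))⁻¹ * ψ (FreeGroup.of e) * c (Γ.tgt e))
    {u v : Γ.V} {g : FreeGroup Γ.E} (hg : g ∈ Γ.pathClass u v) :
    φ g = (c u)⁻¹ * ψ g * c v := by
  refine pathClass_induction (P := fun u v g => φ g = (c u)⁻¹ * ψ g * c v) ?_ h ?_ ?_ hg
  · intro u; simp
  · intro u v w g h hg hh; rw [map_mul, hg, hh, map_mul]; group
  · intro u v g hg; rw [map_inv, hg, map_inv]; group

/-- Two consecutive oriented edges of an edge path without backtracking. -/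
def Turn (Γ : FinGraph) (a b : Γ.E × Bool) : Prop := Γ.term a = Γ.init b ∧ b ≠ bar a

lemma Turn.bar {a b : Γ.E × Bool} (h : Γ.Turn a b) : Γ.Turn (bar b) (bar a) :=
  ⟨by simp [h.1], fun h' => h.2 (by rw [bar_injective h', bar_bar])⟩

lemma isReduced_of_isChain {L : List (Γ.E × Bool)} (h : L.IsChain Γ.Turn) :
    FreeGroup.IsReduced L := by
  refine List.IsChain.imp (fun a b hab h1 => ?_) h
  rcases eq_or_eq_bar h1 with h2 | h2
  · rw [h2]
  · exact absurd (by rw [h2, bar_bar]) hab.2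

lemma isChain_of_isWalk {u v : Γ.V} {L : List (Γ.E × Bool)} (h : Γ.IsWalk u v L)
    (hr : FreeGroup.IsReduced L) : L.IsChain Γ.Turn := by
  induction L generalizing u with
  | nil => exact List.isChain_nil
  | cons d L ih =>
    rw [FreeGroup.IsReduced, List.isChain_cons] at hr
    refine List.isChain_cons.2 ⟨fun y hy => ?_, ih h.2 hr.2⟩
    cases L with
    | nil => simp at hy
    | cons e L =>
      obtain rfl : e = y := by simpa using hy
      refine ⟨h.2.1.symm, fun h' => ?_⟩
      have := hr.1 e (by simp) (by rw [h']; rfl)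
      rw [h'] at this
      simp [FinGraph.bar] at this

lemma isWalk_of_isChain {d : Γ.E × Bool} {L : List (Γ.E × Bool)}
    (h : (d :: L).IsChain Γ.Turn) :
    Γ.IsWalk (Γ.init d) (Γ.term ((d :: L).getLast (by simp))) (d :: L) := by
  induction L generalizing d with
  | nil => simp
  | cons e L ih =>
    rw [List.isChain_cons_cons] at h
    refine ⟨rfl, ?_⟩
    rw [h.1.1]
    simpa using ih h.2

lemma isChain_invRev {L : List (Γ.E × Bool)} (h : L.IsChain Γ.Turn) :
    (FreeGroup.invRev L).IsChain Γ.Turn := by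
  rw [invRev_eq, List.isChain_reverse, List.isChain_map]
  exact List.IsChain.imp (fun a b hab => hab.bar) h

/-- A cyclically reduced closed edge path of positive length. -/
def IsLoop (Γ : FinGraph) (L : List (Γ.E × Bool)) : Prop := L ≠ [] ∧ (L ++ L).IsChain Γ.Turn

lemma isLoop_iff {L : List (Γ.E × Bool)} : Γ.IsLoop L ↔ L ≠ [] ∧ L.IsChain Γ.Turn ∧
    ∀ x ∈ L.getLast?, ∀ y ∈ L.head?, Γ.Turn x y := by
  rw [IsLoop, List.isChain_append]; tauto

lemma IsLoop.rotate {A B : List (Γ.E × Bool)} (h : Γ.IsLoop (A ++ B)) : Γ.IsLoop (B ++ A) := by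
  refine ⟨by simpa [and_comm] using h.1, ?_⟩
  rcases eq_or_ne A [] with rfl | hA
  · simpa using h.2
  rcases eq_or_ne B [] with rfl | hB
  · simpa using h.2
  have h1 : (A ++ B ++ A).IsChain Γ.Turn := by
    have := h.2
    rw [← List.append_assoc] at this
    exact this.left_of_append
  have h2 : (B ++ A).IsChain Γ.Turn := by
    rw [List.append_assoc] at h1; exact h1.right_of_append
  have h3 : (A ++ B).IsChain Γ.Turn := h1.left_of_append
  have := List.IsChain.append_overlap h2 h3 hA
  have h5 := List.IsChain.append_overlap (this : ((B ++ A) ++ B).IsChain Γ.Turn) h2 hB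
  simpa using h5

lemma IsLoop.isChain {L : List (Γ.E × Bool)} (h : Γ.IsLoop L) : L.IsChain Γ.Turn :=
  h.2.left_of_append

lemma IsLoop.isCyclicallyReduced {L : List (Γ.E × Bool)} (h : Γ.IsLoop L) :
    FreeGroup.IsCyclicallyReduced L := by
  refine ⟨isReduced_of_isChain h.isChain, fun a ha b hb h1 => ?_⟩
  have := (isLoop_iff.1 h).2.2 a ha b hb
  rcases eq_or_eq_bar h1 with h2 | h2
  · rw [h2]
  · exact absurd (by rw [h2, bar_bar]) this.2

lemma IsLoop.isWalk {d : Γ.E × Bool} {L : List (Γ.E × Bool)} (h : Γ.IsLoop (d :: L)) :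
    Γ.IsWalk (Γ.init d) (Γ.init d) (d :: L) := by
  have h1 := isWalk_of_isChain h.isChain
  have := ((isLoop_iff.1 h).2.2 ((d :: L).getLast (by simp))
    (List.getLast?_eq_getLast_of_ne_nil _) d (by simp)).1
  rwa [this] at h1

lemma IsLoop.invRev {L : List (Γ.E × Bool)} (h : Γ.IsLoop L) :
    Γ.IsLoop (FreeGroup.invRev L) := by
  refine ⟨fun h' => h.1 (by simpa [FreeGroup.invRev] using h'), ?_⟩
  rw [← FreeGroup.invRev_append]
  exact isChain_invRev h.2

lemma IsLoop.exists_isWalk {L : List (Γ.E × Bool)} (h : Γ.IsLoop L) : ∃ u, Γ.IsWalk u u L := by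
  cases L with
  | nil => exact absurd rfl h.1
  | cons d L => exact ⟨_, h.isWalk⟩

/-- A closed walk which is cyclically reduced and nonempty is a loop. -/
lemma isLoop_of_isWalk {u : Γ.V} {L : List (Γ.E × Bool)} (h : Γ.IsWalk u u L) (hne : L ≠ [])
    (hr : FreeGroup.IsCyclicallyReduced L) : Γ.IsLoop L := by
  refine isLoop_iff.2 ⟨hne, isChain_of_isWalk h hr.isReduced, fun x hx y hy => ?_⟩
  cases L with
  | nil => exact absurd rfl hne
  | cons d L =>
    obtain rfl : d = y := by simpa using hy
    have h1 := isWalk_of_isChain (isChain_of_isWalk h hr.isReduced)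
    have h2 := h.1
    subst h2
    have h3 := isWalk_end_unique h h1
    obtain rfl : (d :: L).getLast (by simp) = x := by
      rw [List.getLast?_eq_getLast_of_ne_nil (by simp)] at hx
      simpa using hx
    refine ⟨h3.symm, fun h' => ?_⟩
    have h4 := hr.2 _ hx d hy
    generalize (d :: L).getLast (by simp) = x at h4 h'
    have := h4 (by rw [h']; rfl)
    rw [h'] at this
    simp [FinGraph.bar] at this

/-- Cyclic reduction of the word of a closed path stays inside the graph: the conjugator is itself
an edge path, and it leads to the loop. -/
lemma exists_loop_of_mem_pathClass {u : Γ.V} {g : FreeGroup Γ.E} (h : g ∈ Γ.pathClass u u)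
    (hne : g ≠ 1) : ∃ L w, Γ.IsLoop L ∧ Γ.IsWalk w w L ∧
      ∃ p ∈ Γ.pathClass u w, g = p * FreeGroup.mk L * p⁻¹ := by
  have h1 := isWalk_toWord h
  have h2 := FreeGroup.reduceCyclically.conj_conjugator_reduceCyclically g.toWord
  set c := FreeGroup.reduceCyclically.conjugator g.toWord
  set r := FreeGroup.reduceCyclically g.toWord with hr
  have hgr : g = FreeGroup.mk c * FreeGroup.mk r * (FreeGroup.mk c)⁻¹ := by
    rw [FreeGroup.inv_mk, ← mk_append, ← mk_append, h2, FreeGroup.mk_toWord]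
  rw [← h2] at h1
  obtain ⟨w, h3, h4⟩ := isWalk_append.1 h1
  obtain ⟨w', h5, h6⟩ := isWalk_append.1 h3
  have h7 := isWalk_invRev h4
  rw [FreeGroup.invRev_invRev] at h7
  obtain rfl := isWalk_end_unique h5 h7
  refine ⟨r, w', isLoop_of_isWalk h6 (fun h0 => hne ?_)
    (FreeGroup.reduceCyclically.isCyclicallyReduced FreeGroup.isReduced_toWord), h6, _,
    mk_mem_pathClass h5, hgr⟩
  rw [hgr, h0, ← FreeGroup.one_eq_mk]; group

end FinGraph

/-! ### Marked graphs without a valence condition, and their loops -/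

open FinGraph

/-- A marked graph, without a condition on valences. -/
structure PreMarked (n : ℕ) where
  Γ : FinGraph
  base : Γ.V
  reach : ∀ u, ∃ g, g ∈ Γ.pathClass base u
  f : FreeGroup (Fin n) →* FreeGroup Γ.E
  f_injective : Function.Injective f
  f_range : Set.range f = Γ.pathClass base base

/-- Forget the condition on the valences. -/
abbrev MarkedGraph.toPreMarked {n : ℕ} (M : MarkedGraph n) : PreMarked n where
  Γ := M.Γ
  base := M.base
  reach u := by
    obtain ⟨L, hL⟩ := M.connected M.base u
    exact ⟨_, mk_mem_pathClass hL⟩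
  f := M.f
  f_injective := M.f_injective
  f_range := M.f_range

namespace PreMarked

variable {n : ℕ} (M : PreMarked n)

lemma f_mem (g : FreeGroup (Fin n)) : M.f g ∈ M.Γ.pathClass M.base M.base := by
  rw [← M.f_range]; exact ⟨g, rfl⟩

lemma exists_f_eq {W : FreeGroup M.Γ.E} (h : W ∈ M.Γ.pathClass M.base M.base) :
    ∃ g, M.f g = W := by
  rw [← M.f_range] at h; exact h

lemma exists_of_mem_pathClass {u : M.Γ.V} {W : FreeGroup M.Γ.E} (h : W ∈ M.Γ.pathClass u u) :
    ∃ g p, p ∈ M.Γ.pathClass M.base u ∧ M.f g = p * W * p⁻¹ := by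
  obtain ⟨p, hp⟩ := M.reach u
  obtain ⟨g, hg⟩ := M.exists_f_eq (mul_mem_pathClass (mul_mem_pathClass hp h)
    (inv_mem_pathClass hp))
  exact ⟨g, p, hp, hg⟩

lemma exists_loop {g : FreeGroup (Fin n)} (hg : g ≠ 1) :
    ∃ L w, M.Γ.IsLoop L ∧ M.Γ.IsWalk w w L ∧
      ∃ p ∈ M.Γ.pathClass M.base w, M.f g = p * FreeGroup.mk L * p⁻¹ :=
  exists_loop_of_mem_pathClass (M.f_mem g)
    (fun h => hg (M.f_injective (h.trans (map_one M.f).symm)))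

lemma exists_tl_eq {g : FreeGroup (Fin n)} (hg : g ≠ 1) :
    ∃ L, M.Γ.IsLoop L ∧ ∀ ℓ : M.Γ.E → ℝ, (∀ e, 0 ≤ ℓ e) → tl ℓ (M.f g) = lsum ℓ L := by
  obtain ⟨L, -, hL, -, p, -, hp⟩ := M.exists_loop hg
  refine ⟨L, hL, fun ℓ hℓ => ?_⟩
  rw [hp, tl_conj hℓ, tl_mk_of_isCyclicallyReduced hℓ hL.isCyclicallyReduced]

lemma exists_of_isLoop {L : List (M.Γ.E × Bool)} (h : M.Γ.IsLoop L) :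
    ∃ g, g ≠ 1 ∧ (∃ p, M.f g = p * FreeGroup.mk L * p⁻¹) ∧
      ∀ ℓ : M.Γ.E → ℝ, (∀ e, 0 ≤ ℓ e) → tl ℓ (M.f g) = lsum ℓ L := by
  obtain ⟨u, hu⟩ := h.exists_isWalk
  obtain ⟨g, p, -, hp⟩ := M.exists_of_mem_pathClass (mk_mem_pathClass hu)
  refine ⟨g, ?_, ⟨p, hp⟩, fun ℓ hℓ => ?_⟩
  · rintro rfl
    rw [map_one] at hp
    have h1 : FreeGroup.mk L = 1 := by
      have : FreeGroup.mk L = p⁻¹ * (p * FreeGroup.mk L * p⁻¹) * p := by group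
      rw [this, ← hp]; group
    have h2 := congrArg FreeGroup.toWord h1
    rw [FreeGroup.toWord_mk, h.isCyclicallyReduced.isReduced.reduce_eq, FreeGroup.toWord_one] at h2
    exact h.1 h2
  · rw [hp, tl_conj hℓ, tl_mk_of_isCyclicallyReduced hℓ h.isCyclicallyReduced]

end PreMarked


/-! ### Loops that lift to edge-simple loops in a double cover -/

namespace FinGraph

variable {Γ : FinGraph}

lemma exists_eq_append_of_not_nodup {α β : Type} (f : α → β) {M : List α}
    (h : ¬ (M.map f).Nodup) : ∃ X a C b Y, M = X ++ a :: (C ++ b :: Y) ∧ f a = f b := by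
  induction M with
  | nil => simp at h
  | cons a M ih =>
    by_cases ha : f a ∈ M.map f
    · obtain ⟨b, hb, hab⟩ := List.mem_map.1 ha
      obtain ⟨C, Y, rfl⟩ := List.append_of_mem hb
      exact ⟨[], a, C, b, Y, rfl, hab.symm⟩
    · obtain ⟨X, a', C, b, Y, rfl, h1⟩ := ih (fun h' => h (by
        rw [List.map_cons, List.nodup_cons]; exact ⟨ha, h'⟩))
      exact ⟨a :: X, a', C, b, Y, rfl, h1⟩

lemma IsLoop.split {d : Γ.E × Bool} {A B : List (Γ.E × Bool)}
    (h : Γ.IsLoop (d :: A ++ d :: B)) : Γ.IsLoop (d :: A) ∧ Γ.IsLoop (d :: B) := by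
  have key : ∀ A B : List (Γ.E × Bool), Γ.IsLoop (d :: A ++ d :: B) → Γ.IsLoop (d :: A) := by
    intro A B h
    have h1 := h.isChain
    rw [List.isChain_append] at h1
    exact isLoop_iff.2 ⟨by simp, h1.1, fun x hx y hy => h1.2.2 x hx y (by simpa using hy)⟩
  exact ⟨key A B h, key B A h.rotate⟩

/-- A loop through an oriented edge twice splits, up to rotation, into two loops. -/
lemma IsLoop.exists_split {L : List (Γ.E × Bool)} (h : Γ.IsLoop L) (hd : ¬ L.Nodup) :
    ∃ A B, Γ.IsLoop A ∧ Γ.IsLoop B ∧ (A ++ B).Perm L := by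
  obtain ⟨X, d, A, d', B, rfl, hdd⟩ := exists_eq_append_of_not_nodup id (by simpa using hd)
  obtain rfl : d = d' := hdd
  have h1 : Γ.IsLoop (d :: A ++ d :: (B ++ X)) := by simpa using h.rotate
  refine ⟨_, _, h1.split.1, h1.split.2, ?_⟩
  have : (d :: A ++ d :: (B ++ X)) = (d :: (A ++ d :: B)) ++ X := by simp
  rw [this]
  exact List.perm_append_comm

/-- Splitting at a repeated oriented edge gives two shorter loops of the same total weight. Hence
extremal questions about loops reduce to finitely many of them. -/
lemma lsum_le_zero_of_nodup {m : Γ.E → ℝ}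
    (H : ∀ L, Γ.IsLoop L → L.Nodup → lsum m L ≤ 0) :
    ∀ L, Γ.IsLoop L → lsum m L ≤ 0 := by
  intro L
  induction hk : L.length using Nat.strong_induction_on generalizing L with
  | _ k ih =>
    intro hL
    by_cases hd : L.Nodup
    · exact H L hL hd
    · obtain ⟨A, B, hA, hB, hp⟩ := hL.exists_split hd
      have h1 := List.length_pos_of_ne_nil hA.1
      have h2 := List.length_pos_of_ne_nil hB.1
      have h3 := hp.length_eq
      rw [List.length_append] at h3
      have h4 := ih A.length (by omega) A rfl hA
      have h5 := ih B.length (by omega) B rfl hB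
      rw [← lsum_perm m hp, lsum_append]
      linarith

/-- Two crossings of one edge have opposite directions here. If the segment between them still
repeats an edge, pass to that shorter segment. -/
lemma exists_innermost_pair {E : Type} {M : List (E × Bool)} (h1 : M.Nodup)
    (h2 : ¬ (M.map Prod.fst).Nodup) :
    ∃ X g C Y, M = X ++ g :: (C ++ bar g :: Y) ∧ (C.map Prod.fst).Nodup := by
  induction hk : M.length using Nat.strong_induction_on generalizing M with
  | _ k ih =>
    obtain ⟨X, a, C, b, Y, rfl, hab⟩ := exists_eq_append_of_not_nodup Prod.fst h2
    obtain rfl : b = bar a := by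
      rcases eq_or_eq_bar hab with rfl | h
      · exact absurd h1 (by simp [List.nodup_append, List.nodup_cons])
      · rw [h, bar_bar]
    by_cases hC : (C.map Prod.fst).Nodup
    · exact ⟨X, a, C, Y, rfl, hC⟩
    · have hCn : C.Nodup := by
        refine List.Nodup.sublist ?_ h1
        exact (((List.sublist_append_left C _).trans (List.sublist_cons_self a _)).trans
          (List.sublist_append_right X _))
      obtain ⟨X', g, C', Y', rfl, hC'⟩ := ih C.length (by simp at hk; omega) hCn hC rfl
      exact ⟨X ++ a :: X', g, C', Y' ++ bar a :: Y, by simp, hC'⟩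

/-- The last letter of `X` may be followed by the first letter of `Y`. -/
def Junction (Γ : FinGraph) (X Y : List (Γ.E × Bool)) : Prop :=
  ∀ x ∈ X.getLast?, ∀ y ∈ Y.head?, Γ.Turn x y

lemma isLoop_append_four {A P C Q : List (Γ.E × Bool)} (hA : A ≠ []) (hP : P ≠ []) (hC : C ≠ [])
    (hQ : Q ≠ []) : Γ.IsLoop (A ++ (P ++ (C ++ Q))) ↔
      (A.IsChain Γ.Turn ∧ P.IsChain Γ.Turn ∧ C.IsChain Γ.Turn ∧ Q.IsChain Γ.Turn) ∧
      Γ.Junction A P ∧ Γ.Junction P C ∧ Γ.Junction C Q ∧ Γ.Junction Q A := by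
  rw [isLoop_iff]
  simp only [List.isChain_append, Junction]
  have e1 : (A ++ (P ++ (C ++ Q))).getLast? = Q.getLast? := by
    simp [List.getLast?_append, List.getLast?_eq_getLast_of_ne_nil hQ]
  have e2 : (A ++ (P ++ (C ++ Q))).head? = A.head? := List.head?_append_of_ne_nil _ hA
  have e3 : (P ++ (C ++ Q)).head? = P.head? := List.head?_append_of_ne_nil _ hP
  have e4 : (C ++ Q).head? = C.head? := List.head?_append_of_ne_nil _ hC
  rw [e1, e2, e3, e4]
  have e5 : A ++ (P ++ (C ++ Q)) ≠ [] := by simp [hA]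
  tauto

lemma head?_invRev {E : Type} (L : List (E × Bool)) :
    (FreeGroup.invRev L).head? = L.getLast?.map bar := by
  simp [invRev_eq]

lemma getLast?_invRev {E : Type} (L : List (E × Bool)) :
    (FreeGroup.invRev L).getLast? = L.head?.map bar := by
  simp [invRev_eq]

lemma invRev_ne_nil {E : Type} {L : List (E × Bool)} (h : L ≠ []) : FreeGroup.invRev L ≠ [] := by
  simpa [FreeGroup.invRev] using h

/-- Replace the way back of a loop by the reverse of the way there. -/
lemma IsLoop.dumbbell {A P C Q : List (Γ.E × Bool)} (hA : A ≠ []) (hP : P ≠ []) (hC : C ≠ [])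
    (hQ : Q ≠ []) (h : Γ.IsLoop (A ++ (P ++ (C ++ Q)))) (h1 : Q.head? = P.getLast?.map bar)
    (h2 : Q.getLast? = P.head?.map bar) : Γ.IsLoop (A ++ (P ++ (C ++ FreeGroup.invRev P))) := by
  rw [isLoop_append_four hA hP hC hQ] at h
  obtain ⟨⟨a1, a2, a3, a4⟩, b1, b2, b3, b4⟩ := h
  rw [isLoop_append_four hA hP hC (invRev_ne_nil hP)]
  refine ⟨⟨a1, a2, a3, isChain_invRev a2⟩, b1, b2, ?_, ?_⟩
  · rw [Junction, head?_invRev, ← h1]; exact b3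
  · rw [Junction, getLast?_invRev, ← h2]; exact b4

/-- Reverse one of the two circles of a dumbbell. -/
lemma IsLoop.dumbbell_reverse {A P C : List (Γ.E × Bool)} (hA : A ≠ []) (hP : P ≠ [])
    (hC : C ≠ []) (h : Γ.IsLoop (A ++ (P ++ (C ++ FreeGroup.invRev P)))) :
    Γ.IsLoop (FreeGroup.invRev A ++ (P ++ (C ++ FreeGroup.invRev P))) := by
  rw [isLoop_append_four hA hP hC (invRev_ne_nil hP)] at h
  obtain ⟨⟨a1, a2, a3, a4⟩, b1, b2, b3, b4⟩ := h
  rw [isLoop_append_four (invRev_ne_nil hA) hP hC (invRev_ne_nil hP)]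
  refine ⟨⟨isChain_invRev a1, a2, a3, a4⟩, ?_, b2, b3, ?_⟩
  · intro x hx y hy
    rw [getLast?_invRev] at hx
    obtain ⟨z, hz, rfl⟩ := Option.mem_map.1 hx
    have := (b4 (bar y) (by rw [getLast?_invRev]; exact Option.mem_map_of_mem _ hy) z hz).bar
    rwa [bar_bar] at this
  · intro x hx y hy
    rw [getLast?_invRev] at hx
    rw [head?_invRev] at hy
    obtain ⟨z, hz, rfl⟩ := Option.mem_map.1 hx
    obtain ⟨w, hw, rfl⟩ := Option.mem_map.1 hy
    exact (b1 w hw z hz).bar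

/-! ### Lifts to double covers, and extremal loops -/

/-- The lift of an edge path to the double cover given by `ρ`, starting in the sheet `s`: the list
of the edges of the double cover that it traverses. -/
def liftPath {E : Type} (ρ : E → ZMod 2) : ZMod 2 → List (E × Bool) → List (E × ZMod 2)
  | _, [] => []
  | s, d :: L => (d.1, if d.2 then s else s + ρ d.1) :: liftPath ρ (s + ρ d.1) L

/-- The difference of the sheets of the two ends of a lift of an edge path. -/
def sheet {E : Type} (ρ : E → ZMod 2) (L : List (E × Bool)) : ZMod 2 :=
  (L.map fun d => ρ d.1).sum

lemma liftPath_append {E : Type} (ρ : E → ZMod 2) (s : ZMod 2) (L M : List (E × Bool)) :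
    liftPath ρ s (L ++ M) = liftPath ρ s L ++ liftPath ρ (s + sheet ρ L) M := by
  induction L generalizing s with
  | nil => simp [liftPath, sheet]
  | cons d L ih => simp [liftPath, ih, sheet, add_assoc]

@[simp] lemma sheet_append {E : Type} (ρ : E → ZMod 2) (L M : List (E × Bool)) :
    sheet ρ (L ++ M) = sheet ρ L + sheet ρ M := by simp [sheet]

@[simp] lemma sheet_cons {E : Type} (ρ : E → ZMod 2) (d : E × Bool) (L : List (E × Bool)) :
    sheet ρ (d :: L) = ρ d.1 + sheet ρ L := by simp [sheet]

lemma sheet_eq_zero {E : Type} {ρ : E → ZMod 2} {L : List (E × Bool)}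
    (h : ∀ d ∈ L, ρ d.1 = 0) : sheet ρ L = 0 := by
  induction L with
  | nil => rfl
  | cons d L ih =>
    rw [sheet_cons, h d (by simp), ih fun d hd => h d (List.mem_cons_of_mem _ hd), add_zero]

lemma liftPath_eq_map {E : Type} {ρ : E → ZMod 2} {L : List (E × Bool)}
    (h : ∀ d ∈ L, ρ d.1 = 0) (s : ZMod 2) : liftPath ρ s L = L.map fun d => (d.1, s) := by
  induction L with
  | nil => rfl
  | cons d L ih =>
    have h1 := h d (by simp)
    simp [liftPath, h1, ih fun d hd => h d (List.mem_cons_of_mem _ hd)]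

lemma map_fst_liftPath {E : Type} (ρ : E → ZMod 2) (s : ZMod 2) (L : List (E × Bool)) :
    (liftPath ρ s L).map Prod.fst = L.map Prod.fst := by
  induction L generalizing s with
  | nil => rfl
  | cons d L ih => simp [liftPath, ih]

/-- The path lifts to a closed path in the double cover given by `ρ`, traversing each edge at most
once. -/
def LiftsSimply {E : Type} (ρ : E → ZMod 2) (L : List (E × Bool)) : Prop :=
  sheet ρ L = 0 ∧ (liftPath ρ 0 L).Nodup

lemma liftsSimply_of_nodup {E : Type} {L : List (E × Bool)} (h : (L.map Prod.fst).Nodup) :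
    LiftsSimply (fun _ => 0) L := by
  refine ⟨sheet_eq_zero fun _ _ => rfl, List.Nodup.of_map Prod.fst ?_⟩
  rwa [map_fst_liftPath]

/-- The sheet changes on exactly one edge of each circle. So the two passages through the bar `P`
happen in different sheets, and the second circle closes the lift. -/
lemma liftsSimply_dumbbell {E : Type} [DecidableEq E] {a c : E × Bool} {A P C : List (E × Bool)}
    (h : ((a :: A ++ (P ++ c :: C)).map Prod.fst).Nodup) :
    LiftsSimply (fun e => if e = a.1 ∨ e = c.1 then 1 else 0)
      (a :: A ++ (P ++ (c :: C ++ FreeGroup.invRev P))) := by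
  set ρ : E → ZMod 2 := fun e => if e = a.1 ∨ e = c.1 then 1 else 0 with hρ
  have ha : ρ a.1 = 1 := by simp [hρ]
  have hc : ρ c.1 = 1 := by simp [hρ]
  simp only [List.map_append, List.map_cons, List.cons_append, List.nodup_cons,
    List.nodup_append, List.mem_append, List.mem_cons, List.mem_map] at h
  obtain ⟨h1, h2, ⟨h3, ⟨h4, h5⟩, h6⟩, h7⟩ := h
  have hA : ∀ d ∈ A, ρ d.1 = 0 := by
    intro d hd
    have e1 : d.1 ≠ a.1 := fun e => h1 (Or.inl ⟨d, hd, e⟩)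
    have e2 : d.1 ≠ c.1 := h7 _ ⟨d, hd, rfl⟩ _ (Or.inr (Or.inl rfl))
    simp [hρ, e1, e2]
  have hP : ∀ d ∈ P, ρ d.1 = 0 := by
    intro d hd
    have e1 : d.1 ≠ a.1 := fun e => h1 (Or.inr (Or.inl ⟨d, hd, e⟩))
    have e2 : d.1 ≠ c.1 := h6 _ ⟨d, hd, rfl⟩ _ (Or.inl rfl)
    simp [hρ, e1, e2]
  have hC : ∀ d ∈ C, ρ d.1 = 0 := by
    intro d hd
    have e1 : d.1 ≠ a.1 := fun e => h1 (Or.inr (Or.inr (Or.inr ⟨d, hd, e⟩)))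
    have e2 : d.1 ≠ c.1 := fun e => h4 ⟨d, hd, e⟩
    simp [hρ, e1, e2]
  have hP' : ∀ d ∈ FreeGroup.invRev P, ρ d.1 = 0 := by
    intro d hd
    rw [invRev_eq, List.mem_reverse, List.mem_map] at hd
    obtain ⟨d', hd', rfl⟩ := hd
    exact hP d' hd'
  have h11 : (1 : ZMod 2) + 1 = 0 := by decide
  constructor
  · simp [sheet_eq_zero hA, sheet_eq_zero hP, sheet_eq_zero hC, sheet_eq_zero hP', ha, hc, h11]
  · simp only [List.cons_append, liftPath, liftPath_append, sheet_eq_zero hA, sheet_eq_zero hP,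
      sheet_eq_zero hC, liftPath_eq_map hA, liftPath_eq_map hP, liftPath_eq_map hC,
      liftPath_eq_map hP', ha, hc, h11, add_zero, zero_add]
    have hn : ∀ s : ZMod 2, Function.Injective (fun e : E => (e, s)) := fun s x y h => by
      simpa using h
    have hm : ∀ (s : ZMod 2) (L : List (E × Bool)), (L.map Prod.fst).Nodup →
        (L.map fun d => (d.1, s)).Nodup := fun s L hL => by
      have := hL.map (hn s)
      rwa [List.map_map] at this
    have hPr : ((FreeGroup.invRev P).map Prod.fst).Nodup := by
      rw [invRev_eq, List.map_reverse, List.nodup_reverse, List.map_map]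
      exact h3
    simp only [List.nodup_cons, List.nodup_append, List.mem_append, List.mem_cons, List.mem_map]
    refine ⟨?_, hm _ _ h2, ⟨hm _ _ h3, ⟨?_, hm _ _ h5, hm _ _ hPr, ?_⟩, ?_⟩, ?_⟩
    · rintro (⟨d, hd, e⟩ | ⟨d, hd, e⟩ | e | ⟨d, hd, e⟩ | ⟨d, hd, e⟩)
      · exact h1 (Or.inl ⟨d, hd, (Prod.ext_iff.1 e).1⟩)
      · exact h1 (Or.inr (Or.inl ⟨d, hd, (Prod.ext_iff.1 e).1⟩))
      · exact h1 (Or.inr (Or.inr (Or.inl ((Prod.ext_iff.1 e).1))))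
      · exact h1 (Or.inr (Or.inr (Or.inr ⟨d, hd, (Prod.ext_iff.1 e).1⟩)))
      · rw [invRev_eq, List.mem_reverse, List.mem_map] at hd
        obtain ⟨d', hd', rfl⟩ := hd
        exact h1 (Or.inr (Or.inl ⟨d', hd', (Prod.ext_iff.1 e).1⟩))
    · rintro (⟨d, hd, e⟩ | ⟨d, hd, e⟩)
      · exact h4 ⟨d, hd, (Prod.ext_iff.1 e).1⟩
      · rw [invRev_eq, List.mem_reverse, List.mem_map] at hd
        obtain ⟨d', hd', rfl⟩ := hd
        exact h6 _ ⟨d', hd', rfl⟩ _ (Or.inl rfl) ((Prod.ext_iff.1 e).1)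
    · rintro _ ⟨d, hd, rfl⟩ _ ⟨d', hd', rfl⟩ e
      rw [invRev_eq, List.mem_reverse, List.mem_map] at hd'
      obtain ⟨d', hd', rfl⟩ := hd'
      exact h6 _ ⟨d', hd', rfl⟩ _ (Or.inr ⟨d, hd, rfl⟩) (Prod.ext_iff.1 e).1.symm
    · rintro _ ⟨d, hd, rfl⟩ _ (rfl | ⟨d', hd', rfl⟩ | ⟨d', hd', rfl⟩) e
      · exact h6 _ ⟨d, hd, rfl⟩ _ (Or.inl rfl) ((Prod.ext_iff.1 e).1)
      · exact h6 _ ⟨d, hd, rfl⟩ _ (Or.inr ⟨d', hd', rfl⟩) ((Prod.ext_iff.1 e).1)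
      · exact absurd (Prod.ext_iff.1 e).2 (by simp)
    · rintro _ ⟨d, hd, rfl⟩ _ (⟨d', hd', rfl⟩ | rfl | ⟨d', hd', rfl⟩ | ⟨d', hd', rfl⟩) e
      · exact h7 _ ⟨d, hd, rfl⟩ _ (Or.inl ⟨d', hd', rfl⟩) ((Prod.ext_iff.1 e).1)
      · exact h7 _ ⟨d, hd, rfl⟩ _ (Or.inr (Or.inl rfl)) ((Prod.ext_iff.1 e).1)
      · exact absurd (Prod.ext_iff.1 e).2 (by simp)
      · exact absurd (Prod.ext_iff.1 e).2 (by simp)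

/-- If all loops have weight at most zero, and some loop has weight zero, then some loop of weight
zero lifts to an edge-simple loop in a double cover. -/
lemma exists_liftsSimply {m : Γ.E → ℝ} (hm : ∀ L, Γ.IsLoop L → lsum m L ≤ 0)
    (h0 : ∃ L, Γ.IsLoop L ∧ lsum m L = 0) :
    ∃ L ρ, Γ.IsLoop L ∧ lsum m L = 0 ∧ LiftsSimply ρ L := by
  classical
  -- Take a loop of weight zero with the fewest edges; minimality forbids every shortcut below.
  have hex : ∃ k L, Γ.IsLoop L ∧ lsum m L = 0 ∧ L.length = k := by
    obtain ⟨L, h1, h2⟩ := h0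
    exact ⟨_, L, h1, h2, rfl⟩
  set k := Nat.find hex with hk
  obtain ⟨L, hL, hL0, hLk⟩ := Nat.find_spec hex
  have hmin : ∀ M, Γ.IsLoop M → lsum m M = 0 → k ≤ M.length := fun M h1 h2 =>
    Nat.find_min' hex ⟨M, h1, h2, rfl⟩
  -- Two loops into which `M` splits have weights at most zero with sum zero. So both have weight
  -- zero, and both are shorter than the minimum.
  have hnodup : ∀ M, Γ.IsLoop M → lsum m M = 0 → M.length ≤ k → M.Nodup := by
    intro M h1 h2 h3
    by_contra hd
    obtain ⟨A, B, hA, hB, hp⟩ := h1.exists_split hd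
    have e1 := lsum_perm m hp
    have e2 := hp.length_eq
    rw [lsum_append] at e1
    rw [List.length_append] at e2
    have e3 := hmin A hA (by linarith [hm A hA, hm B hB])
    have e4 := List.length_pos_of_ne_nil hB.1
    omega
  have hLn := hnodup L hL hL0 hLk.le
  by_cases hs : (L.map Prod.fst).Nodup
  · exact ⟨L, _, hL, hL0, liftsSimply_of_nodup hs⟩
  -- two innermost circles `A` and `C`
  have hdec : ∃ A P C Q, A ≠ [] ∧ P ≠ [] ∧ C ≠ [] ∧ Q ≠ [] ∧ (A ++ (P ++ (C ++ Q))).Perm L ∧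
      Γ.IsLoop (A ++ (P ++ (C ++ Q))) ∧ Q.head? = P.getLast?.map bar ∧
      Q.getLast? = P.head?.map bar ∧ (A.map Prod.fst).Nodup ∧ (C.map Prod.fst).Nodup := by
    obtain ⟨X, g, A, Y, rfl, hA⟩ := exists_innermost_pair hLn hs
    have hrot : Γ.IsLoop (A ++ ([bar g] ++ (Y ++ X ++ [g]))) := by
      have h1 : Γ.IsLoop ((X ++ [g]) ++ (A ++ bar g :: Y)) := by simpa using hL
      simpa using h1.rotate
    have hperm : (A ++ ([bar g] ++ (Y ++ X ++ [g]))).Perm (X ++ g :: (A ++ bar g :: Y)) := by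
      have h1 : A ++ ([bar g] ++ (Y ++ X ++ [g])) = (A ++ bar g :: Y) ++ (X ++ [g]) := by simp
      have h2 : X ++ g :: (A ++ bar g :: Y) = (X ++ [g]) ++ (A ++ bar g :: Y) := by simp
      rw [h1, h2]
      exact List.perm_append_comm
    have hAne : A ≠ [] := by
      rintro rfl
      have h1 := hL.isChain
      simp only [List.nil_append] at h1
      have := h1.right_of_append
      rw [List.isChain_cons_cons] at this
      exact this.1.2 rfl
    by_cases hYX : ((Y ++ X).map Prod.fst).Nodup
    · refine ⟨A, [bar g], Y ++ X, [g], hAne, by simp, ?_, by simp, hperm, hrot, by simp, by simp,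
        hA, hYX⟩
      intro h1
      rw [h1] at hrot
      have h2 : [bar g] ++ ([] ++ [g]) = [bar g, g] := rfl
      rw [h2] at hrot
      have := hrot.isChain.right_of_append
      rw [List.isChain_pair] at this
      exact this.2 (by simp)
    · have hn2 : (Y ++ X).Nodup := by
        have h1 := hperm.nodup_iff.2 hLn
        refine List.Nodup.sublist ?_ h1
        exact ((List.sublist_append_left _ [g]).trans
          (List.sublist_append_right [bar g] _)).trans (List.sublist_append_right A _)
      obtain ⟨Z, h, C, W, hZ, hC⟩ := exists_innermost_pair hn2 hYX
      rw [hZ] at hperm hrot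
      have e : A ++ ([bar g] ++ (Z ++ h :: (C ++ bar h :: W) ++ [g])) =
          A ++ ((bar g :: (Z ++ [h])) ++ (C ++ (bar h :: (W ++ [g])))) := by simp
      rw [e] at hperm hrot
      refine ⟨A, bar g :: (Z ++ [h]), C, bar h :: (W ++ [g]), hAne, by simp, ?_, by simp, hperm,
        hrot, ?_, ?_, hA, hC⟩
      · rintro rfl
        have h1 := hrot.isChain.right_of_append
        have h2 : (bar g :: (Z ++ [h])) ++ ([] ++ (bar h :: (W ++ [g]))) =
            (bar g :: Z) ++ ([h, bar h] ++ (W ++ [g])) := by simp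
        rw [h2] at h1
        have := h1.right_of_append.left_of_append
        rw [List.isChain_pair] at this
        exact this.2 rfl
      · rw [← List.cons_append (as := Z), List.getLast?_concat]; rfl
      · rw [← List.cons_append, List.getLast?_concat]; simp
  obtain ⟨A, P, C, Q, hA, hP, hC, hQ, hperm, hloop, hQ1, hQ2, hAs, hCs⟩ := hdec
  -- make the way there the shorter one
  have hdumb : ∃ A P C, A ≠ [] ∧ P ≠ [] ∧ C ≠ [] ∧ (A.map Prod.fst).Nodup ∧
      (C.map Prod.fst).Nodup ∧ Γ.IsLoop (A ++ (P ++ (C ++ FreeGroup.invRev P))) ∧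
      lsum m (A ++ (P ++ (C ++ FreeGroup.invRev P))) = 0 ∧
      (A ++ (P ++ (C ++ FreeGroup.invRev P))).length ≤ k := by
    have hloop2 : Γ.IsLoop (C ++ (Q ++ (A ++ P))) := by
      have h1 : Γ.IsLoop ((A ++ P) ++ (C ++ Q)) := by simpa using hloop
      simpa using h1.rotate
    have hP1 : P.head? = Q.getLast?.map bar := by
      rw [hQ2, Option.map_map]
      have : (bar ∘ bar : Γ.E × Bool → _) = id := funext fun d => bar_bar d
      rw [this]; simp
    have hP2 : P.getLast? = Q.head?.map bar := by
      rw [hQ1, Option.map_map]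
      have : (bar ∘ bar : Γ.E × Bool → _) = id := funext fun d => bar_bar d
      rw [this]; simp
    -- The weights of the two dumbbells with bars `P` and `Q` add up to twice the weight of the
    -- loop, which is zero. Neither is positive, so both vanish, and the one with the shorter bar
    -- may be kept.
    have d1 := hloop.dumbbell hA hP hC hQ hQ1 hQ2
    have d2 := hloop2.dumbbell hC hQ hA hP hP1 hP2
    have s1 := hm _ d1
    have s2 := hm _ d2
    have s3 := lsum_perm m hperm
    have s4 := hperm.length_eq
    rw [hL0] at s3
    simp only [lsum_append, lsum_invRev] at s1 s2 s3
    simp only [List.length_append] at s4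
    rcases le_total P.length Q.length with hle | hle
    · refine ⟨A, P, C, hA, hP, hC, hAs, hCs, d1, ?_, ?_⟩
      · simp only [lsum_append, lsum_invRev]; linarith
      · simp only [List.length_append, FreeGroup.invRev_length]; omega
    · refine ⟨C, Q, A, hC, hQ, hA, hCs, hAs, d2, ?_, ?_⟩
      · simp only [lsum_append, lsum_invRev]; linarith
      · simp only [List.length_append, FreeGroup.invRev_length]; omega
  clear hA hP hC hQ hperm hloop hQ1 hQ2 hAs hCs
  clear A P C Q
  obtain ⟨A, P, C, hA, hP, hC, hAs, hCs, hl, hl0, hlk⟩ := hdumb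
  have n1 := hnodup _ hl hl0 hlk
  -- Reversing `A` preserves weight and length. Since both loops are free of repetitions, `A` shares
  -- edges with `C` in neither direction.
  have n2 := hnodup _ (hl.dumbbell_reverse hA hP hC) (by simpa using hl0) (by simpa using hlk)
  have hmemP : ∀ d ∈ P, bar d ∈ FreeGroup.invRev P := fun d hd => by
    rw [invRev_eq, List.mem_reverse]; exact List.mem_map_of_mem hd
  have hmemA : ∀ d ∈ A, bar d ∈ FreeGroup.invRev A := fun d hd => by
    rw [invRev_eq, List.mem_reverse]; exact List.mem_map_of_mem hd
  simp only [List.nodup_append, List.mem_append] at n1 n2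
  obtain ⟨-, ⟨hPn, ⟨-, -, hCP⟩, hPCP⟩, hAPCP⟩ := n1
  have hA2 := n2.2.2
  have hAP : ∀ a ∈ A, ∀ p ∈ P, a.1 ≠ p.1 := by
    intro a ha p hp h
    rcases eq_or_eq_bar h with rfl | rfl
    · exact hAPCP _ ha _ (Or.inl hp) rfl
    · exact hAPCP _ ha _ (Or.inr (Or.inr (hmemP _ hp))) rfl
  have hAC : ∀ a ∈ A, ∀ p ∈ C, a.1 ≠ p.1 := by
    intro a ha p hp h
    rcases eq_or_eq_bar h with rfl | rfl
    · exact hAPCP _ ha _ (Or.inr (Or.inl hp)) rfl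
    · exact hA2 _ (hmemA _ ha) _ (Or.inr (Or.inl hp)) (bar_bar _)
  have hPC : ∀ a ∈ P, ∀ p ∈ C, a.1 ≠ p.1 := by
    intro a ha p hp h
    rcases eq_or_eq_bar h with rfl | rfl
    · exact hPCP _ ha _ (Or.inl hp) rfl
    · exact hCP _ hp _ (hmemP _ ha) (bar_bar _).symm
  have hPs : (P.map Prod.fst).Nodup := by
    by_contra hd
    obtain ⟨X, g, C', Y, rfl, -⟩ := exists_innermost_pair hPn hd
    exact hPCP g (by simp) g (Or.inr (by
      have := hmemP (bar g) (by simp); rwa [bar_bar] at this)) rfl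
  obtain ⟨a, A', rfl⟩ := List.exists_cons_of_ne_nil hA
  obtain ⟨c, C', rfl⟩ := List.exists_cons_of_ne_nil hC
  refine ⟨_, _, hl, hl0, liftsSimply_dumbbell ?_⟩
  rw [List.map_append, List.map_append, List.nodup_append, List.nodup_append]
  refine ⟨hAs, ⟨hPs, hCs, ?_⟩, ?_⟩
  · rintro _ h1 _ h2
    obtain ⟨d, hd, rfl⟩ := List.mem_map.1 h1
    obtain ⟨d', hd', rfl⟩ := List.mem_map.1 h2
    exact hPC _ hd _ hd'
  · rintro _ h1 _ h2
    obtain ⟨d, hd, rfl⟩ := List.mem_map.1 h1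
    rw [List.mem_append] at h2
    rcases h2 with h2 | h2 <;> obtain ⟨d', hd', rfl⟩ := List.mem_map.1 h2
    · exact hAP _ hd _ hd'
    · exact hAC _ hd _ hd'

end FinGraph


open FinGraph

/-! ### Classes of loops in double covers -/

/-- The group in which the mod 2 chains of lifts to a double cover are recorded. -/
abbrev CoverGroup (α : Type) : Type :=
  RegularWreathProduct (Multiplicative (α → ZMod 2)) (Multiplicative (ZMod 2))

/-- The mod 2 chain of the lift of a word to the double cover given by `ρ`, together with the
difference of the sheets of its ends. -/
def cover {α : Type} [DecidableEq α] (ρ : α → ZMod 2) : FreeGroup α →* CoverGroup α :=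
  FreeGroup.lift fun a => ⟨fun s => if s = 1 then Multiplicative.ofAdd (Pi.single a 1) else 1,
    Multiplicative.ofAdd (ρ a)⟩

section Cover

variable {α : Type} [DecidableEq α] (ρ : α → ZMod 2)

lemma cover_mk_right (L : List (α × Bool)) :
    (cover ρ (FreeGroup.mk L)).right = Multiplicative.ofAdd (sheet ρ L) := by
  induction L with
  | nil => simp [← FreeGroup.one_eq_mk, sheet]
  | cons d L ih =>
    rw [mk_cons, map_mul, RegularWreathProduct.mul_right, ih, sheet_cons, ofAdd_add]
    congr 1
    obtain ⟨e, b⟩ := d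
    cases b
    · rw [mk_singleton_false, map_inv]
      simp [cover, ← ofAdd_neg, ZMod.neg_eq_self_mod_two]
    · rw [mk_singleton_true]; simp [cover]

/-- In the wreath product the first letter shifts the argument of the remaining factor, just as it
shifts the sheet in which the rest of the lift starts. Orientations are invisible mod 2. -/
lemma cover_mk_left (L : List (α × Bool)) (s t : ZMod 2) (e : α) :
    ((cover ρ (FreeGroup.mk L)).left (Multiplicative.ofAdd (s + t))).toAdd e =
      ((liftPath ρ t L).count (e, s) : ZMod 2) := by
  induction L generalizing t with
  | nil => simp [← FreeGroup.one_eq_mk, liftPath]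
  | cons d L ih =>
    rw [mk_cons, map_mul, RegularWreathProduct.mul_left, liftPath, List.count_cons]
    obtain ⟨e', b⟩ := d
    have hr := cover_mk_right ρ [(e', b)]
    have hneg : ∀ x : ZMod 2, -x = x := fun x => ZMod.neg_eq_self_mod_two x
    have h2 : (cover ρ (FreeGroup.mk [(e', b)])).right⁻¹ * Multiplicative.ofAdd (s + t) =
        Multiplicative.ofAdd (s + (t + ρ e')) := by
      rw [hr, ← ofAdd_neg, ← ofAdd_add]
      congr 1
      simp [sheet, hneg]; ring
    rw [Pi.mul_apply, h2, toAdd_mul, Pi.add_apply, ih (t + ρ e'), add_comm]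
    push_cast
    congr 1
    have hz : ∀ x y : ZMod 2, x + y = 0 ↔ y = x := by decide
    cases b
    · rw [mk_singleton_false, map_inv]
      have h3 : ∀ a b c : ZMod 2, a + (b + c) = 0 ↔ c + a = b := by decide
      have h4 : ∀ a b c : ZMod 2, a + b = c ↔ b + a = c := by decide
      simp only [cover, FreeGroup.lift_apply_of, RegularWreathProduct.inv_left, Pi.inv_apply,
        ← ofAdd_add, ofAdd_eq_one, h3]
      by_cases hs : t + ρ e' = s
      · by_cases he : e' = e
        · subst he; simp [hs, hneg]
        · simp [hs, he, Ne.symm he]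
      · simp [hs]
    · rw [mk_singleton_true]
      simp only [cover, FreeGroup.lift_apply_of, ofAdd_eq_one, hz]
      by_cases hs : t = s
      · by_cases he : e' = e
        · subst he; simp [hs]
        · simp [hs, he, Ne.symm he]
      · simp [hs]

/-- Since `a` closes up in the cover, the lifts of `q` and `q⁻¹` run over the same edges and cancel.
Changing the base point only applies a deck transformation. -/
lemma conj_left {α : Type} (q a : CoverGroup α) (ha : a.right = 1) (s : Multiplicative (ZMod 2)) :
    (q * a * q⁻¹).left s = a.left (q.right⁻¹ * s) := by
  simp only [RegularWreathProduct.mul_left, RegularWreathProduct.mul_right,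
    RegularWreathProduct.inv_left, ha, Pi.mul_apply, mul_one, Pi.inv_apply, mul_inv_cancel_left]
  rw [mul_comm (q.left s), mul_assoc, mul_inv_cancel, mul_one]

lemma conj_right {α : Type} (q a : CoverGroup α) : (q * a * q⁻¹).right = a.right := by
  simp

/-- A homomorphism of free groups, and a double cover of the target, induce a homomorphism on the
groups of chains. -/
def coverMap {α β : Type} [Fintype α] (u : α → Multiplicative (ZMod 2) →
    Multiplicative (β → ZMod 2)) : CoverGroup α →* CoverGroup β where
  toFun a := ⟨fun s => Multiplicative.ofAdd
    (∑ t, ∑ i, (a.left t).toAdd i • (u i (t⁻¹ * s)).toAdd), a.right⟩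
  map_one' := by
    ext1
    · funext s
      simp
    · rfl
  map_mul' a b := by
    ext1
    · funext s
      simp only [RegularWreathProduct.mul_left, Pi.mul_apply, toAdd_mul, Pi.add_apply, add_smul,
        Finset.sum_add_distrib, ofAdd_add]
      congr 2
      refine (Fintype.sum_equiv (Equiv.mulLeft a.right) _ _ fun t => ?_).symm
      simp [mul_assoc]
    · rfl

lemma coverMap_cover_of {α β : Type} [Fintype α] [DecidableEq α]
    (u : α → Multiplicative (ZMod 2) → Multiplicative (β → ZMod 2)) (ρ : α → ZMod 2) (j : α) :
    coverMap u (cover ρ (FreeGroup.of j)) = ⟨u j, Multiplicative.ofAdd (ρ j)⟩ := by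
  rw [cover, FreeGroup.lift_apply_of]
  ext1
  · funext s
    simp only [coverMap, MonoidHom.coe_mk, OneHom.coe_mk]
    rw [Finset.sum_eq_single 1]
    · simp [Pi.single_apply]
    · intro t _ ht; simp [ht]
    · simp
  · rfl

/-- Two homomorphisms that agree on generators. It makes classes independent of the graph: the chain
of `g` in a double cover of the rose determines the chain of `f g` in the corresponding cover of the
marked graph. -/
lemma coverMap_cover {α β : Type} [Fintype α] [DecidableEq α] [DecidableEq β]
    (f : FreeGroup α →* FreeGroup β) (ρ : β → ZMod 2) (g : FreeGroup α) :
    coverMap (fun i => (cover ρ (f (FreeGroup.of i))).left)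
      (cover (fun i => (cover ρ (f (FreeGroup.of i))).right.toAdd) g) = cover ρ (f g) := by
  have : (coverMap (fun i => (cover ρ (f (FreeGroup.of i))).left)).comp
      (cover (fun i => (cover ρ (f (FreeGroup.of i))).right.toAdd)) = (cover ρ).comp f := by
    refine FreeGroup.ext_hom _ _ fun j => ?_
    rw [MonoidHom.comp_apply, coverMap_cover_of]
    rfl
  exact DFunLike.congr_fun this g

end Cover

/-- Pairs of a double cover and a nonzero mod 2 chain in the corresponding cover of the rose. -/
abbrev CoverIndex (n : ℕ) : Type :=
  (Fin n → ZMod 2) × {c : Multiplicative (ZMod 2) → Multiplicative (Fin n → ZMod 2) // c ≠ 1}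

/-- The elements that lift to loops in the given class. -/
def classSet {n : ℕ} (i : CoverIndex n) : Set (FreeGroup (Fin n)) :=
  {g | cover i.1 g = ⟨i.2.1, 1⟩}

lemma ne_one_of_mem_classSet {n : ℕ} {i : CoverIndex n} {g : FreeGroup (Fin n)}
    (h : g ∈ classSet i) : g ≠ 1 := by
  rintro rfl
  have : cover i.1 1 = ⟨i.2.1, 1⟩ := h
  rw [map_one] at this
  exact i.2.2 (congrArg RegularWreathProduct.left this).symm

open Classical in
/-- The least length of a loop in the given class. -/
def classLen {n : ℕ} (τ : FreeGroup (Fin n) → ℝ) (i : CoverIndex n) : ℝ :=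
  -- Chains that are not cycles are indexed too and may have empty classes. The value 1 makes such
  -- factors neutral in the product and compatible with comparisons by constants at least 1.
  if (classSet i).Nonempty then sInf (τ '' classSet i) else 1

/-- The product of the lengths of all classes. -/
def prodLen {n : ℕ} (τ : FreeGroup (Fin n) → ℝ) : ℝ := ∏ i, classLen τ i

/-! ### Comparison of the lengths of classes and of their product -/

section ClassLen

variable {n : ℕ} {τ τ' : FreeGroup (Fin n) → ℝ}

lemma classLen_le (hτ : ∀ g, 0 ≤ τ g) {i : CoverIndex n} {g : FreeGroup (Fin n)}
    (hg : g ∈ classSet i) : classLen τ i ≤ τ g := by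
  rw [classLen, if_pos ⟨g, hg⟩]
  exact csInf_le ⟨0, by rintro _ ⟨h, -, rfl⟩; exact hτ h⟩ ⟨g, hg, rfl⟩

lemma classLen_le_mul {c : ℝ} (hc : 1 ≤ c) (hτ' : ∀ g, 0 ≤ τ' g) (h : ∀ g, τ' g ≤ c * τ g)
    (i : CoverIndex n) : classLen τ' i ≤ c * classLen τ i := by
  by_cases hi : (classSet i).Nonempty
  · rw [← div_le_iff₀' (by linarith)]
    rw [classLen, classLen, if_pos hi, if_pos hi]
    refine le_csInf (hi.image _) ?_
    rintro _ ⟨g, hg, rfl⟩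
    rw [div_le_iff₀' (by linarith)]
    refine le_trans ?_ (h g)
    exact csInf_le ⟨0, by rintro _ ⟨h, -, rfl⟩; exact hτ' h⟩ ⟨g, hg, rfl⟩
  · rw [classLen, classLen, if_neg hi, if_neg hi]; linarith

lemma le_classLen {δ : ℝ} (hδ : δ ≤ 1) (h : ∀ g, g ≠ 1 → δ ≤ τ g) (i : CoverIndex n) :
    δ ≤ classLen τ i := by
  by_cases hi : (classSet i).Nonempty
  · rw [classLen, if_pos hi]
    refine le_csInf (hi.image _) ?_
    rintro _ ⟨g, hg, rfl⟩
    exact h g (ne_one_of_mem_classSet hg)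
  · rwa [classLen, if_neg hi]

lemma classLen_nonneg (hτ : ∀ g, 0 ≤ τ g) (i : CoverIndex n) : 0 ≤ classLen τ i :=
  le_classLen zero_le_one (fun g _ => hτ g) i

lemma prodLen_nonneg (hτ : ∀ g, 0 ≤ τ g) : 0 ≤ prodLen τ :=
  Finset.prod_nonneg fun i _ => classLen_nonneg hτ i

lemma prodLen_pos {δ : ℝ} (hδ : 0 < δ) (h : ∀ g, g ≠ 1 → δ ≤ τ g) : 0 < prodLen τ :=
  Finset.prod_pos fun i _ => lt_of_lt_of_le (lt_min hδ one_pos)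
    (le_classLen (min_le_right δ 1) (fun g hg => (min_le_left δ 1).trans (h g hg)) i)

/-- The factor `i` is kept exactly and each other factor costs one `c`. This is the source of the
exponent, the number of factors minus one. -/
lemma prodLen_le_pow_mul {c : ℝ} (hc : 1 ≤ c) (hτ' : ∀ g, 0 ≤ τ' g)
    (h : ∀ g, τ' g ≤ c * τ g) (i : CoverIndex n) :
    prodLen τ' * classLen τ i ≤
      c ^ (Fintype.card (CoverIndex n) - 1) * (classLen τ' i * prodLen τ) := by
  rw [prodLen, prodLen, ← Finset.mul_prod_erase _ _ (Finset.mem_univ i),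
    ← Finset.mul_prod_erase Finset.univ (classLen τ) (Finset.mem_univ i)]
  have h1 : ∏ j ∈ Finset.univ.erase i, classLen τ' j ≤
      ∏ j ∈ Finset.univ.erase i, (c * classLen τ j) :=
    Finset.prod_le_prod (fun j _ => classLen_nonneg hτ' j) fun j _ => classLen_le_mul hc hτ' h j
  rw [Finset.prod_mul_distrib, Finset.prod_const, Finset.card_erase_of_mem (Finset.mem_univ i),
    Finset.card_univ] at h1
  have h2 := classLen_nonneg hτ' i
  by_cases hi : (classSet i).Nonempty
  · have h3 : 0 ≤ classLen τ i := by
      have := classLen_le_mul hc hτ' h i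
      by_contra! h4
      nlinarith
    calc _ = classLen τ' i * classLen τ i * ∏ j ∈ Finset.univ.erase i, classLen τ' j := by ring
      _ ≤ classLen τ' i * classLen τ i * _ := mul_le_mul_of_nonneg_left h1 (mul_nonneg h2 h3)
      _ = _ := by ring
  · have h3 : 0 ≤ classLen τ i := by rw [classLen, if_neg hi]; exact zero_le_one
    calc _ = classLen τ' i * classLen τ i * ∏ j ∈ Finset.univ.erase i, classLen τ' j := by ring
      _ ≤ classLen τ' i * classLen τ i * _ := mul_le_mul_of_nonneg_left h1 (mul_nonneg h2 h3)
      _ = _ := by ring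

end ClassLen

/-! ### Shortest loops in classes, and two metrics on one graph -/

namespace PreMarked

variable {n : ℕ} (M : PreMarked n)

lemma sum_toFinset_le_sum_map {α : Type} [DecidableEq α] {f : α → ℝ} (hf : ∀ a, 0 ≤ f a)
    (l : List α) : ∑ x ∈ l.toFinset, f x ≤ (l.map f).sum := by
  induction l with
  | nil => simp
  | cons a l ih =>
    rw [List.toFinset_cons, List.map_cons, List.sum_cons]
    by_cases h : a ∈ l.toFinset
    · rw [Finset.insert_eq_of_mem h]; linarith [hf a]
    · rw [Finset.sum_insert h]; linarith

lemma sum_toFinset_liftPath_le {E : Type} [DecidableEq E] {ℓ : E → ℝ} (hℓ : ∀ e, 0 ≤ ℓ e)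
    (ρ : E → ZMod 2) (L : List (E × Bool)) :
    ∑ x ∈ (liftPath ρ 0 L).toFinset, ℓ x.1 ≤ lsum ℓ L := by
  have h1 : lsum ℓ L = ((liftPath ρ 0 L).map fun x => ℓ x.1).sum := by
    have := congrArg (fun l => (l.map ℓ).sum) (map_fst_liftPath ρ 0 L)
    simp only [List.map_map] at this
    exact this.symm
  rw [h1]
  exact sum_toFinset_le_sum_map (f := fun x : E × ZMod 2 => ℓ x.1) (fun x => hℓ x.1) _

lemma sum_toFinset_liftPath_eq {E : Type} [DecidableEq E] (ℓ : E → ℝ) {ρ : E → ZMod 2}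
    {L : List (E × Bool)} (h : (liftPath ρ 0 L).Nodup) :
    ∑ x ∈ (liftPath ρ 0 L).toFinset, ℓ x.1 = lsum ℓ L := by
  have h1 : lsum ℓ L = ((liftPath ρ 0 L).map fun x => ℓ x.1).sum := by
    have := congrArg (fun l => (l.map ℓ).sum) (map_fst_liftPath ρ 0 L)
    simp only [List.map_map] at this
    exact this.symm
  rw [h1, List.sum_toFinset _ h]

/-- A loop with a simple lift to a double cover is shortest in a class of loops, for every
metric. -/
lemma exists_classLen_eq {L : List (M.Γ.E × Bool)} (hL : M.Γ.IsLoop L)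
    {ρ : M.Γ.E → ZMod 2} (hρ : LiftsSimply ρ L) :
    ∃ i : CoverIndex n, ∀ ℓ : M.Γ.E → ℝ, (∀ e, 0 ≤ ℓ e) →
      classLen (fun g => tl ℓ (M.f g)) i = lsum ℓ L := by
  obtain ⟨g, hg, ⟨p, hp⟩, hgl⟩ := M.exists_of_isLoop hL
  set ρ' : Fin n → ZMod 2 := fun i => (cover ρ (M.f (FreeGroup.of i))).right.toAdd with hρ'
  have hr1 : (cover ρ (FreeGroup.mk L)).right = 1 := by rw [cover_mk_right, hρ.1]; rfl
  have hr2 : (cover ρ (M.f g)).right = 1 := by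
    rw [hp, map_mul, map_mul, map_inv, conj_right, hr1]
  have hr3 : (cover ρ' g).right = 1 := by
    have := coverMap_cover M.f ρ g
    rw [← hr2, ← this]; rfl
  have hsupp : ∀ x ∈ liftPath ρ 0 L,
      ((cover ρ (FreeGroup.mk L)).left (Multiplicative.ofAdd x.2)).toAdd x.1 = 1 := by
    intro x hx
    have := cover_mk_left ρ L x.2 0 x.1
    rw [add_zero] at this
    rw [this, List.count_eq_one_of_mem hρ.2 hx, Nat.cast_one]
  -- If the chain of `g` in the cover of the rose vanished, so would that of `L` in its cover. But
  -- the first edge of the simple lift has coefficient 1.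
  have hc : (cover ρ' g).left ≠ 1 := by
    intro h1
    have h2 : cover ρ' g = 1 := by ext1; exacts [h1, hr3]
    have h3 : cover ρ (M.f g) = 1 := by rw [← coverMap_cover M.f ρ g, h2, map_one]
    have h4 : cover ρ (FreeGroup.mk L) = 1 := by
      rw [hp, map_mul, map_mul, map_inv] at h3
      exact conj_eq_one_iff.1 h3
    obtain ⟨d, L', rfl⟩ := List.exists_cons_of_ne_nil hL.1
    have := hsupp _ (by rw [liftPath]; exact List.mem_cons_self)
    rw [h4] at this
    simp at this
  refine ⟨(ρ', ⟨_, hc⟩), fun ℓ hℓ => ?_⟩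
  have hgmem : g ∈ classSet (ρ', ⟨(cover ρ' g).left, hc⟩) := by
    change cover ρ' g = _
    ext1
    · rfl
    · exact hr3
  refine le_antisymm ?_ ?_
  · rw [← hgl ℓ hℓ]
    exact classLen_le (τ := fun g => tl ℓ (M.f g)) (fun g => tl_nonneg hℓ _) hgmem
  · rw [classLen, if_pos ⟨g, hgmem⟩]
    refine le_csInf ⟨_, g, hgmem, rfl⟩ ?_
    rintro _ ⟨g', hg', rfl⟩
    have hne := ne_one_of_mem_classSet hg'
    obtain ⟨L', -, hL', -, p', -, hp'⟩ := M.exists_loop hne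
    have e1 : cover ρ (M.f g') = cover ρ (M.f g) := by
      rw [← coverMap_cover, ← coverMap_cover M.f ρ g]
      congr 1
      exact Eq.trans hg' (Eq.symm hgmem)
    have e2 : tl ℓ (M.f g') = lsum ℓ L' := by
      rw [hp', tl_conj hℓ, tl_mk_of_isCyclicallyReduced hℓ hL'.isCyclicallyReduced]
    have e3 : cover ρ (FreeGroup.mk L') = (cover ρ (p'⁻¹ * p)) * cover ρ (FreeGroup.mk L) *
        (cover ρ (p'⁻¹ * p))⁻¹ := by
      rw [← map_inv, ← map_mul, ← map_mul]
      have h5 : FreeGroup.mk L' = p'⁻¹ * M.f g' * p' := by rw [hp']; group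
      have h6 : p'⁻¹ * p * FreeGroup.mk L * (p'⁻¹ * p)⁻¹ = p'⁻¹ * M.f g * p' := by
        rw [hp]; group
      rw [h5, h6, map_mul, map_mul, e1, map_mul, map_mul]
    show lsum ℓ L ≤ tl ℓ (M.f g')
    rw [e2]
    refine le_trans ?_ (sum_toFinset_liftPath_le hℓ ρ L')
    rw [← sum_toFinset_liftPath_eq ℓ hρ.2]
    -- The deck transformation that takes the chain of the lift of `L` to that of `L'`.
    set t := (cover ρ (p'⁻¹ * p)).right.toAdd with ht
    have hinj : Function.Injective (fun x : M.Γ.E × ZMod 2 => (x.1, t + x.2)) := by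
      intro x y h
      simp only [Prod.mk.injEq, add_right_inj] at h
      exact Prod.ext h.1 h.2
    have h7 : ∑ x ∈ (liftPath ρ 0 L).toFinset, ℓ x.1 =
        ∑ x ∈ (liftPath ρ 0 L).toFinset.image (fun x => (x.1, t + x.2)), ℓ x.1 := by
      rw [Finset.sum_image fun x _ y _ h => hinj h]
    rw [h7]
    refine Finset.sum_le_sum_of_subset_of_nonneg ?_ fun x _ _ => hℓ _
    intro y hy
    obtain ⟨x, hx, rfl⟩ := Finset.mem_image.1 hy
    rw [List.mem_toFinset] at hx ⊢
    have h8 := cover_mk_left ρ L' (t + x.2) 0 x.1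
    rw [add_zero, e3, conj_left _ _ hr1] at h8
    have h9 : (cover ρ (p'⁻¹ * p)).right⁻¹ * Multiplicative.ofAdd (t + x.2) =
        Multiplicative.ofAdd x.2 := by
      rw [ofAdd_add, ht, ofAdd_toAdd, inv_mul_cancel_left]
    -- The translated edge has coefficient 1 in the chain of `L'`, so the lift of `L'` crosses it an
    -- odd number of times, hence at least once.
    rw [h9, hsupp x hx] at h8
    by_contra hnot
    rw [List.count_eq_zero_of_not_mem hnot] at h8
    simp at h8

/-- Comparison of two metrics on the same graph. -/
theorem tl_mul_prodLen_le {ℓ ℓ' : M.Γ.E → ℝ} (hℓ : ∀ e, 0 ≤ ℓ e) (hℓ' : ∀ e, 0 ≤ ℓ' e)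
    (hpos : ∀ g, g ≠ 1 → 0 < tl ℓ' (M.f g)) {c : ℝ} (hc : 1 ≤ c)
    (h : ∀ g, tl ℓ' (M.f g) ≤ c * tl ℓ (M.f g)) (g : FreeGroup (Fin n)) :
    tl ℓ (M.f g) * prodLen (fun g => tl ℓ' (M.f g)) ≤
      c ^ (Fintype.card (CoverIndex n) - 1) *
        (tl ℓ' (M.f g) * prodLen (fun g => tl ℓ (M.f g))) := by
  rcases eq_or_ne g 1 with rfl | hg
  · simp
  have hposL : ∀ L, M.Γ.IsLoop L → 0 < lsum ℓ' L := by
    intro L hL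
    obtain ⟨g, hg, -, h1⟩ := M.exists_of_isLoop hL
    rw [← h1 ℓ' hℓ']; exact hpos g hg
  obtain ⟨L₀, hL₀, hgL⟩ := M.exists_tl_eq hg
  -- Among loops without repeated oriented edges the ratio of the two lengths has a maximum `κ`. By
  -- splitting it bounds the ratio for all loops.
  have hfin : {L | M.Γ.IsLoop L ∧ L.Nodup}.Finite := by
    refine Set.Finite.subset (s := {L : List (M.Γ.E × Bool) | L.Nodup}) ?_ fun L hL => hL.2
    exact Set.finite_coe_iff.1 (inferInstanceAs (Finite {L : List (M.Γ.E × Bool) // L.Nodup}))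
  have hne : {L | M.Γ.IsLoop L ∧ L.Nodup}.Nonempty := by
    by_contra hemp
    have := lsum_le_zero_of_nodup (m := ℓ')
      (fun L h1 h2 => absurd ⟨L, h1, h2⟩ hemp) L₀ hL₀
    linarith [hposL L₀ hL₀]
  obtain ⟨Lm, ⟨hLm, -⟩, hmax⟩ :=
    Set.exists_max_image _ (fun L => lsum ℓ L / lsum ℓ' L) hfin hne
  set κ := lsum ℓ Lm / lsum ℓ' Lm with hκ
  have hκ0 : 0 ≤ κ := div_nonneg (lsum_nonneg hℓ _) (lsum_nonneg hℓ' _)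
  have hm : ∀ L, lsum (fun e => ℓ e - κ * ℓ' e) L = lsum ℓ L - κ * lsum ℓ' L := fun L => by
    rw [lsum_sub, lsum_smul]
  have hle := lsum_le_zero_of_nodup (m := fun e => ℓ e - κ * ℓ' e) (fun L h1 h2 => by
    have := hmax L ⟨h1, h2⟩
    rw [div_le_iff₀ (hposL L h1)] at this
    rw [hm]; linarith)
  -- The weight `ℓ - κ ℓ'` is nowhere positive on loops and vanishes on `Lm`. So the extremal ratio
  -- `κ` is also attained on a loop with a simple lift, whose class has the same shortest loop for
  -- both metrics.
  obtain ⟨L, ρ, hL, hL0, hρ⟩ := exists_liftsSimply hle ⟨Lm, hLm, by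
    rw [hm, hκ, div_mul_cancel₀ _ (hposL Lm hLm).ne']; ring⟩
  obtain ⟨i, hi⟩ := M.exists_classLen_eq hL hρ
  have h1 := prodLen_le_pow_mul hc (τ := fun g => tl ℓ (M.f g)) (τ' := fun g => tl ℓ' (M.f g))
    (fun g => tl_nonneg hℓ' _) h i
  rw [hi ℓ hℓ, hi ℓ' hℓ'] at h1
  rw [hm] at hL0
  have h2 := hle L₀ hL₀
  rw [hm] at h2
  rw [hgL ℓ hℓ, hgL ℓ' hℓ']
  have h3 := hposL L hL
  have h4 := hposL L₀ hL₀
  set P := prodLen (fun g => tl ℓ (M.f g))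
  set P' := prodLen (fun g => tl ℓ' (M.f g)) with hP'
  have hP0 : 0 ≤ P' := prodLen_nonneg fun g => tl_nonneg hℓ' _
  have h5 : lsum ℓ L = κ * lsum ℓ' L := by linarith
  rw [h5] at h1
  have h6 : κ * P' ≤ c ^ (Fintype.card (CoverIndex n) - 1) * P := by
    refine le_of_mul_le_mul_right ?_ h3
    linarith
  calc lsum ℓ L₀ * P' ≤ (κ * lsum ℓ' L₀) * P' := mul_le_mul_of_nonneg_right (by linarith) hP0
    _ = lsum ℓ' L₀ * (κ * P') := by ring
    _ ≤ lsum ℓ' L₀ * (c ^ (Fintype.card (CoverIndex n) - 1) * P) :=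
        mul_le_mul_of_nonneg_left h6 h4.le
    _ = _ := by ring

end PreMarked


open FinGraph

namespace PreMarked

variable {n : ℕ} (M : PreMarked n)

/-! ### Loops visit a vertex only a bounded number of times -/

lemma le_wlen_of_mem_pathClass {ℓ : M.Γ.E → ℝ} (hℓ : ∀ e, 0 ≤ ℓ e) {ε : ℝ}
    (hε : ∀ g, g ≠ 1 → ε ≤ tl ℓ (M.f g)) {u : M.Γ.V} {W : FreeGroup M.Γ.E}
    (h : W ∈ M.Γ.pathClass u u) (hW : W ≠ 1) : ε ≤ wlen ℓ W := by
  obtain ⟨g, p, -, hp⟩ := M.exists_of_mem_pathClass h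
  have hg : g ≠ 1 := by
    rintro rfl
    rw [map_one] at hp
    exact hW (conj_eq_one_iff.1 hp.symm)
  have := hε g hg
  rw [hp, tl_conj hℓ] at this
  exact this.trans (tl_le_wlen hℓ W)

/-- Cut the walk at its visits to `u`. Each piece is a nontrivial reduced closed path, of length at
least `ε`. -/
lemma count_mul_le_of_isWalk {ℓ : M.Γ.E → ℝ} (hℓ : ∀ e, 0 ≤ ℓ e) {ε : ℝ}
    (hε : ∀ g, g ≠ 1 → ε ≤ tl ℓ (M.f g)) {u : M.Γ.V} {L : List (M.Γ.E × Bool)}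
    (h : M.Γ.IsWalk u u L) (hc : L.IsChain M.Γ.Turn) :
    (L.countP fun d => M.Γ.init d = u) * ε ≤ lsum ℓ L := by
  induction hk : L.length using Nat.strong_induction_on generalizing L with
  | _ k ih =>
    cases L with
    | nil => simp
    | cons d X =>
      by_cases hX : ∃ e ∈ X, M.Γ.init e = u
      · obtain ⟨e, he, heu⟩ := hX
        obtain ⟨Y, Z, rfl⟩ := List.append_of_mem he
        rw [← List.cons_append] at h hc hk ⊢
        obtain ⟨w, h1, h2⟩ := isWalk_append.1 h
        obtain rfl : u = w := heu.symm.trans h2.1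
        rw [List.length_append] at hk
        have e1 := ih (d :: Y).length (by simp at hk ⊢; omega) h1 hc.left_of_append rfl
        have e2 := ih (e :: Z).length (by simp at hk ⊢; omega) h2 hc.right_of_append rfl
        rw [List.countP_append, lsum_append]
        push_cast
        linarith
      · push Not at hX
        have h1 : (d :: X).countP (fun d => M.Γ.init d = u) = 1 := by
          rw [List.countP_cons_of_pos (by simpa using h.1), List.countP_eq_zero.2]
          intro e he
          simpa using hX e he
        rw [h1, Nat.cast_one, one_mul]
        have hr := isReduced_of_isChain hc
        rw [← wlen_mk_of_isReduced ℓ hr]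
        refine M.le_wlen_of_mem_pathClass hℓ hε (mk_mem_pathClass h) fun h0 => ?_
        have := congrArg FreeGroup.toWord h0
        rw [FreeGroup.toWord_mk, hr.reduce_eq, FreeGroup.toWord_one] at this
        simp at this

lemma count_init_mul_le {ℓ : M.Γ.E → ℝ} (hℓ : ∀ e, 0 ≤ ℓ e) {ε : ℝ}
    (hε : ∀ g, g ≠ 1 → ε ≤ tl ℓ (M.f g)) (u : M.Γ.V) {L : List (M.Γ.E × Bool)}
    (h : M.Γ.IsLoop L) : (L.countP fun d => M.Γ.init d = u) * ε ≤ lsum ℓ L := by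
  by_cases hX : ∃ e ∈ L, M.Γ.init e = u
  · obtain ⟨e, he, heu⟩ := hX
    obtain ⟨X, Y, rfl⟩ := List.append_of_mem he
    have h1 := h.rotate
    have hp : (X ++ e :: Y).Perm (e :: Y ++ X) := List.perm_append_comm
    rw [hp.countP_eq, lsum_perm ℓ hp]
    have h2 : M.Γ.IsWalk (M.Γ.init e) (M.Γ.init e) (e :: Y ++ X) := by
      rw [List.cons_append] at h1 ⊢; exact h1.isWalk
    rw [heu] at h2
    exact M.count_mul_le_of_isWalk hℓ hε h2 h1.isChain
  · push Not at hX
    have h1 : L.countP (fun d => M.Γ.init d = u) = 0 := by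
      rw [List.countP_eq_zero]
      intro e he
      simpa using hX e he
    rw [h1, Nat.cast_zero, zero_mul]
    exact lsum_nonneg hℓ L

lemma count_term_mul_le {ℓ : M.Γ.E → ℝ} (hℓ : ∀ e, 0 ≤ ℓ e) {ε : ℝ}
    (hε : ∀ g, g ≠ 1 → ε ≤ tl ℓ (M.f g)) (u : M.Γ.V) {L : List (M.Γ.E × Bool)}
    (h : M.Γ.IsLoop L) : (L.countP fun d => M.Γ.term d = u) * ε ≤ lsum ℓ L := by
  have := M.count_init_mul_le hℓ hε u h.invRev
  rw [lsum_invRev, invRev_eq, List.countP_reverse, List.countP_map] at this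
  simpa [Function.comp_def] using this

/-! ### Homotopy equivalences of graphs transport markings -/

/-- Transport a marking along a homotopy equivalence of graphs. -/
abbrev transfer (Γ' : FinGraph) (h : FreeGroup M.Γ.E →* FreeGroup Γ'.E)
    (k : FreeGroup Γ'.E →* FreeGroup M.Γ.E) (hV : M.Γ.V → Γ'.V) (kV : Γ'.V → M.Γ.V)
    (c : M.Γ.V → FreeGroup M.Γ.E) (c' : Γ'.V → FreeGroup Γ'.E)
    (hh : ∀ e, h (FreeGroup.of e) ∈ Γ'.pathClass (hV (M.Γ.src e)) (hV (M.Γ.tgt e)))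
    (hk : ∀ e, k (FreeGroup.of e) ∈ M.Γ.pathClass (kV (Γ'.src e)) (kV (Γ'.tgt e)))
    (hc : ∀ u, c u ∈ M.Γ.pathClass u (kV (hV u)))
    (hc' : ∀ u, c' u ∈ Γ'.pathClass u (hV (kV u)))
    (hkh : ∀ e, k (h (FreeGroup.of e)) = (c (M.Γ.src e))⁻¹ * FreeGroup.of e * c (M.Γ.tgt e))
    (hhk : ∀ e, h (k (FreeGroup.of e)) = (c' (Γ'.src e))⁻¹ * FreeGroup.of e * c' (Γ'.tgt e)) :
    PreMarked n where
  Γ := Γ'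
  base := hV M.base
  reach u := by
    obtain ⟨g, hg⟩ := M.reach (kV u)
    exact ⟨h g * (c' u)⁻¹, mul_mem_pathClass (hom_mem_pathClass h hV hh hg)
      (inv_mem_pathClass (hc' u))⟩
  f := h.comp M.f
  f_injective := by
    intro a b hab
    apply M.f_injective
    have key : ∀ g, k (h (M.f g)) = (c M.base)⁻¹ * M.f g * c M.base := fun g =>
      hom_gauge (k.comp h) (MonoidHom.id _) c hkh (M.f_mem g)
    have h1 := congrArg k hab
    simp only [MonoidHom.comp_apply, key] at h1
    simpa using h1
  f_range := by
    refine Set.Subset.antisymm ?_ fun W hW => ?_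
    · rintro _ ⟨g, rfl⟩
      exact hom_mem_pathClass h hV hh (M.f_mem g)
    -- `q` is the discrepancy of the two gauges at the base point. Conjugating `W` by it beforehand
    -- makes the round trip through `k` and `h` return exactly `W`.
    · set q := h (c M.base) * (c' (hV M.base))⁻¹ with hq
      have hq1 : q ∈ Γ'.pathClass (hV M.base) (hV M.base) :=
        mul_mem_pathClass (hom_mem_pathClass h hV hh (hc M.base)) (inv_mem_pathClass (hc' _))
      have h1 : q⁻¹ * W * q ∈ Γ'.pathClass (hV M.base) (hV M.base) :=
        mul_mem_pathClass (mul_mem_pathClass (inv_mem_pathClass hq1) hW) hq1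
      have h2 := hom_mem_pathClass k kV hk h1
      obtain ⟨g, hg⟩ := M.exists_f_eq (mul_mem_pathClass (mul_mem_pathClass (hc M.base) h2)
        (inv_mem_pathClass (hc M.base)))
      refine ⟨g, ?_⟩
      have h3 : h (k (q⁻¹ * W * q)) = (c' (hV M.base))⁻¹ * (q⁻¹ * W * q) * c' (hV M.base) :=
        hom_gauge (h.comp k) (MonoidHom.id _) c' hhk h1
      rw [MonoidHom.comp_apply, hg, map_mul, map_mul, map_inv, h3, hq]
      group

/-! ### Folds -/

variable (v : M.Γ.V) (S : M.Γ.E × Bool → Prop) [DecidablePred S]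

/-- The graph obtained by detaching the oriented edges in `S` from the vertex `v`, and attaching
them to the end of a new edge from `v` to a new vertex. -/
abbrev foldGraph : FinGraph where
  V := Option M.Γ.V
  E := Option M.Γ.E
  src := fun e => e.elim (some v) fun e => if S (e, true) then none else some (M.Γ.src e)
  tgt := fun e => e.elim none fun e => if S (e, false) then none else some (M.Γ.tgt e)

/-- The path along the new edge, if the oriented edge is in `S`. -/
def foldStem (d : M.Γ.E × Bool) : FreeGroup (Option M.Γ.E) :=
  if S d then FreeGroup.of none else 1

/-- The map to the folded graph. -/
def foldHom : FreeGroup M.Γ.E →* FreeGroup (Option M.Γ.E) :=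
  FreeGroup.lift fun e =>
    M.foldStem S (e, true) * FreeGroup.of (some e) * (M.foldStem S (e, false))⁻¹

/-- The map from the folded graph that collapses the new edge. -/
def foldBack : FreeGroup (Option M.Γ.E) →* FreeGroup M.Γ.E :=
  FreeGroup.lift fun e => e.elim 1 FreeGroup.of

lemma foldBack_foldStem (d : M.Γ.E × Bool) : M.foldBack (M.foldStem S d) = 1 := by
  unfold foldStem foldBack
  split_ifs <;> simp

lemma foldBack_foldHom (g : FreeGroup M.Γ.E) : M.foldBack (M.foldHom S g) = g := by
  have : M.foldBack.comp (M.foldHom S) = MonoidHom.id _ := by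
    refine FreeGroup.ext_hom _ _ fun e => ?_
    rw [MonoidHom.comp_apply, foldHom, FreeGroup.lift_apply_of, map_mul, map_mul, map_inv,
      foldBack_foldStem, foldBack_foldStem]
    simp [foldBack]
  exact DFunLike.congr_fun this g

lemma foldStem_mem {v : M.Γ.V} {S : M.Γ.E × Bool → Prop} [DecidablePred S]
    (hS : ∀ d, S d → M.Γ.init d = v) (d : M.Γ.E × Bool) :
    M.foldStem S d ∈ (M.foldGraph v S).pathClass (some (M.Γ.init d))
      (if S d then none else some (M.Γ.init d)) := by
  by_cases h : S d
  · rw [foldStem, if_pos h, if_pos h, hS d h]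
    exact of_mem_pathClass (Γ := M.foldGraph v S) none
  · rw [foldStem, if_neg h, if_neg h]
    exact one_mem_pathClass (Γ := M.foldGraph v S) _

/-- The folded graph, with its marking. -/
abbrev fold {v : M.Γ.V} {S : M.Γ.E × Bool → Prop} [DecidablePred S]
    (hS : ∀ d, S d → M.Γ.init d = v) : PreMarked n :=
  M.transfer (M.foldGraph v S) (M.foldHom S) M.foldBack some (fun u => u.getD v) (fun _ => 1)
    (fun u => u.elim (FreeGroup.of none)⁻¹ fun _ => 1)
    (fun e => by
      rw [foldHom, FreeGroup.lift_apply_of]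
      exact mul_mem_pathClass (mul_mem_pathClass (M.foldStem_mem hS (e, true))
        (of_mem_pathClass (Γ := M.foldGraph v S) (some e)))
        (inv_mem_pathClass (M.foldStem_mem hS (e, false))))
    (fun e => by
      cases e with
      | none =>
        rw [foldBack, FreeGroup.lift_apply_of]
        exact one_mem_pathClass _
      | some e =>
        rw [foldBack, FreeGroup.lift_apply_of]
        have h1 : Option.getD (if S (e, true) then none else some (M.Γ.src e)) v = M.Γ.src e := by
          split_ifs with h
          · exact (hS _ h).symm
          · rfl
        have h2 : Option.getD (if S (e, false) then none else some (M.Γ.tgt e)) v = M.Γ.tgt e := by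
          split_ifs with h
          · exact (hS _ h).symm
          · rfl
        change FreeGroup.of e ∈ M.Γ.pathClass (Option.getD (if S (e, true) then _ else _) v)
          (Option.getD (if S (e, false) then _ else _) v)
        rw [h1, h2]
        exact of_mem_pathClass e)
    (fun u => one_mem_pathClass _)
    (fun u => by
      cases u with
      | none => exact inv_mem_pathClass (of_mem_pathClass (Γ := M.foldGraph v S) none)
      | some u => exact one_mem_pathClass _)
    (fun e => by rw [M.foldBack_foldHom S]; simp)
    (fun e => by
      cases e with
      | none =>
        rw [foldBack, FreeGroup.lift_apply_of]
        change M.foldHom S 1 = (1 : FreeGroup (Option M.Γ.E))⁻¹ * FreeGroup.of none *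
          (FreeGroup.of none)⁻¹
        simp
      | some e =>
        rw [foldBack, FreeGroup.lift_apply_of]
        change M.foldHom S (FreeGroup.of e) =
          (Option.elim (if S (e, true) then none else some (M.Γ.src e)) (FreeGroup.of none)⁻¹
            fun _ => 1)⁻¹ * FreeGroup.of (some e) *
          (Option.elim (if S (e, false) then none else some (M.Γ.tgt e)) (FreeGroup.of none)⁻¹
            fun _ => 1)
        rw [foldHom, FreeGroup.lift_apply_of, foldStem, foldStem]
        split_ifs <;> simp)

/-- The metric on the folded graph in which the new edge has length zero. -/
def foldMetric (ℓ : M.Γ.E → ℝ) : Option M.Γ.E → ℝ := fun e => e.elim 0 ℓ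

lemma foldMetric_nonneg {ℓ : M.Γ.E → ℝ} (hℓ : ∀ e, 0 ≤ ℓ e) (e : Option M.Γ.E) :
    0 ≤ M.foldMetric ℓ e := by
  cases e with
  | none => exact le_rfl
  | some e => exact hℓ e

/-- With the new edge of length zero, neither the fold nor the collapse of the new edge lengthens
anything. So the lengths before a fold come from a metric on the folded graph. -/
lemma tl_foldMetric {ℓ : M.Γ.E → ℝ} (hℓ : ∀ e, 0 ≤ ℓ e) (W : FreeGroup M.Γ.E) :
    tl (M.foldMetric ℓ) (M.foldHom S W) = tl ℓ W := by
  refine le_antisymm ?_ ?_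
  · refine tl_hom_le (M.foldMetric_nonneg hℓ) _ (fun e => ?_) W
    rw [foldHom, FreeGroup.lift_apply_of]
    have hst : ∀ d, wlen (M.foldMetric ℓ) (M.foldStem S d) = 0 := by
      intro d
      unfold foldStem
      split_ifs
      · rw [wlen_of]; rfl
      · simp
    refine (wlen_mul_le (M.foldMetric_nonneg hℓ) _ _).trans ?_
    rw [wlen_inv, hst, add_zero]
    refine (wlen_mul_le (M.foldMetric_nonneg hℓ) _ _).trans ?_
    rw [hst, zero_add, wlen_of]
    exact le_rfl
  · have := tl_hom_le hℓ M.foldBack (ℓ := M.foldMetric ℓ) (fun e => ?_) (M.foldHom S W)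
    · rwa [foldBack_foldHom] at this
    · cases e with
      | none => simp [foldBack, foldMetric]
      | some e => simp [foldBack, foldMetric]

/-! ### Collapsing an edge -/

variable {M}

/-- The vertex to which a vertex is mapped when the edge `a` is collapsed. -/
def collapseV {a : M.Γ.E} (ha : M.Γ.src a ≠ M.Γ.tgt a) (u : M.Γ.V) :
    {u : M.Γ.V // u ≠ M.Γ.tgt a} :=
  if h : u = M.Γ.tgt a then ⟨M.Γ.src a, ha⟩ else ⟨u, h⟩

/-- Collapse the edge `a`. -/
abbrev collapseGraph {a : M.Γ.E} (ha : M.Γ.src a ≠ M.Γ.tgt a) : FinGraph where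
  V := {u : M.Γ.V // u ≠ M.Γ.tgt a}
  E := {e : M.Γ.E // e ≠ a}
  src := fun e => collapseV ha (M.Γ.src e)
  tgt := fun e => collapseV ha (M.Γ.tgt e)

/-- The effect on paths of collapsing the edge `a`. -/
def collapseHom (a : M.Γ.E) : FreeGroup M.Γ.E →* FreeGroup {e : M.Γ.E // e ≠ a} :=
  FreeGroup.lift fun e => if h : e = a then 1 else FreeGroup.of ⟨e, h⟩

/-- The path along the edge `a` from a vertex to its image after collapsing. -/
def collapseGauge (a : M.Γ.E) (u : M.Γ.V) : FreeGroup M.Γ.E :=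
  if u = M.Γ.tgt a then (FreeGroup.of a)⁻¹ else 1

/-- A homotopy inverse of the collapse of the edge `a`. -/
def collapseBack (a : M.Γ.E) : FreeGroup {e : M.Γ.E // e ≠ a} →* FreeGroup M.Γ.E :=
  FreeGroup.lift fun e => (collapseGauge a (M.Γ.src e))⁻¹ * FreeGroup.of e.1 *
    collapseGauge a (M.Γ.tgt e)

lemma collapseGauge_mem {a : M.Γ.E} (ha : M.Γ.src a ≠ M.Γ.tgt a) (u : M.Γ.V) :
    collapseGauge a u ∈ M.Γ.pathClass u (collapseV ha u).1 := by
  unfold collapseGauge collapseV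
  split_ifs with h
  · rw [h]; exact inv_mem_pathClass (of_mem_pathClass a)
  · exact one_mem_pathClass u

lemma collapseHom_gauge (a : M.Γ.E) (u : M.Γ.V) : collapseHom a (collapseGauge a u) = 1 := by
  unfold collapseGauge collapseHom
  split_ifs <;> simp

lemma collapseBack_collapseHom_of {a : M.Γ.E} (ha : M.Γ.src a ≠ M.Γ.tgt a) (e : M.Γ.E) :
    collapseBack a (collapseHom a (FreeGroup.of e)) =
      (collapseGauge a (M.Γ.src e))⁻¹ * FreeGroup.of e * collapseGauge a (M.Γ.tgt e) := by
  by_cases h : e = a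
  · subst h
    simp [collapseHom, collapseGauge, ha]
  · simp [collapseHom, h, collapseBack]

/-- The marked graph obtained by collapsing the edge `a`. -/
abbrev collapse {a : M.Γ.E} (ha : M.Γ.src a ≠ M.Γ.tgt a) : PreMarked n :=
  M.transfer (collapseGraph ha) (collapseHom a) (collapseBack a) (collapseV ha) Subtype.val
    (collapseGauge a) (fun _ => 1)
    (fun e => by
      by_cases h : e = a
      · subst h
        have h1 : collapseV ha (M.Γ.src e) = collapseV ha (M.Γ.tgt e) := by
          simp [collapseV, ha]
        rw [h1]
        simpa [collapseHom] using one_mem_pathClass (Γ := collapseGraph ha) _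
      · have h1 : collapseHom a (FreeGroup.of e) = FreeGroup.of ⟨e, h⟩ := by
          simp [collapseHom, h]
        rw [h1]
        exact of_mem_pathClass (Γ := collapseGraph ha) ⟨e, h⟩)
    (fun e => by
      rw [collapseBack, FreeGroup.lift_apply_of]
      exact mul_mem_pathClass (mul_mem_pathClass (inv_mem_pathClass (collapseGauge_mem ha _))
        (of_mem_pathClass e.1)) (collapseGauge_mem ha _))
    (collapseGauge_mem ha)
    (fun u => one_mem_pathClass_of_eq (by simp [collapseV, u.2]))
    (collapseBack_collapseHom_of ha)
    (fun e => by
      rw [collapseBack, FreeGroup.lift_apply_of, map_mul, map_mul, map_inv, collapseHom_gauge,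
        collapseHom_gauge]
      simp [collapseHom, e.2])

/-- The collapse and its homotopy inverse differ from the identity only along `a`, which has length
zero. Neither increases lengths. -/
lemma tl_collapse {a : M.Γ.E} (ha : M.Γ.src a ≠ M.Γ.tgt a) {ℓ : M.Γ.E → ℝ} (hℓ : ∀ e, 0 ≤ ℓ e)
    (h0 : ℓ a = 0) (g : FreeGroup (Fin n)) :
    tl (fun e : {e : M.Γ.E // e ≠ a} => ℓ e.1) (collapseHom a (M.f g)) = tl ℓ (M.f g) := by
  have hℓ' : ∀ e : {e : M.Γ.E // e ≠ a}, 0 ≤ ℓ e.1 := fun e => hℓ _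
  have hg : ∀ u, wlen ℓ (collapseGauge a u) = 0 := by
    intro u
    unfold collapseGauge
    split_ifs <;> simp [h0]
  refine le_antisymm ?_ ?_
  · refine tl_hom_le hℓ' _ (fun e => ?_) _
    by_cases h : e = a
    · simpa [collapseHom, h] using hℓ a
    · simp [collapseHom, h]
  · have h1 := tl_hom_le hℓ (collapseBack a) (ℓ := fun e : {e : M.Γ.E // e ≠ a} => ℓ e.1)
      (fun e => ?_) (collapseHom a (M.f g))
    · have h2 : collapseBack a (collapseHom a (M.f g)) = _ :=
        hom_gauge ((collapseBack a).comp (collapseHom a)) (MonoidHom.id _) (collapseGauge a)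
          (collapseBack_collapseHom_of ha) (M.f_mem g)
      rwa [h2, tl_conj_inv hℓ] at h1
    · rw [collapseBack, FreeGroup.lift_apply_of]
      refine (wlen_mul_le hℓ _ _).trans ?_
      rw [hg, add_zero]
      refine (wlen_mul_le hℓ _ _).trans ?_
      rw [wlen_inv, hg, zero_add, wlen_of]

end PreMarked


open FinGraph

/-! ### Stripping letters from words -/

section Strip

variable {A : Type} [DecidableEq A]

lemma mk_bar (d : A × Bool) : FreeGroup.mk [bar d] = (FreeGroup.mk [d])⁻¹ := by
  rw [FreeGroup.inv_mk]; rfl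

/-- A letter, or the empty word. -/
def stem (p : A × Bool) (b : Prop) [Decidable b] : FreeGroup A := if b then FreeGroup.mk [p] else 1

lemma toWord_eq_cons {w : FreeGroup A} {p : A × Bool} (h : w.toWord.head? = some p) :
    w.toWord = p :: ((FreeGroup.mk [p])⁻¹ * w).toWord := by
  obtain ⟨l, hl⟩ : ∃ l, w.toWord = p :: l := by
    cases hw : w.toWord with
    | nil => rw [hw] at h; simp at h
    | cons q l =>
      rw [hw] at h
      obtain rfl : q = p := by simpa using h
      exact ⟨l, rfl⟩
  have h1 : (FreeGroup.mk [p])⁻¹ * w = FreeGroup.mk l := by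
    rw [← FreeGroup.mk_toWord (x := w), hl, mk_cons p l, inv_mul_cancel_left]
  have h2 : FreeGroup.IsReduced l := by
    have := FreeGroup.isReduced_toWord (x := w)
    rw [hl, FreeGroup.IsReduced] at this
    exact this.tail
  rw [h1, FreeGroup.toWord_mk, h2.reduce_eq, hl]

lemma toWord_strip {w : FreeGroup A} {p : A × Bool} {b₁ b₂ : Prop} [Decidable b₁] [Decidable b₂]
    (h₁ : b₁ → w.toWord.head? = some p) (h₂ : b₂ → w⁻¹.toWord.head? = some p) :
    w.toWord = (if b₁ then [p] else []) ++ ((stem p b₁)⁻¹ * w * stem p b₂).toWord ++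
      (if b₂ then [bar p] else []) := by
  have key : ∀ {w : FreeGroup A}, (b₂ → w⁻¹.toWord.head? = some p) →
      w.toWord = (w * stem p b₂).toWord ++ (if b₂ then [bar p] else []) := by
    intro w h
    by_cases hb : b₂
    · have h3 := toWord_eq_cons (h hb)
      have h4 := congrArg FreeGroup.invRev h3
      rw [FreeGroup.toWord_inv, FreeGroup.invRev_invRev, invRev_eq, List.map_cons,
        List.reverse_cons, ← invRev_eq, ← FreeGroup.toWord_inv] at h4
      rw [stem, if_pos hb, if_pos hb, h4]
      congr 2
      group
    · simp [stem, hb]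
  by_cases hb : b₁
  · have h3 := toWord_eq_cons (h₁ hb)
    have h4 : b₂ → ((FreeGroup.mk [p])⁻¹ * w)⁻¹.toWord.head? = some p := by
      intro hb2
      have h5 := h₂ hb2
      rw [FreeGroup.toWord_inv, h3, invRev_eq, List.map_cons, List.reverse_cons, ← invRev_eq,
        ← FreeGroup.toWord_inv] at h5
      cases hx : ((FreeGroup.mk [p])⁻¹ * w)⁻¹.toWord with
      -- The two stripped letters could collide only if `w` were the single letter `p`. But then
      -- `w⁻¹` starts with `bar p`, not with `p`.
      | nil => rw [hx] at h5; exact absurd (by simpa using h5) (bar_ne p)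
      | cons q l => rw [hx] at h5; simpa using h5
    rw [if_pos hb, h3, key h4]
    simp [stem, hb]
  · rw [if_neg hb, List.nil_append, stem, if_neg hb, inv_one, one_mul]
    exact key h₂

lemma wlen_strip (wt : A → ℝ) {w : FreeGroup A} {p : A × Bool} {b₁ b₂ : Prop} [Decidable b₁]
    [Decidable b₂] (h₁ : b₁ → w.toWord.head? = some p) (h₂ : b₂ → w⁻¹.toWord.head? = some p) :
    wlen wt w = wlen wt ((stem p b₁)⁻¹ * w * stem p b₂) +
      wt p.1 * ((if b₁ then 1 else 0) + (if b₂ then 1 else 0)) := by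
  rw [wlen, toWord_strip h₁ h₂, lsum_append, lsum_append, ← wlen]
  split_ifs <;> simp <;> ring

/-- The hypothesis rules out a cancellation between the last letter of `u` and the first letter of
`v`, so the concatenation is already reduced. -/
lemma toWord_mul_of_head? {u v : FreeGroup A}
    (h : ∀ p, u⁻¹.toWord.head? = some p → v.toWord.head? ≠ some p) :
    (u * v).toWord = u.toWord ++ v.toWord := by
  have : FreeGroup.IsReduced (u.toWord ++ v.toWord) := by
    refine List.isChain_append.2 ⟨FreeGroup.isReduced_toWord, FreeGroup.isReduced_toWord, ?_⟩
    intro x hx y hy h1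
    by_contra h2
    have h3 : y = bar x := by
      rcases eq_or_eq_bar h1 with h3 | h3
      · exact absurd (by rw [h3]) h2
      · rw [h3, bar_bar]
    refine h (bar x) ?_ (h3 ▸ hy)
    rw [FreeGroup.toWord_inv, invRev_eq, List.head?_reverse, List.getLast?_map]
    rw [Option.mem_def.1 hx]; rfl
  rw [← this.reduce_eq, ← FreeGroup.toWord_mk, mk_append, FreeGroup.mk_toWord,
    FreeGroup.mk_toWord]

end Strip

/-! ### Labelled graphs -/

/-- A marked graph together with a homomorphism from its paths to a free group that induces the
homomorphism `F` on the fundamental group. -/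
structure Labelled {n : ℕ} {A : Type} (F : FreeGroup (Fin n) →* FreeGroup A) extends
    PreMarked n where
  lab : FreeGroup Γ.E →* FreeGroup A
  comp : ∀ g, lab (f g) = F g

namespace Labelled

variable {n : ℕ} {A : Type} [DecidableEq A] {F : FreeGroup (Fin n) →* FreeGroup A}
  (Z : Labelled F) (wt : A → ℝ)

/-- The length of an edge of a labelled graph. -/
def len (e : Z.Γ.E) : ℝ := wlen wt (Z.lab (FreeGroup.of e))

/-- The volume of a labelled graph. -/
def vol : ℝ := ∑ e, Z.len wt e

/-- The number of edges and letters of a labelled graph. -/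
def complexity : ℕ := ∑ e, (2 * (Z.lab (FreeGroup.of e)).norm + 1)

variable {wt}

lemma len_nonneg (hwt : ∀ a, 0 ≤ wt a) (e : Z.Γ.E) : 0 ≤ Z.len wt e := wlen_nonneg hwt _

lemma tl_F_le (hwt : ∀ a, 0 ≤ wt a) (g : FreeGroup (Fin n)) :
    tl wt (F g) ≤ tl (Z.len wt) (Z.f g) := by
  rw [← Z.comp]
  exact tl_hom_le hwt Z.lab (fun e => le_rfl) _

/-! #### Immersed labelled graphs -/

lemma lab_mk_singleton (d : Z.Γ.E × Bool) :
    Z.lab (FreeGroup.mk [bar d]) = (Z.lab (FreeGroup.mk [d]))⁻¹ := by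
  rw [mk_bar, map_inv]

lemma wlen_lab_mk_singleton (wt : A → ℝ) (d : Z.Γ.E × Bool) :
    wlen wt (Z.lab (FreeGroup.mk [d])) = Z.len wt d.1 := by
  obtain ⟨e, b⟩ := d
  cases b
  · rw [mk_singleton_false, map_inv, wlen_inv, len]
  · rfl

/-- The first letter of the label of an oriented edge. -/
def first (d : Z.Γ.E × Bool) : Option (A × Bool) := (Z.lab (FreeGroup.mk [d])).toWord.head?

/-- In an immersed graph different edges leaving a vertex have different first letters, so labels
along a path without backtracking concatenate without cancellation. The second clause carries the
induction. -/
lemma wlen_lab_of_isChain (h1 : ∀ d, Z.first d ≠ none)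
    (h2 : ∀ d d', Z.Γ.init d = Z.Γ.init d' → Z.first d = Z.first d' → d = d')
    {L : List (Z.Γ.E × Bool)} (h : L.IsChain Z.Γ.Turn) :
    wlen wt (Z.lab (FreeGroup.mk L)) = lsum (Z.len wt) L ∧
      ∀ d ∈ L.head?, (Z.lab (FreeGroup.mk L)).toWord.head? = Z.first d := by
  induction L with
  | nil => simp [← FreeGroup.one_eq_mk]
  | cons d L ih =>
    obtain ⟨ih1, ih2⟩ := ih h.tail
    have key : (Z.lab (FreeGroup.mk (d :: L))).toWord =
        (Z.lab (FreeGroup.mk [d])).toWord ++ (Z.lab (FreeGroup.mk L)).toWord := by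
      rw [mk_cons, map_mul]
      refine toWord_mul_of_head? fun p hp hp' => ?_
      cases L with
      | nil => simp [← FreeGroup.one_eq_mk] at hp'
      | cons e L =>
        rw [ih2 e (by simp)] at hp'
        rw [List.isChain_cons_cons] at h
        have h3 : Z.first (bar d) = some p := by
          rw [first, lab_mk_singleton]; exact hp
        exact h.1.2 (h2 _ _ (by rw [init_bar, h.1.1]) (hp'.trans h3.symm))
    refine ⟨?_, fun d' hd' => ?_⟩
    · rw [wlen, key, lsum_append, ← wlen, ← wlen, ih1, wlen_lab_mk_singleton, lsum_cons]
    · obtain rfl : d = d' := by simpa using hd'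
      rw [key, List.head?_append]
      cases h3 : (Z.lab (FreeGroup.mk [d])).toWord.head? with
      | none => exact absurd h3 (h1 d)
      | some p => rw [first, h3]; rfl

lemma isChain_flatten_replicate {L : List (Z.Γ.E × Bool)} (h : Z.Γ.IsLoop L) (k : ℕ) :
    (List.replicate k L).flatten.IsChain Z.Γ.Turn := by
  induction k with
  | zero => simp
  | succ k ih =>
    cases k with
    | zero => simpa using h.isChain
    | succ k =>
      rw [List.replicate_succ, List.flatten_cons] at ih ⊢
      rw [List.replicate_succ, List.flatten_cons, ← List.append_assoc]
      exact List.IsChain.append_overlap h.2 ih h.1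

lemma mk_flatten_replicate {E : Type} [DecidableEq E] (L : List (E × Bool)) (k : ℕ) :
    FreeGroup.mk (List.replicate k L).flatten = FreeGroup.mk L ^ k := by
  induction k with
  | zero => rfl
  | succ k ih => rw [List.replicate_succ, List.flatten_cons, mk_append, ih, pow_succ']

/-- All powers of a loop are paths without backtracking, so their labels have full length. The
growth rate then gives the bound, which ends the induction on folds. -/
lemma tl_le_of_immersed (hwt : ∀ a, 0 ≤ wt a) (h1 : ∀ d, Z.first d ≠ none)
    (h2 : ∀ d d', Z.Γ.init d = Z.Γ.init d' → Z.first d = Z.first d' → d = d')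
    (g : FreeGroup (Fin n)) : tl (Z.len wt) (Z.f g) ≤ tl wt (F g) := by
  rcases eq_or_ne g 1 with rfl | hg
  · simp
  obtain ⟨L, -, hL, -, p, -, hp⟩ := Z.exists_loop hg
  have hl := Z.len_nonneg hwt
  rw [← Z.comp, hp, tl_conj hl, map_mul, map_mul, map_inv, tl_conj hwt]
  refine (tl_le_of_wlen_pow_le hl (c := 1) (C := 0) fun k => ?_).trans_eq (one_mul _)
  rw [one_mul, add_zero, ← map_pow, ← mk_flatten_replicate,
    (Z.wlen_lab_of_isChain h1 h2 (isChain_flatten_replicate Z hL k)).1]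
  exact wlen_mk_le hl _

/-! #### Collapsing edges with empty labels -/

/-- A closed edge with empty label would give a nontrivial element of translation length zero. Hence
such an edge can be collapsed. -/
lemma src_ne_tgt {ε : ℝ} (hε : 0 < ε) (hF : ∀ g, g ≠ 1 → ε ≤ tl wt (F g)) {a : Z.Γ.E}
    (ha : Z.lab (FreeGroup.of a) = 1) : Z.Γ.src a ≠ Z.Γ.tgt a := by
  intro h
  have h1 := of_mem_pathClass a
  rw [← h] at h1
  obtain ⟨g, p, -, hp⟩ := Z.exists_of_mem_pathClass h1
  have h2 := Z.comp g
  rw [hp, map_mul, map_mul, ha, map_inv, mul_one, mul_inv_cancel] at h2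
  have hg : g ≠ 1 := by
    rintro rfl
    rw [map_one] at hp
    exact FreeGroup.of_ne_one a (conj_eq_one_iff.1 hp.symm)
  have := hF g hg
  rw [← h2, tl_one] at this
  linarith

/-- Collapse an edge with empty label. -/
abbrev collapse {a : Z.Γ.E} (h : Z.Γ.src a ≠ Z.Γ.tgt a) (ha : Z.lab (FreeGroup.of a) = 1) :
    Labelled F where
  __ := PreMarked.collapse (M := Z.toPreMarked) h
  lab := FreeGroup.lift fun e => Z.lab (FreeGroup.of e.1)
  comp g := by
    rw [← Z.comp]
    have : (FreeGroup.lift fun e : {e : Z.Γ.E // e ≠ a} => Z.lab (FreeGroup.of e.1)).comp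
        (PreMarked.collapseHom (M := Z.toPreMarked) a) = Z.lab := by
      refine FreeGroup.ext_hom _ _ fun e => ?_
      by_cases he : e = a
      · subst he; simp [PreMarked.collapseHom, ha]
      · simp [PreMarked.collapseHom, he]
    exact DFunLike.congr_fun this _

lemma len_collapse {a : Z.Γ.E} (h : Z.Γ.src a ≠ Z.Γ.tgt a) (ha : Z.lab (FreeGroup.of a) = 1)
    (e : {e : Z.Γ.E // e ≠ a}) : (Z.collapse h ha).len wt e = Z.len wt e.1 := by
  simp [len]

lemma len_eq_zero {a : Z.Γ.E} (ha : Z.lab (FreeGroup.of a) = 1) : Z.len wt a = 0 := by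
  rw [len, ha, wlen_one]

lemma tl_collapse (hwt : ∀ a, 0 ≤ wt a) {a : Z.Γ.E} (h : Z.Γ.src a ≠ Z.Γ.tgt a)
    (ha : Z.lab (FreeGroup.of a) = 1) (g : FreeGroup (Fin n)) :
    tl ((Z.collapse h ha).len wt) ((Z.collapse h ha).f g) = tl (Z.len wt) (Z.f g) := by
  rw [funext (Z.len_collapse h ha)]
  exact PreMarked.tl_collapse h (Z.len_nonneg hwt) (Z.len_eq_zero ha) g

lemma sum_collapse {R : Type} [AddCommMonoid R] {E : Type} [Fintype E] [DecidableEq E] (a : E)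
    (f : E → R) : ∑ e, f e = f a + ∑ e : {e : E // e ≠ a}, f e.1 := by
  rw [← Finset.add_sum_erase _ _ (Finset.mem_univ a)]
  congr 1
  exact Finset.sum_subtype _ (by simp) _

lemma vol_collapse {a : Z.Γ.E} (h : Z.Γ.src a ≠ Z.Γ.tgt a) (ha : Z.lab (FreeGroup.of a) = 1) :
    (Z.collapse h ha).vol wt = Z.vol wt := by
  rw [vol, vol, sum_collapse a, Z.len_eq_zero ha, zero_add]
  exact Finset.sum_congr rfl fun e _ => Z.len_collapse h ha e

lemma complexity_collapse {a : Z.Γ.E} (h : Z.Γ.src a ≠ Z.Γ.tgt a)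
    (ha : Z.lab (FreeGroup.of a) = 1) : (Z.collapse h ha).complexity < Z.complexity := by
  have : (Z.collapse h ha).complexity =
      ∑ e : {e : Z.Γ.E // e ≠ a}, (2 * (Z.lab (FreeGroup.of e.1)).norm + 1) :=
    Finset.sum_congr rfl fun e _ => by simp
  rw [this, complexity, sum_collapse a]
  omega

end Labelled


open FinGraph

namespace Labelled

variable {n : ℕ} {A : Type} [DecidableEq A] {F : FreeGroup (Fin n) →* FreeGroup A}
  (Z : Labelled F) {wt : A → ℝ}

/-! #### Folding -/

/-- The oriented edges at `v` whose labels start with `p`. -/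
def Starts (v : Z.Γ.V) (p : A × Bool) (d : Z.Γ.E × Bool) : Prop :=
  Z.Γ.init d = v ∧ Z.first d = some p

instance (v : Z.Γ.V) (p : A × Bool) : DecidablePred (Z.Starts v p) := fun _ => by
  unfold Starts; infer_instance

variable (v : Z.Γ.V) (p : A × Bool)

/-- The label of an edge after folding. -/
def stripped (e : Z.Γ.E) : FreeGroup A :=
  (stem p (Z.Starts v p (e, true)))⁻¹ * Z.lab (FreeGroup.of e) *
    stem p (Z.Starts v p (e, false))

/-- The labels after folding. -/
def foldLab : FreeGroup (Option Z.Γ.E) →* FreeGroup A :=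
  FreeGroup.lift fun e => e.elim (FreeGroup.mk [p]) (Z.stripped v p)

lemma foldLab_foldStem (d : Z.Γ.E × Bool) :
    Z.foldLab v p (Z.toPreMarked.foldStem (Z.Starts v p) d) = stem p (Z.Starts v p d) := by
  unfold PreMarked.foldStem stem foldLab
  split_ifs <;> simp

lemma foldLab_foldHom (W : FreeGroup Z.Γ.E) :
    Z.foldLab v p (Z.toPreMarked.foldHom (Z.Starts v p) W) = Z.lab W := by
  have : (Z.foldLab v p).comp (Z.toPreMarked.foldHom (Z.Starts v p)) = Z.lab := by
    refine FreeGroup.ext_hom _ _ fun e => ?_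
    have h : Z.foldLab v p (FreeGroup.of (some e)) = Z.stripped v p e := by simp [foldLab]
    rw [MonoidHom.comp_apply, PreMarked.foldHom, FreeGroup.lift_apply_of, map_mul, map_mul,
      map_inv, foldLab_foldStem, foldLab_foldStem, h, stripped]
    group
  exact DFunLike.congr_fun this W

/-- Fold all the oriented edges at `v` whose labels start with `p`. -/
abbrev fold : Labelled F where
  __ := PreMarked.fold Z.toPreMarked (v := v) (S := Z.Starts v p) fun _ h => h.1
  lab := Z.foldLab v p
  comp g := (Z.foldLab_foldHom v p _).trans (Z.comp g)

/-- The number of ends of an edge that are folded. -/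
def ends (e : Z.Γ.E) : ℝ :=
  (if Z.Starts v p (e, true) then 1 else 0) + (if Z.Starts v p (e, false) then 1 else 0)

lemma wlen_lab_of (wt : A → ℝ) (e : Z.Γ.E) : wlen wt (Z.lab (FreeGroup.of e)) =
    wlen wt (Z.stripped v p e) + wt p.1 * Z.ends v p e :=
  wlen_strip wt (fun h => h.2) (fun h => by
    have := h.2
    rwa [first, mk_singleton_false, map_inv] at this)

lemma len_fold_none : (Z.fold v p).len wt none = wt p.1 := by
  change wlen wt (Z.foldLab v p (FreeGroup.of none)) = _
  rw [foldLab, FreeGroup.lift_apply_of]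
  rw [Option.elim_none, wlen_mk_of_isReduced _ (by simp [FreeGroup.IsReduced])]
  simp

lemma len_fold_some (e : Z.Γ.E) :
    (Z.fold v p).len wt (some e) = Z.len wt e - wt p.1 * Z.ends v p e := by
  change wlen wt (Z.foldLab v p (FreeGroup.of (some e))) = _
  rw [foldLab, FreeGroup.lift_apply_of, len, Z.wlen_lab_of v p]
  simp

lemma two_le_sum_ends {d d' : Z.Γ.E × Bool} (hd : Z.Starts v p d) (hd' : Z.Starts v p d')
    (hne : d ≠ d') : 2 ≤ ∑ e, Z.ends v p e := by
  have h1 : ∑ e, Z.ends v p e = ∑ d, if Z.Starts v p d then (1 : ℝ) else 0 := by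
    rw [Fintype.sum_prod_type]
    exact Finset.sum_congr rfl fun e _ => by rw [Fintype.sum_bool, ends]
  rw [h1]
  calc (2 : ℝ) = ∑ x ∈ {d, d'}, if Z.Starts v p x then (1 : ℝ) else 0 := by
        rw [Finset.sum_pair hne, if_pos hd, if_pos hd']; norm_num
    _ ≤ _ := Finset.sum_le_sum_of_subset_of_nonneg (Finset.subset_univ _) fun x _ _ => by
        split_ifs <;> norm_num

/-- At least two ends of edges lose the letter `p`, while the new edge contributes it only once. -/
lemma vol_fold_le (hwt : ∀ a, 0 ≤ wt a) {d d' : Z.Γ.E × Bool} (hd : Z.Starts v p d)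
    (hd' : Z.Starts v p d') (hne : d ≠ d') : (Z.fold v p).vol wt + wt p.1 ≤ Z.vol wt := by
  have h1 : (Z.fold v p).vol wt = wt p.1 + ∑ e, (Z.len wt e - wt p.1 * Z.ends v p e) := by
    refine (Fintype.sum_option _).trans ?_
    rw [Z.len_fold_none v p]
    congr 1
    exact Finset.sum_congr rfl fun e _ => Z.len_fold_some v p e
  rw [h1, Finset.sum_sub_distrib, ← Finset.mul_sum, vol]
  have := mul_le_mul_of_nonneg_left (Z.two_le_sum_ends v p hd hd' hne) (hwt p.1)
  linarith

lemma complexity_eq : (Z.complexity : ℝ) =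
    2 * Z.vol (fun _ => 1) + Fintype.card Z.Γ.E := by
  have h : ∀ w : FreeGroup A, (w.norm : ℝ) = wlen (fun _ => 1) w := by
    intro w; rw [wlen, lsum_const, one_mul]; rfl
  rw [complexity, vol]
  push_cast
  simp only [h]
  rw [Finset.sum_add_distrib, ← Finset.mul_sum]
  simp [len]

/-- A fold removes at least one letter in total and adds one edge. Letters are counted twice so that
the complexity still drops. -/
lemma complexity_fold {d d' : Z.Γ.E × Bool} (hd : Z.Starts v p d)
    (hd' : Z.Starts v p d') (hne : d ≠ d') : (Z.fold v p).complexity < Z.complexity := by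
  have h1 := (Z.fold v p).complexity_eq
  have h2 := Z.complexity_eq
  have h3 := Z.vol_fold_le v p (wt := fun _ => 1) (fun _ => zero_le_one) hd hd' hne
  have h4 : (Fintype.card (Z.fold v p).Γ.E : ℝ) = Fintype.card Z.Γ.E + 1 := by
    have : Fintype.card (Option Z.Γ.E) = Fintype.card Z.Γ.E + 1 := Fintype.card_option
    exact_mod_cast this
  have : ((Z.fold v p).complexity : ℝ) < Z.complexity := by
    rw [h1, h2, h4]; linarith
  exact_mod_cast this

/-- The metric of `Z` on the folded graph. -/
abbrev oldLen (wt : A → ℝ) : Option Z.Γ.E → ℝ := Z.toPreMarked.foldMetric (Z.len wt)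

lemma tl_oldLen (hwt : ∀ a, 0 ≤ wt a) (g : FreeGroup (Fin n)) :
    tl (Z.oldLen wt) ((Z.fold v p).f g) = tl (Z.len wt) (Z.f g) :=
  PreMarked.tl_foldMetric Z.toPreMarked (Z.Starts v p) (Z.len_nonneg hwt) _

lemma tl_fold_le (hwt : ∀ a, 0 ≤ wt a) (g : FreeGroup (Fin n)) :
    tl ((Z.fold v p).len wt) ((Z.fold v p).f g) ≤ tl (Z.len wt) (Z.f g) := by
  have hl := (Z.fold v p).len_nonneg hwt
  refine tl_hom_le hl (Z.toPreMarked.foldHom (Z.Starts v p)) (fun e => ?_) _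
  have hs : ∀ d, wlen ((Z.fold v p).len wt) (Z.toPreMarked.foldStem (Z.Starts v p) d) =
      wt p.1 * if Z.Starts v p d then 1 else 0 := by
    intro d
    unfold PreMarked.foldStem
    split_ifs
    · rw [wlen_of, mul_one]; exact Z.len_fold_none v p
    · simp
  rw [PreMarked.foldHom, FreeGroup.lift_apply_of]
  refine (wlen_mul_le hl _ _).trans ?_
  rw [wlen_inv, hs]
  have h1 := wlen_mul_le hl (Z.toPreMarked.foldStem (Z.Starts v p) (e, true))
    (FreeGroup.of (some e))
  rw [hs, wlen_of] at h1
  have h2 : (Z.fold v p).len wt (some e) = _ := Z.len_fold_some v p e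
  rw [h2, ends] at h1
  linarith

/-- An edge is shortened once for each of its ends that moves to the new vertex `none`. The loss
along a loop is thus counted by its visits to that vertex. -/
lemma oldLen_le (hwt : ∀ a, 0 ≤ wt a) (d : Option Z.Γ.E × Bool) :
    Z.oldLen wt d.1 ≤ (Z.fold v p).len wt d.1 + wt p.1 *
      ((if (Z.fold v p).Γ.init d = (none : Option Z.Γ.V) then 1 else 0) +
        (if (Z.fold v p).Γ.term d = (none : Option Z.Γ.V) then 1 else 0)) := by
  have aux : ∀ b : Prop, ∀ _ : Decidable b, (0 : ℝ) ≤ if b then 1 else 0 := by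
    intro b _; split_ifs <;> norm_num
  obtain ⟨e, b⟩ := d
  cases e with
  | none =>
    have h1 : 0 ≤ (Z.fold v p).len wt none := (Z.fold v p).len_nonneg hwt _
    exact add_nonneg h1 (mul_nonneg (hwt _) (add_nonneg (aux _ _) (aux _ _)))
  | some e =>
    change Z.len wt e ≤ (Z.fold v p).len wt (some e) + _
    rw [Z.len_fold_some v p e, ends]
    have h1 : (if (Z.fold v p).Γ.src (some e) = (none : Option Z.Γ.V) then (1 : ℝ) else 0) =
        if Z.Starts v p (e, true) then 1 else 0 := by
      by_cases h : Z.Starts v p (e, true) <;> simp [h]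
    have h2 : (if (Z.fold v p).Γ.tgt (some e) = (none : Option Z.Γ.V) then (1 : ℝ) else 0) =
        if Z.Starts v p (e, false) then 1 else 0 := by
      by_cases h : Z.Starts v p (e, false) <;> simp [h]
    cases b
    · simp only [FinGraph.init, FinGraph.term, Bool.false_eq_true, if_false]
      rw [h1, h2]
      exact le_of_eq (by ring)
    · simp only [FinGraph.init, FinGraph.term, if_true]
      rw [h1, h2]
      exact le_of_eq (by ring)

lemma lsum_le_add_count {E : Type} [DecidableEq E] {ℓ ℓ' : E → ℝ} {c : ℝ} {P Q : E × Bool → Prop}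
    [DecidablePred P] [DecidablePred Q]
    (h : ∀ d : E × Bool, ℓ d.1 ≤ ℓ' d.1 + c * ((if P d then 1 else 0) + (if Q d then 1 else 0)))
    (L : List (E × Bool)) :
    lsum ℓ L ≤ lsum ℓ' L + c * ((L.countP P : ℝ) + L.countP Q) := by
  induction L with
  | nil => simp
  | cons d L ih =>
    have := h d
    rw [lsum_cons, lsum_cons, List.countP_cons, List.countP_cons]
    push_cast
    simp only [decide_eq_true_eq]
    linarith

/-- In the metric before the fold a loop of length `x` enters the new vertex at most `x / ε` times
and leaves it as often. Each such passage costs at most two letters `p`. -/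
lemma tl_le_tl_fold (hwt : ∀ a, 0 ≤ wt a) {ε : ℝ} (hε : 0 < ε)
    (hF : ∀ g, g ≠ 1 → ε ≤ tl wt (F g)) (g : FreeGroup (Fin n)) :
    tl (Z.len wt) (Z.f g) * (1 - 2 / ε * wt p.1) ≤
      tl ((Z.fold v p).len wt) ((Z.fold v p).f g) := by
  rcases eq_or_ne g 1 with rfl | hg
  · simp
  obtain ⟨L, hL, h⟩ := (Z.fold v p).exists_tl_eq hg
  have ho : ∀ e, 0 ≤ Z.oldLen wt e := PreMarked.foldMetric_nonneg _ (Z.len_nonneg hwt)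
  have hoε : ∀ g, g ≠ 1 → ε ≤ tl (Z.oldLen wt) ((Z.fold v p).f g) := fun g hg => by
    rw [Z.tl_oldLen v p hwt]; exact (hF g hg).trans (Z.tl_F_le hwt g)
  have h1 := (Z.fold v p).count_init_mul_le ho hoε none hL
  have h2 := (Z.fold v p).count_term_mul_le ho hoε none hL
  have h3 := lsum_le_add_count (Z.oldLen_le v p hwt) L
  rw [h _ ((Z.fold v p).len_nonneg hwt), ← Z.tl_oldLen v p hwt, h _ ho]
  set a : ℝ := ((L.countP fun d => (Z.fold v p).Γ.init d = none : ℕ) : ℝ)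
  set b : ℝ := ((L.countP fun d => (Z.fold v p).Γ.term d = none : ℕ) : ℝ)
  set x := lsum (Z.oldLen wt) L
  have h4 : a + b ≤ 2 / ε * x := by
    rw [div_mul_eq_mul_div, le_div_iff₀ hε]; linarith
  have h5 := mul_le_mul_of_nonneg_left h4 (hwt p.1)
  linarith

/-! #### The effect of folding on lengths -/

/-- A labelled graph can be collapsed and folded until it is immersed. -/
theorem exists_step {ε : ℝ} (hε : 0 < ε) (hF : ∀ g, g ≠ 1 → ε ≤ tl wt (F g)) :
    ((∀ d, Z.first d ≠ none) ∧
      ∀ d d', Z.Γ.init d = Z.Γ.init d' → Z.first d = Z.first d' → d = d') ∨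
    (∃ a, Z.lab (FreeGroup.of a) = 1 ∧ Z.Γ.src a ≠ Z.Γ.tgt a) ∨
    ∃ v p d d', Z.Starts v p d ∧ Z.Starts v p d' ∧ d ≠ d' := by
  by_cases h1 : ∀ d, Z.first d ≠ none
  · by_cases h2 : ∀ d d', Z.Γ.init d = Z.Γ.init d' → Z.first d = Z.first d' → d = d'
    · exact Or.inl ⟨h1, h2⟩
    · push Not at h2
      obtain ⟨d, d', hi, hf, hne⟩ := h2
      obtain ⟨p, hp⟩ := Option.ne_none_iff_exists'.1 (h1 d)
      exact Or.inr (Or.inr ⟨_, p, d, d', ⟨rfl, hp⟩, ⟨hi.symm, hf.symm.trans hp⟩, hne⟩)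
  · push Not at h1
    obtain ⟨⟨e, b⟩, hd⟩ := h1
    have h2 : Z.lab (FreeGroup.of e) = 1 := by
      rw [first, List.head?_eq_none_iff, FreeGroup.toWord_eq_nil_iff] at hd
      cases b
      · rwa [mk_singleton_false, map_inv, inv_eq_one] at hd
      · exact hd
    exact Or.inr (Or.inl ⟨e, h2, Z.src_ne_tgt hε hF h2⟩)

/-- Folding does not increase the products that control the stretch of all conjugacy classes. -/
theorem tl_mul_prodLen_le (hwt : ∀ a, 0 ≤ wt a) {ε : ℝ} (hε : 0 < ε)
    (hF : ∀ g, g ≠ 1 → ε ≤ tl wt (F g)) (g : FreeGroup (Fin n)) :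
    tl (Z.len wt) (Z.f g) * prodLen (fun g => tl wt (F g)) ≤
      tl wt (F g) * prodLen (fun g => tl (Z.len wt) (Z.f g)) := by
  induction hk : Z.complexity using Nat.strong_induction_on generalizing Z with
  | _ k ih =>
    subst hk
    rcases Z.exists_step hε hF with ⟨h1, h2⟩ | ⟨a, ha, hst⟩ | ⟨v, p, d, d', hd, hd', hne⟩
    · have h3 : ∀ g, tl (Z.len wt) (Z.f g) = tl wt (F g) := fun g =>
        le_antisymm (Z.tl_le_of_immersed hwt h1 h2 g) (Z.tl_F_le hwt g)
      simp only [h3]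
      exact le_rfl
    · have := ih _ (Z.complexity_collapse hst ha) (Z.collapse hst ha) rfl
      simpa only [Z.tl_collapse hwt hst ha] using this
    · have h1 := ih _ (Z.complexity_fold v p hd hd' hne) (Z.fold v p) rfl
      have hpos : ∀ g, g ≠ 1 → ε ≤ tl ((Z.fold v p).len wt) ((Z.fold v p).f g) := fun g hg =>
        (hF g hg).trans ((Z.fold v p).tl_F_le hwt g)
      -- The lengths before and after the fold are both metrics on the folded graph. The fold
      -- increases no length, so the comparison applies with constant 1 and no power is lost.
      have h2 := (Z.fold v p).tl_mul_prodLen_le (ℓ := Z.oldLen wt) (ℓ' := (Z.fold v p).len wt)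
        (PreMarked.foldMetric_nonneg _ (Z.len_nonneg hwt)) ((Z.fold v p).len_nonneg hwt)
        (fun g hg => hε.trans_le (hpos g hg)) le_rfl
        (fun g => by rw [one_mul, Z.tl_oldLen v p hwt]; exact Z.tl_fold_le v p hwt g) g
      simp only [Z.tl_oldLen v p hwt, one_pow, one_mul] at h2
      have h3 := prodLen_pos hε hpos
      have h4 := prodLen_nonneg (fun g => tl_nonneg hwt (F g))
      have h5 := prodLen_nonneg (fun g => tl_nonneg (Z.len_nonneg hwt) (Z.f g))
      refine le_of_mul_le_mul_right ?_ h3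
      have h6 := mul_le_mul_of_nonneg_right h2 h4
      have h7 := mul_le_mul_of_nonneg_right h1 h5
      linarith

/-- Folding changes lengths by an amount controlled by the loss of volume. -/
theorem tl_mul_le (hwt : ∀ a, 0 ≤ wt a) {ε V : ℝ} (hε : 0 < ε)
    (hF : ∀ g, g ≠ 1 → ε ≤ tl wt (F g)) (hV : ∀ Z : Labelled F, V ≤ Z.vol wt)
    (g : FreeGroup (Fin n)) :
    tl (Z.len wt) (Z.f g) * (1 - 2 / ε * (Z.vol wt - V)) ≤ tl wt (F g) := by
  induction hk : Z.complexity using Nat.strong_induction_on generalizing Z with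
  | _ k ih =>
    subst hk
    have hnn := tl_nonneg (Z.len_nonneg hwt) (Z.f g)
    have hε' : 0 ≤ 2 / ε := by positivity
    rcases Z.exists_step hε hF with ⟨h1, h2⟩ | ⟨a, ha, hst⟩ | ⟨v, p, d, d', hd, hd', hne⟩
    · refine le_trans ?_ (Z.tl_le_of_immersed hwt h1 h2 g)
      have := mul_nonneg hε' (sub_nonneg.2 (hV Z))
      exact mul_le_of_le_one_right hnn (by linarith)
    · have := ih _ (Z.complexity_collapse hst ha) (Z.collapse hst ha) rfl
      rwa [Z.tl_collapse hwt hst ha, Z.vol_collapse hst ha] at this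
    · have h1 := ih _ (Z.complexity_fold v p hd hd' hne) (Z.fold v p) rfl
      have h2 := Z.tl_le_tl_fold v p hwt hε hF g
      have h3 := Z.vol_fold_le v p hwt hd hd' hne
      have h4 := mul_nonneg hε' (sub_nonneg.2 (hV (Z.fold v p)))
      have h5 := mul_nonneg hε' (hwt p.1)
      have h6 := mul_le_mul_of_nonneg_left h3 hε'
      set α := 2 / ε * ((Z.fold v p).vol wt - V)
      set β := 2 / ε * wt p.1
      have h7 : tl (Z.len wt) (Z.f g) * (1 - 2 / ε * (Z.vol wt - V)) ≤
          tl (Z.len wt) (Z.f g) * (1 - α - β) :=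
        mul_le_mul_of_nonneg_left (by simp only [α, β]; linarith) hnn
      refine h7.trans ?_
      -- For `α ≤ 1` use `1 - α - β ≤ (1 - α) * (1 - β)`; otherwise the left side is not positive.
      rcases le_total α 1 with hα | hα
      · have h8 := mul_le_mul_of_nonneg_right h2 (sub_nonneg.2 hα)
        have h9 := mul_nonneg hnn (mul_nonneg h4 h5)
        nlinarith
      · exact (mul_nonpos_of_nonneg_of_nonpos hnn (by linarith)).trans (tl_nonneg hwt _)

end Labelled


open FinGraph

/-! ### Graphs without vertices of valence less than three -/

namespace FinGraph

variable {Γ : FinGraph}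

lemma valence_eq (v : Γ.V) :
    Γ.valence v = (Finset.univ.filter fun d => Γ.init d = v).card := Fintype.card_subtype _

lemma card_init_eq_card_term (v : Γ.V) :
    (Finset.univ.filter fun d => Γ.init d = v).card =
      (Finset.univ.filter fun d => Γ.term d = v).card := by
  refine Finset.card_bij (fun d _ => bar d) (fun d hd => ?_) (fun a _ b _ h => bar_injective h)
    fun d hd => ⟨bar d, ?_, bar_bar d⟩
  · simpa using hd
  · simpa using hd

/-- A set of oriented edges that is closed under continuing a path without backtracking is empty
or contains all oriented edges. -/
lemma eq_univ_of_closed (hc : Γ.Connected) (hv : ∀ v, 2 < Γ.valence v)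
    (C : Finset (Γ.E × Bool)) (hC : ∀ a ∈ C, ∀ b, Γ.Turn a b → b ∈ C) (hne : C.Nonempty) :
    C = Finset.univ := by
  -- Compare, at each vertex, the edges of `C` arriving and leaving. One arrival allows every
  -- departure except its reverse, and two arrivals allow all departures. So arrivals never
  -- outnumber departures, and as the totals agree there is equality everywhere.
  set In : Γ.V → Finset (Γ.E × Bool) := fun v => C.filter fun d => Γ.term d = v with hI
  set Ou : Γ.V → Finset (Γ.E × Bool) := fun v => C.filter fun d => Γ.init d = v with hO
  have hOu' : ∀ v, (Ou v).card ≤ Γ.valence v := fun v => by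
    rw [valence_eq]; exact Finset.card_le_card (Finset.filter_subset_filter _ (Finset.subset_univ _))
  have hIn' : ∀ v, (In v).card ≤ Γ.valence v := fun v => by
    rw [valence_eq, card_init_eq_card_term]
    exact Finset.card_le_card (Finset.filter_subset_filter _ (Finset.subset_univ _))
  have h1 : ∀ v, ∀ a ∈ In v, Γ.valence v - 1 ≤ (Ou v).card := by
    intro v a ha
    rw [valence_eq, ← Finset.card_erase_of_mem (s := Finset.univ.filter fun d => Γ.init d = v)
      (a := bar a) (by simpa using (Finset.mem_filter.1 ha).2)]
    refine Finset.card_le_card fun b hb => ?_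
    simp only [Finset.mem_erase, Finset.mem_filter, Finset.mem_univ, true_and] at hb
    have ha' := Finset.mem_filter.1 ha
    exact Finset.mem_filter.2 ⟨hC a ha'.1 b ⟨ha'.2.trans hb.2.symm, hb.1⟩, hb.2⟩
  have h2 : ∀ v, 1 < (In v).card → Γ.valence v ≤ (Ou v).card := by
    intro v hlt
    obtain ⟨a, ha, a', ha', hne⟩ := Finset.one_lt_card.1 hlt
    rw [valence_eq]
    refine Finset.card_le_card fun b hb => ?_
    simp only [Finset.mem_filter, Finset.mem_univ, true_and] at hb
    rw [hI, Finset.mem_filter] at ha ha'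
    refine Finset.mem_filter.2 ⟨?_, hb⟩
    by_cases h : b = bar a
    · refine hC a' ha'.1 b ⟨ha'.2.trans hb.symm, fun h' => hne (bar_injective (h.symm.trans h'))⟩
    · exact hC a ha.1 b ⟨ha.2.trans hb.symm, h⟩
  have h3 : ∀ v, (In v).card ≤ (Ou v).card := by
    intro v
    rcases Nat.lt_or_ge 1 (In v).card with h | h
    · exact (hIn' v).trans (h2 v h)
    · rcases (In v).eq_empty_or_nonempty with h0 | ⟨a, ha⟩
      · simp [h0]
      · have := h1 v a ha
        have := hv v
        omega
  have h4 : ∑ v, (In v).card = ∑ v, (Ou v).card := by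
    rw [← Finset.card_eq_sum_card_fiberwise (fun _ _ => Finset.mem_univ _),
      ← Finset.card_eq_sum_card_fiberwise (fun _ _ => Finset.mem_univ _)]
  have h5 : ∀ v, (In v).card = (Ou v).card := fun v =>
    (Finset.sum_eq_sum_iff_of_le fun v _ => h3 v).1 h4 v (Finset.mem_univ v)
  -- With valence at least three, one arrival forces two departures, hence by equality two arrivals,
  -- hence all departures.
  have h6 : ∀ v, ∀ a ∈ In v, ∀ b, Γ.init b = v → b ∈ C := by
    intro v a ha b hb
    have hlt : 1 < (In v).card := by
      have := h1 v a ha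
      have := hv v
      have := h5 v
      omega
    have h7 : Ou v = Finset.univ.filter fun d => Γ.init d = v :=
      Finset.eq_of_subset_of_card_le
        (Finset.filter_subset_filter _ (Finset.subset_univ _))
        (by rw [← valence_eq]; exact h2 v hlt)
    have : b ∈ Ou v := by rw [h7]; simpa using hb
    exact (Finset.mem_filter.1 this).1
  have h7 : ∀ L u v, Γ.IsWalk u v L → (∃ a, a ∈ In u) → ∃ a, a ∈ In v := by
    intro L
    induction L with
    | nil => rintro u v h ha; obtain rfl : u = v := h; exact ha
    | cons d L ih =>
      rintro u v ⟨h, h'⟩ ⟨a, ha⟩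
      exact ih _ _ h' ⟨d, Finset.mem_filter.2 ⟨h6 u a ha d h, rfl⟩⟩
  obtain ⟨d, hd⟩ := hne
  rw [Finset.eq_univ_iff_forall]
  intro b
  obtain ⟨L, hL⟩ := hc (Γ.term d) (Γ.init b)
  obtain ⟨a, ha⟩ := h7 L _ _ hL ⟨d, Finset.mem_filter.2 ⟨hd, rfl⟩⟩
  exact h6 _ a ha b rfl

/-- Any two oriented edges are joined by a path without backtracking. -/
lemma exists_isChain (hc : Γ.Connected) (hv : ∀ v, 2 < Γ.valence v) (d d' : Γ.E × Bool) :
    ∃ L, (d :: L).IsChain Γ.Turn ∧ (d :: L).getLast? = some d' := by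
  classical
  have h : Relation.ReflTransGen Γ.Turn d d' := by
    have := eq_univ_of_closed hc hv
      (Finset.univ.filter fun d' => Relation.ReflTransGen Γ.Turn d d')
      (fun a ha b hb => by
        simp only [Finset.mem_filter, Finset.mem_univ, true_and] at ha ⊢
        exact ha.tail hb)
      ⟨d, by simpa using Relation.ReflTransGen.refl⟩
    have h1 : d' ∈ (Finset.univ.filter fun d' => Relation.ReflTransGen Γ.Turn d d') := by
      rw [this]; exact Finset.mem_univ _
    simpa using h1
  obtain ⟨L, h1, h2⟩ := List.exists_isChain_cons_of_relationReflTransGen h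
  refine ⟨L, h1, ?_⟩
  rw [List.getLast?_eq_getLast_of_ne_nil (by simp), h2]

lemma exists_turn (hv : ∀ v, 2 < Γ.valence v) (d : Γ.E × Bool) : ∃ b, Γ.Turn d b := by
  have h := hv (Γ.term d)
  rw [valence_eq] at h
  obtain ⟨b, hb, hne⟩ := Finset.exists_mem_ne (lt_trans one_lt_two h) (bar d)
  exact ⟨b, (Finset.mem_filter.1 hb).2.symm, hne⟩

/-- A path without backtracking can be closed up to a loop. -/
lemma exists_closing (hc : Γ.Connected) (hv : ∀ v, 2 < Γ.valence v) (a z : Γ.E × Bool) :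
    ∃ K, ∀ L : List (Γ.E × Bool), L.IsChain Γ.Turn → L.head? = some a → L.getLast? = some z →
      Γ.IsLoop (L ++ K) := by
  obtain ⟨b, hb⟩ := exists_turn hv z
  obtain ⟨c', hc'⟩ := exists_turn hv (bar a)
  have hca : Γ.Turn (bar c') a := by simpa using hc'.bar
  obtain ⟨K, hK, hKl⟩ := exists_isChain hc hv b (bar c')
  refine ⟨b :: K, fun L hL hLh hLl => isLoop_iff.2 ⟨by simp, ?_, ?_⟩⟩
  · refine List.isChain_append.2 ⟨hL, hK, ?_⟩
    intro x hx y hy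
    rw [hLl] at hx
    obtain rfl : z = x := by simpa using hx
    obtain rfl : b = y := by simpa using hy
    exact hb
  · intro x hx y hy
    rw [List.getLast?_append, hKl] at hx
    rw [List.head?_append, hLh] at hy
    obtain rfl : bar c' = x := by simpa using hx
    obtain rfl : a = y := by simpa using hy
    exact hca

lemma exists_isLoop_mem (hc : Γ.Connected) (hv : ∀ v, 2 < Γ.valence v) (d : Γ.E × Bool) :
    ∃ L, Γ.IsLoop L ∧ d ∈ L := by
  obtain ⟨K, hK⟩ := exists_closing hc hv d d
  exact ⟨_, hK [d] (by simp) rfl rfl, by simp⟩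

/-- For a metric on a graph, there is a lower bound for the lengths of loops. -/
lemma IsMetric.exists_le_lsum {ℓ : Γ.E → ℝ} (h : Γ.IsMetric ℓ) :
    ∃ δ > 0, ∀ L, Γ.IsLoop L → δ ≤ lsum ℓ L := by
  have hne : Nonempty Γ.E := by
    by_contra h0
    rw [not_nonempty_iff] at h0
    have := h.sum_eq_one
    simp at this
  -- Edges of length zero receive the dummy value 1, which keeps the minimum positive. Since these
  -- edges form a forest, every loop contains an edge of positive length.
  obtain ⟨a, ha⟩ := Finite.exists_min fun e => if ℓ e = 0 then 1 else ℓ e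
  refine ⟨if ℓ a = 0 then 1 else ℓ a, ?_, fun L hL => ?_⟩
  · split_ifs with h0
    · exact one_pos
    · exact lt_of_le_of_ne (h.nonneg a) (Ne.symm h0)
  · obtain ⟨d, hd, hd0⟩ : ∃ d ∈ L, ℓ d.1 ≠ 0 := by
      by_contra! hcon
      obtain ⟨u, hu⟩ := hL.exists_isWalk
      have hr := hL.isCyclicallyReduced.isReduced
      have h1 := h.forest u _ (mk_mem_pathClass hu) fun d hd => by
        rw [FreeGroup.toWord_mk, hr.reduce_eq] at hd
        exact hcon d hd
      have h2 := congrArg FreeGroup.toWord h1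
      rw [FreeGroup.toWord_mk, hr.reduce_eq, FreeGroup.toWord_one] at h2
      exact hL.1 h2
    have h1 := ha d.1
    simp only [if_neg hd0] at h1
    exact h1.trans (le_lsum_of_mem h.nonneg hd)

end FinGraph

/-! ### Linear combinations of weights -/

lemma lsum_sum {E ι : Type} (s : Finset ι) (c : ι → ℝ) (ℓ : ι → E → ℝ) (L : List (E × Bool)) :
    lsum (fun e => ∑ i ∈ s, c i * ℓ i e) L = ∑ i ∈ s, c i * lsum (ℓ i) L := by
  induction L with
  | nil => simp
  | cons d L ih => simp only [lsum_cons, ih, mul_add, Finset.sum_add_distrib]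

/-- The weight that counts the occurrences of one letter. -/
def single {A : Type} [DecidableEq A] (a : A) : A → ℝ := fun b => if b = a then 1 else 0

lemma single_nonneg {A : Type} [DecidableEq A] (a b : A) : 0 ≤ single a b := by
  unfold single; split_ifs <;> norm_num

lemma lsum_single {A : Type} [DecidableEq A] (a : A) (L : List (A × Bool)) :
    lsum (single a) L = L.countP fun d => d.1 = a := by
  induction L with
  | nil => simp
  | cons d L ih =>
    rw [lsum_cons, ih, List.countP_cons, single]
    push_cast
    simp only [decide_eq_true_eq]
    ring

/-! ### Subdivisions of the unit interval -/

lemma exists_subdivision (s : Finset ℝ) (h0 : 0 ∈ s) (h1 : 1 ∈ s) (hs : ∀ x ∈ s, 0 ≤ x ∧ x ≤ 1) :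
    ∃ (k : ℕ) (t : ℕ → ℝ), Monotone t ∧ t 0 = 0 ∧ t k = 1 ∧ ∀ x ∈ s, ∃ j ≤ k, t j = x := by
  have hpos : 0 < s.card := Finset.card_pos.2 ⟨0, h0⟩
  set o := s.orderEmbOfFin rfl with ho
  set m : ℕ → Fin s.card := fun j => ⟨min j (s.card - 1), by omega⟩ with hm
  have hsur : ∀ x ∈ s, ∃ j ≤ s.card - 1, o (m j) = x := by
    intro x hx
    have : x ∈ Set.range o := by rw [ho, Finset.range_orderEmbOfFin]; exact hx
    obtain ⟨i, hi⟩ := this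
    refine ⟨i, by omega, ?_⟩
    rw [← hi]; congr 1; ext; simp only [hm]; omega
  have hmem : ∀ j, o (m j) ∈ s := fun j => Finset.orderEmbOfFin_mem _ _ _
  have hmono : Monotone fun j => o (m j) := fun i j hij =>
    o.monotone (by simp only [hm, Fin.mk_le_mk]; omega)
  refine ⟨s.card - 1, fun j => o (m j), hmono, ?_, ?_, hsur⟩
  · obtain ⟨j, -, hj⟩ := hsur 0 h0
    exact le_antisymm (by rw [← hj]; exact hmono (Nat.zero_le j)) (hs _ (hmem _)).1
  · obtain ⟨j, hjk, hj⟩ := hsur 1 h1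
    exact le_antisymm (hs _ (hmem _)).2 (by rw [← hj]; exact hmono hjk)


open FinGraph

/-! ### Subdividing edges -/

section Subdivision

variable {E : Type} [DecidableEq E]

/-- The initial segment of an edge, in the subdivided graph. -/
def seg (e : E) : ℕ → FreeGroup (E × ℕ)
  | 0 => 1
  | j + 1 => seg e j * FreeGroup.of (e, j)

/-- Subdivide each edge into `k` edges. -/
def subdiv (k : ℕ) : FreeGroup E →* FreeGroup (E × ℕ) := FreeGroup.lift fun e => seg e k

/-- The length of the pieces of the edges. -/
def subWt (ℓ : E → ℝ) (t : ℕ → ℝ) (a : E × ℕ) : ℝ := (t (a.2 + 1) - t a.2) * ℓ a.1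

/-- Forget all pieces of an edge, except the one with number `j`. -/
def proj (j : ℕ) : FreeGroup (E × ℕ) →* FreeGroup E :=
  FreeGroup.lift fun a => if a.2 = j then FreeGroup.of a.1 else 1

variable {ℓ : E → ℝ} {t : ℕ → ℝ}

lemma subWt_nonneg (hℓ : ∀ e, 0 ≤ ℓ e) (ht : Monotone t) (a : E × ℕ) : 0 ≤ subWt ℓ t a :=
  mul_nonneg (sub_nonneg.2 (ht (Nat.le_succ _))) (hℓ _)

lemma wlen_seg_le (hℓ : ∀ e, 0 ≤ ℓ e) (ht : Monotone t) (e : E) {i j : ℕ} (hij : i ≤ j) :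
    wlen (subWt ℓ t) ((seg e i)⁻¹ * seg e j) ≤ (t j - t i) * ℓ e := by
  induction j, hij using Nat.le_induction with
  | base => simp
  | succ j _ ih =>
    rw [seg, ← mul_assoc]
    refine (wlen_mul_le (subWt_nonneg hℓ ht) _ _).trans ?_
    rw [wlen_of, subWt]
    linarith

lemma wlen_seg_le_abs (hℓ : ∀ e, 0 ≤ ℓ e) (ht : Monotone t) (e : E) (i j : ℕ) :
    wlen (subWt ℓ t) ((seg e i)⁻¹ * seg e j) ≤ |t i * ℓ e - t j * ℓ e| := by
  rcases le_total i j with h | h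
  · refine (wlen_seg_le hℓ ht e h).trans ?_
    rw [sub_mul, abs_sub_comm]; exact le_abs_self _
  · have h1 := wlen_seg_le hℓ ht e h
    rw [← wlen_inv, mul_inv_rev, inv_inv] at h1
    refine h1.trans ?_
    rw [sub_mul]; exact le_abs_self _

lemma proj_seg (j : ℕ) (e : E) (i : ℕ) :
    proj j (seg e i) = if j < i then FreeGroup.of e else 1 := by
  induction i with
  | zero => simp [seg]
  | succ i ih =>
    rw [seg, map_mul, ih, proj, FreeGroup.lift_apply_of]
    rcases lt_trichotomy i j with h | h | h
    · rw [if_neg (by omega), if_neg (by simp; omega), if_neg (by omega), mul_one]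
    · rw [if_neg (by omega), if_pos (by simpa using h), if_pos (by omega), one_mul]
    · rw [if_pos (by omega), if_neg (by simp; omega), if_pos (by omega), mul_one]

lemma proj_subdiv {j k : ℕ} (h : j < k) (W : FreeGroup E) : proj j (subdiv k W) = W := by
  have : (proj j).comp (subdiv k) = MonoidHom.id (FreeGroup E) := by
    refine FreeGroup.ext_hom _ _ fun e => ?_
    rw [MonoidHom.comp_apply, subdiv, FreeGroup.lift_apply_of, proj_seg, if_pos h]; rfl
  exact DFunLike.congr_fun this W

/-- Remembering only the pieces with number `j` recovers `W`, and does not increase lengths when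
only these pieces carry weight. -/
lemma tl_le_tl_subdiv (hℓ : ∀ e, 0 ≤ ℓ e) {j k : ℕ} (h : j < k) (W : FreeGroup E) :
    tl ℓ W ≤ tl (fun a : E × ℕ => if a.2 = j then ℓ a.1 else 0) (subdiv k W) := by
  have := tl_hom_le hℓ (proj j) (ℓ := fun a : E × ℕ => if a.2 = j then ℓ a.1 else 0)
    (fun a => by
      rw [proj, FreeGroup.lift_apply_of]
      split_ifs <;> simp) (subdiv k W)
  rwa [proj_subdiv h] at this

lemma tl_subdiv (hℓ : ∀ e, 0 ≤ ℓ e) (ht : Monotone t) (h0 : t 0 = 0) {k : ℕ} (h1 : t k = 1)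
    (W : FreeGroup E) : tl (subWt ℓ t) (subdiv k W) = tl ℓ W := by
  refine le_antisymm ?_ ?_
  · refine tl_hom_le (subWt_nonneg hℓ ht) _ (fun e => ?_) W
    have := wlen_seg_le hℓ ht e (Nat.zero_le k)
    rw [h0, h1] at this
    rw [subdiv, FreeGroup.lift_apply_of]
    simpa [seg] using this
  -- Average the bounds from the `k` projections, each weighted by the proportion of the edge that
  -- its piece takes up.
  · calc tl ℓ W = ∑ j ∈ Finset.range k, (t (j + 1) - t j) * tl ℓ W := by
          rw [← Finset.sum_mul, Finset.sum_range_sub, h0, h1]; ring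
      _ ≤ ∑ j ∈ Finset.range k, (t (j + 1) - t j) *
            tl (fun a : E × ℕ => if a.2 = j then ℓ a.1 else 0) (subdiv k W) :=
          Finset.sum_le_sum fun j hj => mul_le_mul_of_nonneg_left
            (tl_le_tl_subdiv hℓ (Finset.mem_range.1 hj) W) (sub_nonneg.2 (ht (Nat.le_succ j)))
      _ = tl (fun a : E × ℕ => ∑ j ∈ Finset.range k, (t (j + 1) - t j) *
            (if a.2 = j then ℓ a.1 else 0)) (subdiv k W) :=
          (lsum_sum _ (fun j => t (j + 1) - t j)
            (fun j (a : E × ℕ) => if a.2 = j then ℓ a.1 else 0) _).symm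
      _ ≤ _ := tl_mono (fun a => by
          simp only [mul_ite, mul_zero, Finset.sum_ite_eq, Finset.mem_range]
          split_ifs
          · exact le_rfl
          · exact subWt_nonneg hℓ ht a) _

end Subdivision

/-! ### Volumes of labelled graphs -/

lemma single_le_wlen {A : Type} [DecidableEq A] (a : A) (w : FreeGroup A) :
    wlen (single a) w = 0 ∨ 1 ≤ wlen (single a) w := by
  rw [wlen, lsum_single]
  rcases Nat.eq_zero_or_pos (w.toWord.countP fun d => d.1 = a) with h | h
  · left; exact_mod_cast h
  · right; exact_mod_cast h

/-- If the letter `a` survives in some `F g`, it must occur in a label, and occurrences are counted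
by natural numbers. -/
lemma Labelled.one_le_vol_single {n : ℕ} {A : Type} [DecidableEq A]
    {F : FreeGroup (Fin n) →* FreeGroup A} (Z : Labelled F) {a : A} {g : FreeGroup (Fin n)}
    (h : 0 < tl (single a) (F g)) : 1 ≤ Z.vol (single a) := by
  obtain ⟨e, he⟩ : ∃ e, Z.len (single a) e ≠ 0 := by
    by_contra! hcon
    have h1 := h.trans_le (Z.tl_F_le (single_nonneg a) g)
    rw [tl, lsum_eq_zero fun d _ => hcon d.1] at h1
    exact lt_irrefl _ h1
  have h1 : 1 ≤ Z.len (single a) e :=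
    (single_le_wlen a _).resolve_left he
  exact h1.trans (Finset.single_le_sum (fun e _ => Z.len_nonneg (single_nonneg a) e)
    (Finset.mem_univ e))

lemma Labelled.vol_sum {n : ℕ} {A : Type} [DecidableEq A] {ι : Type}
    {F : FreeGroup (Fin n) →* FreeGroup A} (Z : Labelled F) (s : Finset ι) (c : ι → ℝ)
    (ℓ : ι → A → ℝ) :
    Z.vol (fun a => ∑ i ∈ s, c i * ℓ i a) = ∑ i ∈ s, c i * Z.vol (ℓ i) := by
  simp only [vol, len, Finset.mul_sum]
  rw [Finset.sum_comm]
  exact Finset.sum_congr rfl fun e _ => lsum_sum s c ℓ _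

/-! ### Differences of markings as labelled graphs -/

/-- The translation lengths of a point of Outer space. -/
def MarkedMetricGraph.tr {n : ℕ} (x : MarkedMetricGraph n) (g : FreeGroup (Fin n)) : ℝ :=
  tl x.ℓ (x.f g)

namespace DifferenceOfMarkings

variable {n : ℕ} {x y : MarkedMetricGraph n} (φ : DifferenceOfMarkings x y)

/-- Every edge of `y` lies on a loop because all valences exceed two. So each piece of it occurs in
the labels of `Z`, and the pieces have total length 1. -/
lemma one_le_vol {k : ℕ} {t : ℕ → ℝ} (ht : Monotone t) (h0 : t 0 = 0) (h1 : t k = 1)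
    {F : FreeGroup (Fin n) →* FreeGroup (y.Γ.E × ℕ)}
    (hF : ∀ ℓ : y.Γ.E × ℕ → ℝ, (∀ a, 0 ≤ ℓ a) → ∀ g, tl ℓ (F g) = tl ℓ (subdiv k (y.f g)))
    (Z : Labelled F) : 1 ≤ Z.vol (subWt y.ℓ t) := by
  have key : ∀ a : y.Γ.E × ℕ, a.2 < k → 1 ≤ Z.vol (single a) := by
    rintro ⟨e, j⟩ hj
    obtain ⟨L, hL, heL⟩ := exists_isLoop_mem y.connected y.two_lt_valence (e, true)
    obtain ⟨g, -, -, hg⟩ := y.toMarkedGraph.toPreMarked.exists_of_isLoop hL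
    refine Z.one_le_vol_single (g := g) ?_
    rw [hF _ (single_nonneg _)]
    have h2 := tl_le_tl_subdiv (single_nonneg e) hj (y.f g)
    have h3 : tl (single e) (y.f g) = lsum (single e) L := hg _ (single_nonneg e)
    have h4 := le_lsum_of_mem (single_nonneg e) heL
    have h5 : (fun a : y.Γ.E × ℕ => if a.2 = j then single e a.1 else 0) = single (e, j) := by
      funext a
      obtain ⟨e', j'⟩ := a
      by_cases hj : j' = j <;> by_cases he : e' = e <;> simp [single, hj, he]
    rw [h5, h3] at h2
    have h6 : single e ((e, true) : y.Γ.E × Bool).1 = 1 := by simp [single]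
    rw [h6] at h4
    linarith
  have hw := subWt_nonneg y.isMetric.nonneg ht
  calc (1 : ℝ) = ∑ e, ∑ j ∈ Finset.range k, subWt y.ℓ t (e, j) := by
        simp only [subWt]
        rw [← y.isMetric.sum_eq_one]
        refine Finset.sum_congr rfl fun e _ => ?_
        rw [← Finset.sum_mul, Finset.sum_range_sub, h0, h1]; ring
    _ = ∑ a ∈ Finset.univ ×ˢ Finset.range k, subWt y.ℓ t a := (Finset.sum_product _ _ _).symm
    _ ≤ ∑ a ∈ Finset.univ ×ˢ Finset.range k, subWt y.ℓ t a * Z.vol (single a) := by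
        refine Finset.sum_le_sum fun a ha => le_mul_of_one_le_right (hw a) (key a ?_)
        simpa using ha
    _ = Z.vol (fun b => ∑ a ∈ Finset.univ ×ˢ Finset.range k, subWt y.ℓ t a * single a b) :=
        (Z.vol_sum _ _ _).symm
    _ ≤ _ := by
        refine Finset.sum_le_sum fun e _ => wlen_mono (fun b => ?_) _
        simp only [single, mul_ite, mul_one, mul_zero, Finset.sum_ite_eq]
        split_ifs
        · exact le_rfl
        · exact hw b

/-- After subdividing the graph of `y` at the images of vertices, the image of an edge is an edge
path, whose word is the label. This turns a difference of markings into a labelled graph to be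
folded; the last clause says that folding can never reduce the volume below 1. -/
theorem exists_lab : ∃ (A : Type) (_ : DecidableEq A) (wt : A → ℝ)
    (lab : FreeGroup x.Γ.E →* FreeGroup A), (∀ a, 0 ≤ wt a) ∧
      (∀ g, tl wt (lab (x.f g)) = y.tr g) ∧
      (∀ e, wlen wt (lab (FreeGroup.of e)) ≤ φ.imageLength e) ∧
      ∀ Z : Labelled (lab.comp x.f), 1 ≤ Z.vol wt := by
  obtain ⟨k, t, ht, h0, h1, hpos⟩ := exists_subdivision
    (insert 0 (insert 1 (Finset.univ.image fun u => ((φ.onV u).pos : ℝ))))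
    (by simp) (by simp) (by
      intro a ha
      simp only [Finset.mem_insert, Finset.mem_image, Finset.mem_univ, true_and] at ha
      rcases ha with rfl | rfl | ⟨u, rfl⟩
      · simp
      · simp
      · exact ⟨(φ.onV u).pos.2.1, (φ.onV u).pos.2.2⟩)
  have hpos' : ∀ u, ∃ j ≤ k, t j = (φ.onV u).pos := fun u => hpos _ (by simp)
  choose j hjk hj using hpos'
  have hℓ := y.isMetric.nonneg
  have hw := subWt_nonneg hℓ ht
  set P : x.Γ.V → FreeGroup (y.Γ.E × ℕ) := fun u => seg (φ.onV u).edge (j u) with hP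
  set lab : FreeGroup x.Γ.E →* FreeGroup (y.Γ.E × ℕ) := FreeGroup.lift fun e =>
    (P (x.Γ.src e))⁻¹ * subdiv k (φ.onE e) * P (x.Γ.tgt e) with hlab
  have hF : ∀ ℓ : y.Γ.E × ℕ → ℝ, (∀ a, 0 ≤ ℓ a) → ∀ g,
      tl ℓ (lab.comp x.f g) = tl ℓ (subdiv k (y.f g)) := by
    intro ℓ hℓ g
    obtain ⟨p, -, hp⟩ := φ.homotopic
    have h2 : lab (x.f g) = (P x.base)⁻¹ * subdiv k (FreeGroup.lift φ.onE (x.f g)) * P x.base :=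
      hom_gauge lab ((subdiv k).comp (FreeGroup.lift φ.onE)) P (fun e => by simp [hlab])
        (x.toMarkedGraph.toPreMarked.f_mem g)
    rw [MonoidHom.comp_apply, h2, tl_conj_inv hℓ, hp, map_mul, map_mul, map_inv, tl_conj_inv hℓ]
  refine ⟨y.Γ.E × ℕ, inferInstance, subWt y.ℓ t, lab, hw, fun g => ?_, fun e => ?_,
    fun Z => one_le_vol ht h0 h1 hF Z⟩
  · have := hF _ hw g
    rwa [tl_subdiv hℓ ht h0 h1] at this
  · have hl : lab (FreeGroup.of e) =
        (P (x.Γ.src e))⁻¹ * subdiv k (φ.onE e) * P (x.Γ.tgt e) := by simp [hlab]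
    rw [hl, imageLength, Point.tightLength]
    generalize φ.onE e = w
    have hs : ∀ w, wlen (subWt y.ℓ t) (subdiv k w) ≤ pathLength y.ℓ w := fun w => by
      refine wlen_hom_le hw _ (fun e => ?_) w
      have := wlen_seg_le hℓ ht e (Nat.zero_le k)
      rw [h0, h1] at this
      rw [subdiv, FreeGroup.lift_apply_of]
      simpa [seg] using this
    have hA : ∀ u, wlen (subWt y.ℓ t) (P u) ≤ (φ.onV u).pos * y.ℓ (φ.onV u).edge := by
      intro u
      have := wlen_seg_le hℓ ht (φ.onV u).edge (Nat.zero_le (j u))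
      rw [h0, hj] at this
      simpa [seg] using this
    have hB : ∀ u, wlen (subWt y.ℓ t) ((P u)⁻¹ * subdiv k (FreeGroup.of (φ.onV u).edge)) ≤
        (1 - (φ.onV u).pos) * y.ℓ (φ.onV u).edge := by
      intro u
      have := wlen_seg_le hℓ ht (φ.onV u).edge (hjk u)
      rw [h1, hj] at this
      rwa [subdiv, FreeGroup.lift_apply_of]
    have h3 : ∀ a b c : FreeGroup (y.Γ.E × ℕ), wlen (subWt y.ℓ t) (a * b * c) ≤
        wlen (subWt y.ℓ t) a + wlen (subWt y.ℓ t) b + wlen (subWt y.ℓ t) c := fun a b c => by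
      have := wlen_mul_le hw (a * b) c
      have := wlen_mul_le hw a b
      linarith
    split_ifs with h
    · obtain ⟨he, rfl⟩ := h
      rw [map_one, mul_one, hP]
      dsimp only
      rw [← he, ← hj, ← hj]
      exact wlen_seg_le_abs hℓ ht _ _ _
    -- One estimate for each choice of the ends through which the tight path leaves the first edge
    -- and enters the last one.
    · refine le_min (le_min ?_ ?_) (le_min ?_ ?_)
      · refine (h3 _ _ _).trans ?_
        rw [wlen_inv]
        exact add_le_add (add_le_add (hA _) (hs w)) (hA _)
      · have e1 : (P (x.Γ.src e))⁻¹ * subdiv k w * P (x.Γ.tgt e) =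
          ((P (x.Γ.src e))⁻¹ * subdiv k (FreeGroup.of (φ.onV (x.Γ.src e)).edge)) *
            subdiv k ((FreeGroup.of (φ.onV (x.Γ.src e)).edge)⁻¹ * w) * P (x.Γ.tgt e) := by
          rw [map_mul, map_inv]; group
        rw [e1]
        exact (h3 _ _ _).trans (add_le_add (add_le_add (hB _) (hs _)) (hA _))
      · have e1 : (P (x.Γ.src e))⁻¹ * subdiv k w * P (x.Γ.tgt e) =
          (P (x.Γ.src e))⁻¹ * subdiv k (w * FreeGroup.of (φ.onV (x.Γ.tgt e)).edge) *
            ((P (x.Γ.tgt e))⁻¹ * subdiv k (FreeGroup.of (φ.onV (x.Γ.tgt e)).edge))⁻¹ := by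
          rw [map_mul]; group
        rw [e1]
        refine (h3 _ _ _).trans ?_
        rw [wlen_inv, wlen_inv]
        exact add_le_add (add_le_add (hA _) (hs _)) (hB _)
      · have e1 : (P (x.Γ.src e))⁻¹ * subdiv k w * P (x.Γ.tgt e) =
          ((P (x.Γ.src e))⁻¹ * subdiv k (FreeGroup.of (φ.onV (x.Γ.src e)).edge)) *
            subdiv k ((FreeGroup.of (φ.onV (x.Γ.src e)).edge)⁻¹ * w *
              FreeGroup.of (φ.onV (x.Γ.tgt e)).edge) *
            ((P (x.Γ.tgt e))⁻¹ * subdiv k (FreeGroup.of (φ.onV (x.Γ.tgt e)).edge))⁻¹ := by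
          rw [map_mul, map_mul, map_inv]; group
        rw [e1]
        refine (h3 _ _ _).trans ?_
        rw [wlen_inv _ ((P (x.Γ.tgt e))⁻¹ * _)]
        exact add_le_add (add_le_add (hB _) (hs _)) (hB _)

end DifferenceOfMarkings


open FinGraph

/-! ### Comparison of translation lengths along a difference of markings -/

namespace MarkedMetricGraph

variable {n : ℕ} (x : MarkedMetricGraph n)

lemma tr_nonneg (g : FreeGroup (Fin n)) : 0 ≤ x.tr g := tl_nonneg x.isMetric.nonneg _

lemma exists_le_tr : ∃ δ > 0, ∀ g, g ≠ 1 → δ ≤ x.tr g := by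
  obtain ⟨δ, hδ, h⟩ := x.isMetric.exists_le_lsum
  refine ⟨δ, hδ, fun g hg => ?_⟩
  obtain ⟨L, hL, hl⟩ := x.toMarkedGraph.toPreMarked.exists_tl_eq hg
  exact (h L hL).trans_eq (hl x.ℓ x.isMetric.nonneg).symm

lemma prodLen_tr_pos : 0 < prodLen x.tr := by
  obtain ⟨δ, hδ, h⟩ := x.exists_le_tr
  exact prodLen_pos hδ h

end MarkedMetricGraph

/-- A loop crosses an edge only a bounded number of times. -/
lemma PreMarked.lsum_single_le {n : ℕ} (M : PreMarked n) {ℓ : M.Γ.E → ℝ} (hℓ : ∀ e, 0 ≤ ℓ e)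
    {ε : ℝ} (hε : 0 < ε) (h : ∀ g, g ≠ 1 → ε ≤ tl ℓ (M.f g)) {L : List (M.Γ.E × Bool)}
    (hL : M.Γ.IsLoop L) (e : M.Γ.E) : lsum (single e) L ≤ 2 / ε * lsum ℓ L := by
  have h2 := M.count_init_mul_le hℓ h (M.Γ.src e) hL
  have h3 := M.count_init_mul_le hℓ h (M.Γ.tgt e) hL
  -- Each crossing of `e` starts at one of its two ends, and visits to a vertex are already bounded.
  have h4 : L.countP (fun d => d.1 = e) ≤ L.countP (fun d => M.Γ.init d = M.Γ.src e) +
      L.countP (fun d => M.Γ.init d = M.Γ.tgt e) := by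
    clear hL h2 h3
    induction L with
    | nil => simp
    | cons d L ih =>
      simp only [List.countP_cons, decide_eq_true_eq]
      have : (if d.1 = e then 1 else 0) ≤ (if M.Γ.init d = M.Γ.src e then 1 else 0) +
          if M.Γ.init d = M.Γ.tgt e then 1 else 0 := by
        by_cases hd : d.1 = e
        · obtain ⟨a, b⟩ := d
          obtain rfl : a = e := hd
          cases b <;> simp [FinGraph.init]
        · simp [hd]
      omega
  have h5 : (L.countP (fun d => d.1 = e) : ℝ) ≤ L.countP (fun d => M.Γ.init d = M.Γ.src e) +
      L.countP (fun d => M.Γ.init d = M.Γ.tgt e) := by exact_mod_cast h4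
  rw [lsum_single, div_mul_eq_mul_div, le_div_iff₀ hε]
  have := mul_le_mul_of_nonneg_right h5 hε.le
  linarith

/-- If two metrics on a graph differ little, then so do the lengths of loops. -/
lemma PreMarked.tl_mul_le_tl {n : ℕ} (M : PreMarked n) {ℓ ℓ' : M.Γ.E → ℝ} (hℓ : ∀ e, 0 ≤ ℓ e)
    (hℓ' : ∀ e, 0 ≤ ℓ' e) {ε : ℝ} (hε : 0 < ε) (h : ∀ g, g ≠ 1 → ε ≤ tl ℓ (M.f g)) {c : ℝ}
    (hle : ∀ e, ℓ' e ≤ c * ℓ e) (g : FreeGroup (Fin n)) :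
    tl ℓ (M.f g) * (c - 2 / ε * (∑ e, (c * ℓ e - ℓ' e))) ≤ tl ℓ' (M.f g) := by
  rcases eq_or_ne g 1 with rfl | hg
  · simp
  obtain ⟨L, hL, hl⟩ := M.exists_tl_eq hg
  rw [hl ℓ hℓ, hl ℓ' hℓ']
  have h1 : ∀ e, lsum (single e) L ≤ 2 / ε * lsum ℓ L := M.lsum_single_le hℓ hε h hL
  have h2 : lsum (fun e => c * ℓ e - ℓ' e) L ≤
      ∑ e, (c * ℓ e - ℓ' e) * (2 / ε * lsum ℓ L) := by
    have h3 : lsum (fun e => c * ℓ e - ℓ' e) L =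
        ∑ e, (c * ℓ e - ℓ' e) * lsum (single e) L := by
      rw [← lsum_sum]
      congr 1
      funext e
      simp [single]
    rw [h3]
    exact Finset.sum_le_sum fun e _ => mul_le_mul_of_nonneg_left (h1 e) (sub_nonneg.2 (hle e))
  rw [lsum_sub, lsum_smul, ← Finset.sum_mul] at h2
  linarith

namespace DifferenceOfMarkings

variable {n : ℕ} {x y : MarkedMetricGraph n} {φ : DifferenceOfMarkings x y} {c : ℝ}

lemma SlopeLE.tr_le (h : φ.SlopeLE c) (g : FreeGroup (Fin n)) : y.tr g ≤ c * x.tr g := by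
  obtain ⟨A, _, wt, lab, hwt, hF, hl, -⟩ := φ.exists_lab
  rw [← hF]
  exact tl_hom_le_mul hwt lab (fun e => (hl e).trans (h e)) _

/-- The metric pulled back along `φ` has volume at least 1, and at most `c` times the volume 1 of
`x`. -/
lemma SlopeLE.one_le (h : φ.SlopeLE c) : 1 ≤ c := by
  obtain ⟨A, _, wt, lab, hwt, hF, hl, hV⟩ := φ.exists_lab
  have h1 := hV ⟨x.toMarkedGraph.toPreMarked, lab, fun _ => rfl⟩
  refine h1.trans ?_
  calc _ ≤ ∑ e, c * x.ℓ e := Finset.sum_le_sum fun e _ => (hl e).trans (h e)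
    _ = c := by rw [← Finset.mul_sum, x.isMetric.sum_eq_one, mul_one]

/-- The stretch of a conjugacy class in the reverse direction is controlled by the slope. -/
theorem SlopeLE.tr_mul_prodLen_le (h : φ.SlopeLE c) (g : FreeGroup (Fin n)) :
    x.tr g * prodLen y.tr ≤
      c ^ (Fintype.card (CoverIndex n) - 1) * (y.tr g * prodLen x.tr) := by
  have hc := h.one_le
  obtain ⟨A, _, wt, lab, hwt, hF, hl, hV⟩ := φ.exists_lab
  set Z : Labelled (lab.comp x.f) := ⟨x.toMarkedGraph.toPreMarked, lab, fun _ => rfl⟩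
  obtain ⟨ε, hε, hy⟩ := y.exists_le_tr
  have hF' : ∀ g, tl wt (lab.comp x.f g) = y.tr g := hF
  have hZ := Z.tl_mul_prodLen_le hwt hε (fun g hg => (hy g hg).trans_eq (hF g).symm) g
  have hpos : ∀ g, g ≠ 1 → ε ≤ tl (Z.len wt) (Z.f g) := fun g hg =>
    (hy g hg).trans ((hF g).symm.le.trans (Z.tl_F_le hwt g))
  have hle : ∀ e, Z.len wt e ≤ c * x.ℓ e := fun e => (hl e).trans (h e)
  -- The change of metric on the graph of `x` is the only place where the slope enters. The folds,
  -- treated in `hZ`, cost nothing.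
  have hX := Z.toPreMarked.tl_mul_prodLen_le (ℓ := x.ℓ) (ℓ' := Z.len wt) x.isMetric.nonneg
    (Z.len_nonneg hwt) (fun g hg => hε.trans_le (hpos g hg)) hc
    (fun g => (tl_mono hle _).trans_eq (lsum_smul c x.ℓ _)) g
  simp only [hF'] at hZ
  have hX' : x.tr g * prodLen (fun g => tl (Z.len wt) (Z.f g)) ≤
      c ^ (Fintype.card (CoverIndex n) - 1) * (tl (Z.len wt) (Z.f g) * prodLen x.tr) := hX
  have h3 := prodLen_pos hε hpos
  have h4 := y.prodLen_tr_pos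
  have h5 := x.prodLen_tr_pos
  refine le_of_mul_le_mul_right ?_ h3
  have h6 := mul_le_mul_of_nonneg_right hX' h4.le
  have h7 := mul_le_mul_of_nonneg_left hZ
    (mul_nonneg (pow_nonneg (zero_le_one.trans hc) (Fintype.card (CoverIndex n) - 1)) h5.le)
  calc _ = x.tr g * prodLen (fun g => tl (Z.len wt) (Z.f g)) * prodLen y.tr := by ring
    _ ≤ _ := h6
    _ = c ^ (Fintype.card (CoverIndex n) - 1) * prodLen x.tr *
        (tl (Z.len wt) (Z.f g) * prodLen y.tr) := by ring
    _ ≤ _ := h7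
    _ = _ := by ring

/-- In the thick part, a difference of markings of slope near `1` changes lengths little. -/
theorem SlopeLE.tr_mul_le (h : φ.SlopeLE c) {ε : ℝ} (hε : 0 < ε)
    (hx : ∀ g, g ≠ 1 → ε ≤ x.tr g) (hy : ∀ g, g ≠ 1 → ε ≤ y.tr g)
    (hcε : 2 / ε * (c - 1) ≤ 1) (g : FreeGroup (Fin n)) :
    x.tr g * (1 - 2 / ε * (c - 1)) ^ 2 ≤ y.tr g := by
  have hc := h.one_le
  obtain ⟨A, _, wt, lab, hwt, hF, hl, hV⟩ := φ.exists_lab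
  set Z : Labelled (lab.comp x.f) := ⟨x.toMarkedGraph.toPreMarked, lab, fun _ => rfl⟩
  have hle : ∀ e, Z.len wt e ≤ c * x.ℓ e := fun e => (hl e).trans (h e)
  have hZ := Z.tl_mul_le hwt hε (fun g hg => (hy g hg).trans_eq (hF g).symm) hV g
  have hX := Z.toPreMarked.tl_mul_le_tl (ℓ := x.ℓ) (ℓ' := Z.len wt) x.isMetric.nonneg
    (Z.len_nonneg hwt) hε hx hle g
  have hvol : ∑ e, c * x.ℓ e = c := by rw [← Finset.mul_sum, x.isMetric.sum_eq_one, mul_one]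
  have h1 : ∑ e, (c * x.ℓ e - Z.len wt e) ≤ c - 1 := by
    have h2 : ∑ e, (c * x.ℓ e - Z.len wt e) = ∑ e, c * x.ℓ e - Z.vol wt :=
      Finset.sum_sub_distrib _ _
    rw [h2, hvol]
    exact sub_le_sub_left (hV Z) _
  have h2 : Z.vol wt - 1 ≤ c - 1 :=
    sub_le_sub_right ((Finset.sum_le_sum fun e _ => hle e).trans_eq hvol) _
  have hε' : 0 ≤ 2 / ε := by positivity
  -- One factor for the change of metric, and in `h4` one for the folds. Each of the two loses
  -- volume at most `c - 1`.
  have h3 : x.tr g * (1 - 2 / ε * (c - 1)) ≤ tl (Z.len wt) (Z.f g) := le_trans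
    (mul_le_mul_of_nonneg_left (sub_le_sub hc (mul_le_mul_of_nonneg_left h1 hε'))
      (x.tr_nonneg g)) hX
  have h4 : tl (Z.len wt) (Z.f g) * (1 - 2 / ε * (c - 1)) ≤ y.tr g := by
    rw [← hF]
    exact le_trans (mul_le_mul_of_nonneg_left (sub_le_sub_left
      (mul_le_mul_of_nonneg_left h2 hε') 1) (tl_nonneg (Z.len_nonneg hwt) _)) hZ
  have h5 := mul_le_mul_of_nonneg_right h3 (sub_nonneg.2 hcε)
  calc _ = x.tr g * (1 - 2 / ε * (c - 1)) * (1 - 2 / ε * (c - 1)) := by ring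
    _ ≤ _ := h5.trans h4

end DifferenceOfMarkings


open FinGraph

/-! ### The geometry of the tree of a free group -/

section Tree

variable {E : Type} [DecidableEq E] {ℓ : E → ℝ}

/-- The distance of two vertices in the Cayley tree of a free group. -/
def treeDist (ℓ : E → ℝ) (z w : FreeGroup E) : ℝ := wlen ℓ (z⁻¹ * w)

lemma treeDist_comm (ℓ : E → ℝ) (z w : FreeGroup E) : treeDist ℓ z w = treeDist ℓ w z := by
  rw [treeDist, ← wlen_inv, mul_inv_rev, inv_inv, ← treeDist]

lemma treeDist_self (ℓ : E → ℝ) (z : FreeGroup E) : treeDist ℓ z z = 0 := by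
  rw [treeDist, inv_mul_cancel, wlen_one]

lemma treeDist_triangle (hℓ : ∀ e, 0 ≤ ℓ e) (z w u : FreeGroup E) :
    treeDist ℓ z u ≤ treeDist ℓ z w + treeDist ℓ w u := by
  have := wlen_mul_le hℓ (z⁻¹ * w) (w⁻¹ * u)
  rwa [mul_assoc, mul_inv_cancel_left] at this

lemma treeDist_mul_left (ℓ : E → ℝ) (h z w : FreeGroup E) :
    treeDist ℓ (h * z) (h * w) = treeDist ℓ z w := by
  rw [treeDist, treeDist]; congr 1; group

/-- The vertex `z` lies beyond the edge issuing from `A` with label `d`. -/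
def Beyond (A : FreeGroup E) (d : E × Bool) (z : FreeGroup E) : Prop :=
  (A⁻¹ * z).toWord.head? = some d

lemma toWord_mk_singleton (d : E × Bool) : (FreeGroup.mk [d]).toWord = [d] := by
  rw [FreeGroup.toWord_mk]; rfl

lemma Beyond.treeDist_eq {A z : FreeGroup E} {d : E × Bool} (h : Beyond A d z) :
    treeDist ℓ z A = treeDist ℓ z (A * FreeGroup.mk [d]) + ℓ d.1 := by
  rw [treeDist_comm, treeDist_comm _ z, treeDist, wlen, toWord_eq_cons h, lsum_cons, treeDist,
    wlen, mul_inv_rev, mul_assoc]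
  ring

lemma treeDist_eq_of_not_beyond {A z : FreeGroup E} {d : E × Bool} (h : ¬ Beyond A d z) :
    treeDist ℓ z (A * FreeGroup.mk [d]) = treeDist ℓ z A + ℓ d.1 := by
  have h1 : ((FreeGroup.mk [d])⁻¹ * (A⁻¹ * z)).toWord =
      ((FreeGroup.mk [d])⁻¹).toWord ++ (A⁻¹ * z).toWord := by
    refine toWord_mul_of_head? fun p hp hp' => h ?_
    rw [inv_inv, toWord_mk_singleton] at hp
    obtain rfl : d = p := by simpa using hp
    exact hp'
  rw [treeDist_comm, treeDist_comm _ z, treeDist, wlen, mul_inv_rev, mul_assoc, h1, lsum_append,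
    FreeGroup.toWord_inv, lsum_invRev, toWord_mk_singleton, treeDist, wlen, lsum_cons, lsum_nil]
  ring

/-- The edge `d` at `A` separates `z` from `q`, so the geodesic between them passes through `A`. -/
lemma treeDist_eq_add {A z q : FreeGroup E} {d : E × Bool} (hz : ¬ Beyond A d z)
    (hq : Beyond A d q) : treeDist ℓ z q = treeDist ℓ z A + treeDist ℓ A q := by
  have h1 : ((A⁻¹ * z)⁻¹ * (A⁻¹ * q)).toWord = ((A⁻¹ * z)⁻¹).toWord ++ (A⁻¹ * q).toWord := by
    refine toWord_mul_of_head? fun p hp hp' => hz ?_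
    rw [inv_inv] at hp
    rw [hq] at hp'
    obtain rfl : d = p := by simpa using hp'
    exact hp
  have h2 : z⁻¹ * q = (A⁻¹ * z)⁻¹ * (A⁻¹ * q) := by group
  rw [treeDist, h2, wlen, h1, lsum_append, ← wlen, ← wlen, wlen_inv, ← treeDist, ← treeDist,
    treeDist_comm]

lemma head?_mul_singleton {u : FreeGroup E} {p d : E × Bool} (h : u.toWord.head? = some p)
    (h' : (u * FreeGroup.mk [d]).toWord.head? ≠ some p) : u = FreeGroup.mk [p] ∧ d = bar p := by
  by_cases hd : u⁻¹.toWord.head? = some d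
  · have h3 := toWord_eq_cons hd
    have h4 := congrArg FreeGroup.invRev h3
    rw [FreeGroup.toWord_inv, FreeGroup.invRev_invRev, invRev_eq, List.map_cons,
      List.reverse_cons, ← invRev_eq, ← FreeGroup.toWord_inv, mul_inv_rev, inv_inv, inv_inv] at h4
    rw [h4] at h
    have h5 : (u * FreeGroup.mk [d]).toWord = [] := by
      cases hx : (u * FreeGroup.mk [d]).toWord with
      | nil => rfl
      | cons q l => rw [hx] at h h'; exact absurd h h'
    rw [h5] at h h4
    obtain rfl : bar d = p := by simpa using h
    rw [bar_bar]
    refine ⟨?_, rfl⟩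
    rw [← FreeGroup.mk_toWord (x := u), h4]; rfl
  · have h1 : (u * FreeGroup.mk [d]).toWord = u.toWord ++ (FreeGroup.mk [d]).toWord := by
      refine toWord_mul_of_head? fun p hp hp' => hd ?_
      rw [toWord_mk_singleton] at hp'
      obtain rfl : d = p := by simpa using hp'
      exact hp
    rw [h1, List.head?_append, h] at h'
    exact absurd rfl h'

/-- An edge that crosses another edge coincides with it. -/
lemma eq_of_beyond {A z : FreeGroup E} {e e' : E}
    (h : ¬ (Beyond A (e, true) z ↔ Beyond A (e, true) (z * FreeGroup.of e'))) :
    e = e' ∧ A = z := by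
  have key : A⁻¹ * (z * FreeGroup.of e') = A⁻¹ * z * FreeGroup.mk [(e', true)] :=
    (mul_assoc _ _ _).symm
  by_cases hz : Beyond A (e, true) z
  · have h1 : ¬ Beyond A (e, true) (z * FreeGroup.of e') := fun h1 => h ⟨fun _ => h1, fun _ => hz⟩
    rw [Beyond, key] at h1
    have := (head?_mul_singleton hz h1).2
    simp [bar] at this
  · have h1 : Beyond A (e, true) (z * FreeGroup.of e') := by
      by_contra h1; exact h ⟨fun h2 => absurd h2 hz, fun h2 => absurd h2 h1⟩
    rw [Beyond, key] at h1
    have h2 : A⁻¹ * z * FreeGroup.mk [(e', true)] * FreeGroup.mk [bar (e', true)] = A⁻¹ * z := by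
      rw [mk_bar, mul_inv_cancel_right]
    have h3 := head?_mul_singleton h1 (d := bar (e', true)) (by rw [h2]; exact hz)
    have h4 := bar_injective h3.2
    have h5 : (e, true) = ((e', true) : E × Bool) := h4.symm
    obtain rfl : e = e' := congrArg Prod.fst h5
    refine ⟨rfl, ?_⟩
    have h6 := mul_eq_right.1 h3.1
    exact inv_mul_eq_one.1 h6

/-- The distance of the vertex `z` from the point that divides the edge issuing from `A` with
label `e` in the proportion `t : 1 - t`. -/
def pointDist (ℓ : E → ℝ) (z A : FreeGroup E) (e : E) (t : ℝ) : ℝ :=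
  min (treeDist ℓ z A + t * ℓ e) (treeDist ℓ z (A * FreeGroup.of e) + (1 - t) * ℓ e)

lemma pointDist_mul_left (ℓ : E → ℝ) (h z A : FreeGroup E) (e : E) (t : ℝ) :
    pointDist ℓ (h * z) (h * A) e t = pointDist ℓ z A e t := by
  rw [pointDist, pointDist, treeDist_mul_left, mul_assoc, treeDist_mul_left]

lemma pointDist_of_beyond (hℓ : ∀ e, 0 ≤ ℓ e) {z A : FreeGroup E} {e : E} {t : ℝ} (ht : 0 ≤ t)
    (h : Beyond A (e, true) z) :
    pointDist ℓ z A e t = treeDist ℓ z (A * FreeGroup.of e) + (1 - t) * ℓ e := by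
  have h1 : treeDist ℓ z A = treeDist ℓ z (A * FreeGroup.of e) + ℓ e := h.treeDist_eq
  rw [pointDist, h1, min_eq_right]
  have := mul_nonneg ht (hℓ e)
  linarith

lemma pointDist_of_not_beyond (hℓ : ∀ e, 0 ≤ ℓ e) {z A : FreeGroup E} {e : E} {t : ℝ}
    (ht : t ≤ 1) (h : ¬ Beyond A (e, true) z) :
    pointDist ℓ z A e t = treeDist ℓ z A + t * ℓ e := by
  have h1 : treeDist ℓ z (A * FreeGroup.of e) = treeDist ℓ z A + ℓ e :=
    treeDist_eq_of_not_beyond h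
  rw [pointDist, h1, min_eq_left]
  have := mul_nonneg (sub_nonneg.2 ht) (hℓ e)
  linarith

lemma pointDist_root (hℓ : ∀ e, 0 ≤ ℓ e) (A : FreeGroup E) (e : E) {t : ℝ} (ht : t ≤ 1) :
    pointDist ℓ A A e t = t * ℓ e := by
  rw [pointDist_of_not_beyond hℓ ht (by simp [Beyond]), treeDist_self, zero_add]

lemma pointDist_end (hℓ : ∀ e, 0 ≤ ℓ e) (A : FreeGroup E) (e : E) {t : ℝ} (ht : 0 ≤ t) :
    pointDist ℓ (A * FreeGroup.of e) A e t = (1 - t) * ℓ e := by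
  rw [pointDist_of_beyond hℓ ht (by
    rw [Beyond, inv_mul_cancel_left]; exact congrArg List.head? (toWord_mk_singleton (e, true))),
    treeDist_self, zero_add]

/-- The distances of the endpoints of an edge from a point on another edge differ by the length of
the edge. -/
lemma pointDist_end_eq (hℓ : ∀ e, 0 ≤ ℓ e) {A A' : FreeGroup E} {e e' : E} {t : ℝ} (ht : 0 ≤ t)
    (ht' : t ≤ 1) (h : ¬ (e = e' ∧ A = A')) :
    pointDist ℓ (A' * FreeGroup.of e') A e t = pointDist ℓ A' A e t + ℓ e' ∨
      pointDist ℓ A' A e t = pointDist ℓ (A' * FreeGroup.of e') A e t + ℓ e' := by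
  have key : ∀ z, treeDist ℓ (A' * FreeGroup.of e') z = treeDist ℓ A' z + ℓ e' ∨
      treeDist ℓ A' z = treeDist ℓ (A' * FreeGroup.of e') z + ℓ e' := by
    intro z
    rw [treeDist_comm, treeDist_comm _ A']
    by_cases hz : Beyond A' (e', true) z
    · exact Or.inr hz.treeDist_eq
    · exact Or.inl (treeDist_eq_of_not_beyond hz)
  have hiff : Beyond A (e, true) A' ↔ Beyond A (e, true) (A' * FreeGroup.of e') := by
    by_contra hcon; exact h (eq_of_beyond hcon)
  by_cases hA : Beyond A (e, true) A'
  · rw [pointDist_of_beyond hℓ ht hA, pointDist_of_beyond hℓ ht (hiff.1 hA)]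
    refine (key (A * FreeGroup.of e)).imp (fun h => ?_) fun h => ?_ <;> rw [h] <;> ring
  · rw [pointDist_of_not_beyond hℓ ht' hA, pointDist_of_not_beyond hℓ ht' (fun h => hA (hiff.2 h))]
    refine (key A).imp (fun h => ?_) fun h => ?_ <;> rw [h] <;> ring

end Tree

namespace FinGraph

variable {Γ : FinGraph} {ℓ : Γ.E → ℝ}

/-- Two points whose distance functions, up to constants, are close to each other, are close to
each other. -/
lemma tightLength_le (hℓ : ∀ e, 0 ≤ ℓ e) (p q : Γ.Point) (A B : FreeGroup Γ.E)
    {f g : FreeGroup Γ.E → ℝ} {r s δ : ℝ} (hf : ∀ z, f z = r + pointDist ℓ z A p.edge p.pos)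
    (hg : ∀ z, g z = s + pointDist ℓ z B q.edge q.pos) (hfg : ∀ z, |f z - g z| ≤ δ) :
    p.tightLength ℓ (A⁻¹ * B) q ≤ δ := by
  obtain ⟨e, t, ht⟩ := p
  obtain ⟨e', t', ht'⟩ := q
  simp only at hf hg
  have h0 := abs_le.1 (hfg A)
  have h1 := abs_le.1 (hfg (A * FreeGroup.of e))
  have h2 := abs_le.1 (hfg B)
  have h3 := abs_le.1 (hfg (B * FreeGroup.of e'))
  rw [hf, hg, pointDist_root hℓ _ _ ht.2] at h0
  rw [hf, hg, pointDist_end hℓ _ _ ht.1] at h1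
  rw [hf, hg, pointDist_root hℓ _ _ ht'.2] at h2
  rw [hf, hg, pointDist_end hℓ _ _ ht'.1] at h3
  rw [Point.tightLength]
  simp only
  by_cases hc : e = e' ∧ A = B
  · obtain ⟨rfl, rfl⟩ := hc
    -- For points on one edge, the two ends of the edge give inequalities in which the constant `r -
    -- s` is the same and the distance enters with opposite signs.
    rw [if_pos ⟨rfl, inv_mul_cancel A⟩]
    rw [pointDist_root hℓ _ _ ht'.2] at h0
    rw [pointDist_end hℓ _ _ ht'.1] at h1
    exact abs_le.2 ⟨by linarith, by linarith⟩
  · have hc' : ¬ (e' = e ∧ B = A) := fun h => hc ⟨h.1.symm, h.2.symm⟩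
    rw [if_neg (by rw [inv_mul_eq_one]; exact hc)]
    have e0 := pointDist_end_eq hℓ ht'.1 ht'.2 hc'
    have e1 := pointDist_end_eq hℓ ht.1 ht.2 hc
    have w1 : A⁻¹ * B * FreeGroup.of e' = A⁻¹ * (B * FreeGroup.of e') := mul_assoc _ _ _
    have w2 : (FreeGroup.of e)⁻¹ * (A⁻¹ * B) = (A * FreeGroup.of e)⁻¹ * B := by group
    have w3 : (A * FreeGroup.of e)⁻¹ * B * FreeGroup.of e' =
      (A * FreeGroup.of e)⁻¹ * (B * FreeGroup.of e') := mul_assoc _ _ _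
    rw [w1, w2, w3]
    have m1 : ∀ a b c : ℝ, a + min b c = min (a + b) (a + c) := fun a b c =>
      (min_add_add_left a b c).symm
    set T := min (min (t * ℓ e + pathLength ℓ (A⁻¹ * B) + t' * ℓ e')
        ((1 - t) * ℓ e + pathLength ℓ ((A * FreeGroup.of e)⁻¹ * B) + t' * ℓ e'))
      (min (t * ℓ e + pathLength ℓ (A⁻¹ * (B * FreeGroup.of e')) + (1 - t') * ℓ e')
        ((1 - t) * ℓ e + pathLength ℓ ((A * FreeGroup.of e)⁻¹ * (B * FreeGroup.of e')) +
          (1 - t') * ℓ e')) with hT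
    have T1 : T ≤ t * ℓ e + pathLength ℓ (A⁻¹ * B) + t' * ℓ e' :=
      (min_le_left _ _).trans (min_le_left _ _)
    have T2 : T ≤ (1 - t) * ℓ e + pathLength ℓ ((A * FreeGroup.of e)⁻¹ * B) + t' * ℓ e' :=
      (min_le_left _ _).trans (min_le_right _ _)
    have T3 : T ≤ t * ℓ e + pathLength ℓ (A⁻¹ * (B * FreeGroup.of e')) + (1 - t') * ℓ e' :=
      (min_le_right _ _).trans (min_le_left _ _)
    have T4 : T ≤ (1 - t) * ℓ e + pathLength ℓ ((A * FreeGroup.of e)⁻¹ * (B * FreeGroup.of e')) +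
        (1 - t') * ℓ e' := (min_le_right _ _).trans (min_le_right _ _)
    have a0 : T ≤ t * ℓ e + pointDist ℓ A B e' t' := by
      rw [pointDist, m1]
      refine le_min (T1.trans_eq (add_assoc _ _ _)) (T3.trans_eq (add_assoc _ _ _))
    have a1 : T ≤ (1 - t) * ℓ e + pointDist ℓ (A * FreeGroup.of e) B e' t' := by
      rw [pointDist, m1]
      refine le_min (T2.trans_eq (add_assoc _ _ _)) (T4.trans_eq (add_assoc _ _ _))
    have b0 : T ≤ t' * ℓ e' + pointDist ℓ B A e t := by
      rw [pointDist, m1, treeDist_comm, treeDist_comm _ B]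
      exact le_min (T1.trans_eq (by rw [treeDist, wlen, lsum, pathLength]; ring))
        (T2.trans_eq (by rw [treeDist, wlen, lsum, pathLength]; ring))
    have b1 : T ≤ (1 - t') * ℓ e' + pointDist ℓ (B * FreeGroup.of e') A e t := by
      rw [pointDist, m1, treeDist_comm, treeDist_comm _ (B * FreeGroup.of e')]
      exact le_min (T3.trans_eq (by rw [treeDist, wlen, lsum, pathLength]; ring))
        (T4.trans_eq (by rw [treeDist, wlen, lsum, pathLength]; ring))
    -- Evaluate at the end of the edge of `p` that is farther from `q`: the way to `q` passes
    -- through `p`, so `g - f` is at least `s - r + T` there. Adding the symmetric inequality `c2`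
    -- removes `r - s`.
    have c1 : s - r + T ≤ δ := by
      rcases e0 with e0 | e0 <;> linarith
    have c2 : r - s + T ≤ δ := by
      rcases e1 with e1 | e1 <;> linarith
    linarith

end FinGraph

/-! ### Centres -/

lemma finite_setOf_wlen_le {E : Type} [Finite E] [DecidableEq E] {ℓ : E → ℝ}
    (hℓ : ∀ e, 0 < ℓ e) (M : ℝ) : {z : FreeGroup E | wlen ℓ z ≤ M}.Finite := by
  rcases isEmpty_or_nonempty E with hE | hE
  · exact Set.toFinite _
  obtain ⟨a, ha⟩ := Finite.exists_min ℓ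
  refine Set.Finite.of_injOn (f := FreeGroup.toWord) (t := {L | L.length ≤ ⌈M / ℓ a⌉₊})
    (fun z hz => ?_) FreeGroup.toWord_injective.injOn (List.finite_length_le _ _)
  have h1 := lsum_mono (ℓ := fun _ => ℓ a) (ℓ' := ℓ) ha z.toWord
  rw [lsum_const] at h1
  have h2 : (z.toWord.length : ℝ) ≤ M / ℓ a := by
    rw [le_div_iff₀ (hℓ a), mul_comm]
    exact h1.trans hz
  have h3 : (z.toWord.length : ℝ) ≤ ⌈M / ℓ a⌉₊ := h2.trans (Nat.le_ceil _)
  exact_mod_cast h3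

/-- The maximum of finitely many distance functions, up to constants, is the distance from a
point, up to a constant. -/
theorem exists_centre {Γ : FinGraph} {ℓ : Γ.E → ℝ} (hℓ : ∀ e, 0 < ℓ e) {b : Γ.V}
    (hv : ∀ v, ∃ d, Γ.init d = v) {ι : Type} (q : ι → FreeGroup Γ.E)
    (hq : ∀ i, q i ∈ Γ.pathClass b b) (c : ι → ℝ) (f : FreeGroup Γ.E → ℝ)
    (hf : ∀ z, IsGreatest (Set.range fun i => treeDist ℓ z (q i) - c i) (f z)) :
    ∃ (p : Γ.Point) (A : FreeGroup Γ.E) (r : ℝ), A ∈ Γ.pathClass b p.root ∧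
      ∀ z, f z = r + pointDist ℓ z A p.edge p.pos := by
  have hℓ0 : ∀ e, 0 ≤ ℓ e := fun e => (hℓ e).le
  have hlip : ∀ z w, f z ≤ f w + treeDist ℓ z w := by
    intro z w
    obtain ⟨⟨i, hi⟩, -⟩ := hf z
    have h1 := (hf w).2 ⟨i, rfl⟩
    have h2 := treeDist_triangle hℓ0 z w (q i)
    simp only at hi h1
    linarith
  have hge : ∀ z i, treeDist ℓ z (q i) - c i ≤ f z := fun z i => (hf z).2 ⟨i, rfl⟩
  suffices H : ∃ (A : FreeGroup Γ.E) (d : Γ.E × Bool) (s r : ℝ), A ∈ Γ.pathClass b (Γ.init d) ∧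
      0 ≤ s ∧ s ≤ ℓ d.1 ∧ ∀ z, f z = r + min (treeDist ℓ z A + s)
        (treeDist ℓ z (A * FreeGroup.mk [d]) + (ℓ d.1 - s)) by
    obtain ⟨A, ⟨e, o⟩, s, r, hA, hs0, hs1, h⟩ := H
    have he := (hℓ e).ne'
    cases o with
    | true =>
      refine ⟨⟨e, s / ℓ e, div_nonneg hs0 (hℓ e).le, (div_le_one (hℓ e)).2 hs1⟩, A, r, hA,
        fun z => ?_⟩
      rw [h, pointDist]
      simp only
      rw [sub_mul, one_mul, div_mul_cancel₀ _ he]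
      rfl
    | false =>
      refine ⟨⟨e, 1 - s / ℓ e, sub_nonneg.2 ((div_le_one (hℓ e)).2 hs1),
        sub_le_self _ (div_nonneg hs0 (hℓ e).le)⟩, A * FreeGroup.mk [(e, false)], r,
        mul_mem_pathClass hA (mk_singleton_mem_pathClass (e, false)), fun z => ?_⟩
      have h1 : A * FreeGroup.mk [(e, false)] * FreeGroup.of e = A := by
        rw [mk_singleton_false, inv_mul_cancel_right]
      rw [h, pointDist]
      simp only
      rw [h1, sub_sub_cancel, sub_mul, one_mul, div_mul_cancel₀ _ he, min_comm]
  obtain ⟨⟨i₀, -⟩, -⟩ := hf 1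
  -- Positive lengths make `f` proper, so it has a minimum over the vertices of the universal cover,
  -- which are the words that are edge paths from `b`. The centre lies on an edge at this vertex.
  have hfin : {z : FreeGroup Γ.E | (∃ w, z ∈ Γ.pathClass b w) ∧ f z ≤ f 1}.Finite := by
    refine (finite_setOf_wlen_le hℓ (f 1 + c i₀ + wlen ℓ (q i₀))).subset ?_
    rintro z ⟨-, hz⟩
    have h1 := hge z i₀
    have h2 := treeDist_triangle hℓ0 1 (q i₀) z
    rw [treeDist_comm ℓ (q i₀) z] at h2
    have h3 : ∀ w, treeDist ℓ 1 w = wlen ℓ w := fun w => by rw [treeDist, inv_one, one_mul]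
    rw [h3, h3] at h2
    change wlen ℓ z ≤ _
    linarith
  obtain ⟨A, ⟨⟨w, hw⟩, hA1⟩, hmin⟩ := Set.exists_min_image _ f hfin
    ⟨1, ⟨b, one_mem_pathClass b⟩, le_rfl⟩
  have hmin' : ∀ z w, z ∈ Γ.pathClass b w → f A ≤ f z := by
    intro z w hz
    rcases le_total (f z) (f 1) with h | h
    · exact hmin z ⟨⟨w, hz⟩, h⟩
    · exact hA1.trans h
  obtain ⟨⟨i, hi⟩, -⟩ := hf A
  simp only at hi
  cases hu : (A⁻¹ * q i).toWord with
  | nil =>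
    rw [FreeGroup.toWord_eq_nil_iff, inv_mul_eq_one] at hu
    obtain ⟨d, hd⟩ := hv w
    refine ⟨A, d, 0, f A, hd ▸ hw, le_rfl, (hℓ _).le, fun z => ?_⟩
    rw [← hu, treeDist_self] at hi
    have h1 : treeDist ℓ z A ≤ treeDist ℓ z (A * FreeGroup.mk [d]) + ℓ d.1 := by
      by_cases hz : Beyond A d z
      · exact hz.treeDist_eq.le
      · rw [treeDist_eq_of_not_beyond hz]; linarith [hℓ d.1]
    rw [add_zero, sub_zero, min_eq_left h1]
    refine le_antisymm (hlip z A) ?_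
    have := hge z i
    rw [← hu] at this
    linarith
  | cons d l =>
    have hdi : Beyond A d (q i) := by rw [Beyond, hu]; rfl
    have hdw : Γ.init d = w := by
      have := isWalk_toWord (mul_mem_pathClass (inv_mem_pathClass hw) (hq i))
      rw [hu] at this
      exact this.1
    set B := A * FreeGroup.mk [d] with hB
    have hBA : f A ≤ f B := by
      refine hmin' B (Γ.term d) (mul_mem_pathClass hw ?_)
      rw [← hdw]; exact mk_singleton_mem_pathClass d
    have hAB : treeDist ℓ B A = ℓ d.1 := by
      rw [hB, treeDist_comm, treeDist, inv_mul_cancel_left, wlen, toWord_mk_singleton]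
      simp
    have hBA' := hlip B A
    rw [hAB] at hBA'
    obtain ⟨⟨j, hj⟩, -⟩ := hf B
    simp only at hj
    -- If the point attaining the maximum at `B` lay beyond `d` too, then `f A` would exceed `f B`,
    -- against minimality. So the maxima at `A` and `B` come from opposite sides of the edge.
    have hdj : ¬ Beyond A d (q j) := by
      intro h
      have h1 := h.treeDist_eq (ℓ := ℓ)
      rw [← hB, treeDist_comm, treeDist_comm ℓ _ B] at h1
      have h2 := hge A j
      have := hℓ d.1
      linarith
    have hj' := treeDist_eq_of_not_beyond (ℓ := ℓ) hdj
    rw [← hB, treeDist_comm, treeDist_comm ℓ _ A] at hj'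
    -- The distance `s` of the centre from `A` and the constant `r` solve `f A = r + s` and `f B = r
    -- + ℓ d.1 - s`.
    refine ⟨A, d, (f A + ℓ d.1 - f B) / 2, f A - (f A + ℓ d.1 - f B) / 2, hdw ▸ hw,
      by linarith, by linarith [hℓ d.1], fun z => ?_⟩
    by_cases hz : Beyond A d z
    · have h1 := hz.treeDist_eq (ℓ := ℓ)
      rw [← hB] at h1
      rw [← hB, min_eq_right (by linarith)]
      have h2 := treeDist_eq_add (ℓ := ℓ) hdj hz
      have h3 := hge z j
      rw [treeDist_comm ℓ z (q j), h2, treeDist_comm ℓ A z, treeDist_comm ℓ (q j)] at h3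
      have h4 := hlip z B
      exact le_antisymm (by linarith) (by linarith)
    · have h1 := treeDist_eq_of_not_beyond (ℓ := ℓ) hz
      rw [← hB] at h1
      rw [← hB, min_eq_left (by linarith)]
      have h2 := treeDist_eq_add (ℓ := ℓ) hz hdi
      have h3 := hge z i
      rw [h2] at h3
      have h4 := hlip z A
      exact le_antisymm (by linarith) (by linarith)


open FinGraph

/-! ### Existence of differences of markings with given slope -/

/-- Every element of the fundamental group becomes cyclically reduced after multiplication with an
element of a finite set. -/
lemma MarkedGraph.exists_finset_closing {n : ℕ} (M : MarkedGraph n) :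
    ∃ s : Finset (FreeGroup (Fin n)), ∀ g, ∃ k ∈ s, ∀ ℓ : M.Γ.E → ℝ, (∀ e, 0 ≤ ℓ e) →
      wlen ℓ (M.f g) ≤ tl ℓ (M.f (g * k)) := by
  classical
  choose K hK using exists_closing M.connected M.two_lt_valence
  set k : (M.Γ.E × Bool) × (M.Γ.E × Bool) → FreeGroup (Fin n) := fun a =>
    if h : FreeGroup.mk (K a.1 a.2) ∈ M.Γ.pathClass M.base M.base then
      (M.toPreMarked.exists_f_eq h).choose else 1 with hk
  have hk' : ∀ a z, FreeGroup.mk (K a z) ∈ M.Γ.pathClass M.base M.base →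
      M.f (k (a, z)) = FreeGroup.mk (K a z) := by
    intro a z h
    simp only [hk, dif_pos h]
    exact (M.toPreMarked.exists_f_eq h).choose_spec
  refine ⟨insert 1 (Finset.univ.image k), fun g => ?_⟩
  have hg := M.toPreMarked.f_mem g
  cases hW : (M.f g).toWord with
  | nil => exact ⟨1, by simp, fun ℓ hℓ => by rw [wlen, hW]; exact tl_nonneg hℓ _⟩
  | cons a W =>
    obtain ⟨z, hz⟩ : ∃ z, (a :: W).getLast? = some z :=
      ⟨_, List.getLast?_eq_getLast_of_ne_nil (by simp)⟩
    have hw := isWalk_toWord hg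
    have hr := FreeGroup.isReduced_toWord (x := M.f g)
    rw [hW] at hw hr
    have hw' : M.Γ.IsWalk M.base M.base (a :: W) := hw
    have hl := hK a z (a :: W) (isChain_of_isWalk hw' hr) rfl hz
    have h1 : M.Γ.IsWalk (M.Γ.init a) (M.Γ.init a) (a :: W ++ K a z) := hl.isWalk
    rw [hw'.1] at h1
    obtain ⟨w, h2, h3⟩ := isWalk_append.1 h1
    obtain rfl := isWalk_end_unique hw' h2
    refine ⟨k (a, z), Finset.mem_insert_of_mem (Finset.mem_image_of_mem k (Finset.mem_univ _)),
      fun ℓ hℓ => ?_⟩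
    rw [map_mul, hk' a z (mk_mem_pathClass h3), ← FreeGroup.mk_toWord (x := M.f g), hW,
      ← mk_append, tl_mk_of_isCyclicallyReduced hℓ hl.isCyclicallyReduced, lsum_append,
      wlen_mk_of_isReduced ℓ hr]
    linarith [lsum_nonneg hℓ (K a z)]

/-! ### From a bound for translation lengths to a map with that slope -/

namespace MarkedMetricGraph

variable {n : ℕ} {x y : MarkedMetricGraph n}

/-- Translation lengths control the lengths of words. -/
lemma exists_wlen_le {ℓ : y.Γ.E → ℝ} (hℓ : ∀ e, 0 ≤ ℓ e) {c : ℝ} (hc : 0 ≤ c)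
    (h : ∀ g, tl ℓ (y.f g) ≤ c * x.tr g) :
    ∃ C, ∀ g, wlen ℓ (y.f g) ≤ c * wlen x.ℓ (x.f g) + C := by
  obtain ⟨s, hs⟩ := y.exists_finset_closing
  refine ⟨c * ∑ k ∈ s, wlen x.ℓ (x.f k), fun g => ?_⟩
  obtain ⟨k, hk, hk'⟩ := hs g
  have hx := x.isMetric.nonneg
  have h1 : wlen x.ℓ (x.f k) ≤ ∑ k ∈ s, wlen x.ℓ (x.f k) :=
    Finset.single_le_sum (f := fun k => wlen x.ℓ (x.f k)) (fun k _ => wlen_nonneg hx _) hk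
  have h2 : x.tr (g * k) ≤ wlen x.ℓ (x.f g) + wlen x.ℓ (x.f k) := by
    refine (tl_le_wlen hx _).trans ?_
    rw [map_mul]; exact wlen_mul_le hx _ _
  calc wlen ℓ (y.f g) ≤ _ := hk' ℓ hℓ
    _ ≤ c * x.tr (g * k) := h _
    _ ≤ c * (wlen x.ℓ (x.f g) + ∑ k ∈ s, wlen x.ℓ (x.f k)) :=
        mul_le_mul_of_nonneg_left (h2.trans (by linarith)) hc
    _ = _ := by ring

/-- A metric may be made positive without changing translation lengths much. -/
lemma exists_pos_metric {c c' : ℝ} (hc : 0 ≤ c) (hcc : c < c') (h : ∀ g, y.tr g ≤ c * x.tr g) :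
    ∃ ℓ : y.Γ.E → ℝ, (∀ e, 0 < ℓ e) ∧ (∀ e, y.ℓ e ≤ ℓ e) ∧
      ∀ g, tl ℓ (y.f g) ≤ c' * x.tr g := by
  obtain ⟨ε, hε, hy⟩ := y.exists_le_tr
  set N : ℝ := Fintype.card y.Γ.E * (2 / ε) with hN
  have hN0 : 0 ≤ N := by positivity
  -- A loop has at most `N * c * x.tr g` edges, so adding `η` to each edge costs at most `(c' - c) *
  -- x.tr g`. The summand 1 keeps the denominator positive.
  set η := (c' - c) / (N * c + 1) with hη
  have hNc : 0 < N * c + 1 := by positivity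
  have hη0 : 0 < η := div_pos (sub_pos.2 hcc) hNc
  have hyℓ := y.isMetric.nonneg
  refine ⟨fun e => y.ℓ e + η, fun e => by linarith [hyℓ e], fun e => by linarith, fun g => ?_⟩
  rcases eq_or_ne g 1 with rfl | hg
  · rw [map_one, tl_one]
    exact mul_nonneg (hc.trans hcc.le) (x.tr_nonneg 1)
  obtain ⟨L, hL, hl⟩ := y.toMarkedGraph.toPreMarked.exists_tl_eq hg
  have h1 : tl (fun e => y.ℓ e + η) (y.f g) = lsum (fun e => y.ℓ e + η) L :=
    hl _ fun e => by linarith [hyℓ e]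
  have h2 : y.tr g = lsum y.ℓ L := hl _ hyℓ
  have h3 : lsum (fun _ : y.Γ.E => η) L = η * ∑ e, lsum (single e) L := by
    rw [Finset.mul_sum, ← lsum_sum]
    congr 1
    funext e
    simp [single]
  have h4 : ∑ e, lsum (single e) L ≤ N * y.tr g := by
    rw [h2, hN, mul_assoc]
    refine (Finset.sum_le_card_nsmul _ _ _ fun e _ =>
      y.toMarkedGraph.toPreMarked.lsum_single_le hyℓ hε hy hL e).trans_eq ?_
    rw [nsmul_eq_mul]; rfl
  rw [h1, lsum_add, ← h2, h3]
  have h5 : η * ∑ e, lsum (single e) L ≤ η * (N * (c * x.tr g)) :=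
    mul_le_mul_of_nonneg_left (h4.trans (mul_le_mul_of_nonneg_left (h g) hN0)) hη0.le
  have h6 : η * (N * c) ≤ c' - c := by
    rw [hη, div_mul_eq_mul_div, div_le_iff₀ hNc]
    have := sub_pos.2 hcc
    nlinarith
  have h7 := mul_le_mul_of_nonneg_right h6 (x.tr_nonneg g)
  have h8 := h g
  nlinarith

/-- The function whose centre is the image of a point under a map of least slope. -/
def stretch (x y : MarkedMetricGraph n) (ℓ : y.Γ.E → ℝ) (c : ℝ) (τ : FreeGroup x.Γ.E)
    (z : FreeGroup y.Γ.E) : ℝ :=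
  sSup (Set.range fun g => treeDist ℓ z (y.f g) - c * treeDist x.ℓ τ (x.f g))

/-- Distances in `y` grow at most like `c` times those in `x`, up to a constant. As `c < c'`, all
but finitely many `g` lie below the value at 1, and the supremum is attained. -/
lemma isGreatest_stretch {ℓ : y.Γ.E → ℝ} (hℓ : ∀ e, 0 < ℓ e) {c c' : ℝ} (hc : 0 ≤ c)
    (hcc : c < c') (h : ∀ g, tl ℓ (y.f g) ≤ c * x.tr g) (τ : FreeGroup x.Γ.E)
    (z : FreeGroup y.Γ.E) :
    IsGreatest (Set.range fun g => treeDist ℓ z (y.f g) - c' * treeDist x.ℓ τ (x.f g))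
      (stretch x y ℓ c' τ z) := by
  have hℓ0 : ∀ e, 0 ≤ ℓ e := fun e => (hℓ e).le
  have hx := x.isMetric.nonneg
  obtain ⟨C, hC⟩ := exists_wlen_le hℓ0 hc h
  set F : FreeGroup (Fin n) → ℝ := fun g => treeDist ℓ z (y.f g) - c' * treeDist x.ℓ τ (x.f g)
    with hF
  have hub : ∀ g, F g ≤ wlen ℓ z + C + c' * wlen x.ℓ τ - (c' - c) * wlen x.ℓ (x.f g) := by
    intro g
    have h1 : treeDist ℓ z (y.f g) ≤ wlen ℓ z + wlen ℓ (y.f g) := by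
      have := wlen_mul_le hℓ0 z⁻¹ (y.f g)
      rwa [wlen_inv] at this
    have h2 : wlen x.ℓ (x.f g) ≤ wlen x.ℓ τ + treeDist x.ℓ τ (x.f g) := by
      have := wlen_mul_le hx τ (τ⁻¹ * x.f g)
      rwa [mul_inv_cancel_left] at this
    have h3 := mul_le_mul_of_nonneg_left h2 (hc.trans hcc.le)
    have h4 := hC g
    simp only [hF]
    linarith
  have hfin : {g | F 1 ≤ F g}.Finite := by
    set R := (wlen ℓ z + C + c' * wlen x.ℓ τ - F 1) / (c' - c)
    refine ((finite_setOf_wlen_le hℓ (c * R + C)).preimage y.f_injective.injOn).subset ?_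
    intro g hg
    have h1 : wlen x.ℓ (x.f g) ≤ R := by
      rw [le_div_iff₀ (sub_pos.2 hcc)]
      have := hub g
      have : F 1 ≤ F g := hg
      linarith
    exact (hC g).trans (add_le_add_left (mul_le_mul_of_nonneg_left h1 hc) C)
  obtain ⟨g, -, hmax⟩ := Set.exists_max_image _ F hfin ⟨1, le_refl (F 1)⟩
  have hg : IsGreatest (Set.range F) (F g) := by
    refine ⟨⟨g, rfl⟩, ?_⟩
    rintro _ ⟨k, rfl⟩
    rcases le_total (F 1) (F k) with h1 | h1
    · exact hmax k h1
    · exact h1.trans (hmax 1 (le_refl (F 1)))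
  have : stretch x y ℓ c' τ z = F g := hg.csSup_eq
  rw [this]
  exact hg

/-- Reindexing the supremum by a left translation. Thus centres depend equivariantly on `τ` and
define a map of quotient graphs. -/
lemma stretch_mul (ℓ : y.Γ.E → ℝ) (c : ℝ) (h : FreeGroup (Fin n)) (τ : FreeGroup x.Γ.E)
    (z : FreeGroup y.Γ.E) : stretch x y ℓ c (x.f h * τ) (y.f h * z) = stretch x y ℓ c τ z := by
  rw [stretch, stretch]
  congr 1
  rw [← (Equiv.mulLeft h).surjective.range_comp]
  congr 1
  funext g
  simp only [Function.comp_apply, Equiv.coe_mulLeft, map_mul, treeDist_mul_left]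

/-- Each function under the supremum is `c'`-Lipschitz in `τ` by the triangle inequality. This is
what becomes the bound for the slope. -/
lemma abs_stretch_sub_le {ℓ : y.Γ.E → ℝ} (hℓ : ∀ e, 0 < ℓ e) {c c' : ℝ} (hc : 0 ≤ c)
    (hcc : c < c') (h : ∀ g, tl ℓ (y.f g) ≤ c * x.tr g) (τ τ' : FreeGroup x.Γ.E)
    (z : FreeGroup y.Γ.E) :
    |stretch x y ℓ c' τ z - stretch x y ℓ c' τ' z| ≤ c' * treeDist x.ℓ τ τ' := by
  have key : ∀ τ τ', stretch x y ℓ c' τ z ≤ stretch x y ℓ c' τ' z + c' * treeDist x.ℓ τ τ' := by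
    intro τ τ'
    obtain ⟨⟨g, hg⟩, -⟩ := isGreatest_stretch hℓ hc hcc h τ z
    have h1 := (isGreatest_stretch hℓ hc hcc h τ' z).2 ⟨g, rfl⟩
    have h2 := mul_le_mul_of_nonneg_left
      (treeDist_triangle x.isMetric.nonneg τ' τ (x.f g)) (hc.trans hcc.le)
    rw [treeDist_comm _ τ' τ] at h2
    simp only at hg h1
    linarith
  have h1 := key τ τ'
  have h2 := key τ' τ
  rw [treeDist_comm] at h2
  exact abs_le.2 ⟨by linarith, by linarith⟩

end MarkedMetricGraph

lemma FinGraph.tightLength_mono {Γ : FinGraph} {ℓ ℓ' : Γ.E → ℝ} (h : ∀ e, ℓ e ≤ ℓ' e)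
    (hℓ : ∀ e, 0 ≤ ℓ e) (p : Γ.Point) (w : FreeGroup Γ.E) (q : Γ.Point) :
    p.tightLength ℓ w q ≤ p.tightLength ℓ' w q := by
  have hp : ∀ w, pathLength ℓ w ≤ pathLength ℓ' w := fun w => wlen_mono h w
  have h1 : ∀ p : Γ.Point, (p.pos : ℝ) * ℓ p.edge ≤ p.pos * ℓ' p.edge := fun p =>
    mul_le_mul_of_nonneg_left (h _) p.pos.2.1
  have h2 : ∀ p : Γ.Point, (1 - (p.pos : ℝ)) * ℓ p.edge ≤ (1 - p.pos) * ℓ' p.edge := fun p =>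
    mul_le_mul_of_nonneg_left (h _) (sub_nonneg.2 p.pos.2.2)
  rw [Point.tightLength, Point.tightLength]
  split_ifs with hc
  · rw [hc.1, ← sub_mul, ← sub_mul, abs_mul, abs_mul, abs_of_nonneg (hℓ _),
      abs_of_nonneg ((hℓ _).trans (h _))]
    exact mul_le_mul_of_nonneg_left (h _) (abs_nonneg _)
  · exact min_le_min
      (min_le_min (add_le_add (add_le_add (h1 _) (hp _)) (h1 _))
        (add_le_add (add_le_add (h2 _) (hp _)) (h1 _)))
      (min_le_min (add_le_add (add_le_add (h1 _) (hp _)) (h2 _))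
        (add_le_add (add_le_add (h2 _) (hp _)) (h2 _)))

/-- Paths in a marked graph may be turned into elements of the fundamental group. -/
lemma PreMarked.exists_retraction {n : ℕ} (X : PreMarked n) :
    ∃ (τ : X.Γ.V → FreeGroup X.Γ.E) (κ : FreeGroup X.Γ.E →* FreeGroup (Fin n)) (k₀ : _),
      (∀ u, τ u ∈ X.Γ.pathClass X.base u) ∧
      (∀ u v, ∀ W ∈ X.Γ.pathClass u v, X.f (κ W) = τ u * W * (τ v)⁻¹) ∧
      ∀ g, κ (X.f g) = k₀ * g * k₀⁻¹ := by
  choose τ hτ using X.reach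
  have hk : ∀ e, ∃ k, X.f k = τ (X.Γ.src e) * FreeGroup.of e * (τ (X.Γ.tgt e))⁻¹ := fun e =>
    X.exists_f_eq (mul_mem_pathClass (mul_mem_pathClass (hτ _) (of_mem_pathClass e))
      (inv_mem_pathClass (hτ _)))
  choose k hk using hk
  obtain ⟨k₀, hk₀⟩ := X.exists_f_eq (hτ X.base)
  have key : ∀ u v, ∀ W ∈ X.Γ.pathClass u v, X.f (FreeGroup.lift k W) = τ u * W * (τ v)⁻¹ := by
    intro u v W hW
    have := hom_gauge (X.f.comp (FreeGroup.lift k)) (MonoidHom.id _) (fun u => (τ u)⁻¹)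
      (fun e => by simp [hk]) hW
    simpa using this
  refine ⟨τ, FreeGroup.lift k, k₀, hτ, key, fun g => X.f_injective ?_⟩
  rw [key _ _ _ (X.f_mem g), map_mul, map_mul, map_inv, hk₀]

/-- If no conjugacy class is stretched by more than `c`, there are differences of markings with
slopes arbitrarily near to `c`. -/
theorem exists_slopeLE {n : ℕ} {x y : MarkedMetricGraph n} {c c' : ℝ} (hc : 0 ≤ c) (hcc : c < c')
    (h : ∀ g, y.tr g ≤ c * x.tr g) : ∃ φ : DifferenceOfMarkings x y, φ.SlopeLE c' := by
  -- One part of the gap pays for making the metric of `y` positive, the other for the suprema being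
  -- attained.
  obtain ⟨c₁, hc1, hc1'⟩ := exists_between hcc
  obtain ⟨ℓ, hℓ, hyℓ, hl⟩ := MarkedMetricGraph.exists_pos_metric hc hc1 h
  have hc0 := hc.trans hc1.le
  set X := x.toMarkedGraph.toPreMarked
  set Y := y.toMarkedGraph.toPreMarked
  obtain ⟨τ, κ, k₀, hτ, hκ, hk₀⟩ := X.exists_retraction
  have hv : ∀ v, ∃ d, y.Γ.init d = v := by
    intro v
    have h1 := y.two_lt_valence v
    rw [valence_eq] at h1
    obtain ⟨d, hd⟩ := Finset.card_pos.1 ((Nat.zero_lt_two).trans h1)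
    exact ⟨d, (Finset.mem_filter.1 hd).2⟩
  -- A vertex `u` is sent to the centre of the stretch function at its lift `τ u`.
  have hcen := fun u => exists_centre hℓ hv y.f Y.f_mem _ _
    (MarkedMetricGraph.isGreatest_stretch hℓ hc0 hc1' hl (τ u))
  choose p R r hR hcen using hcen
  have hk : ∀ e, x.f (κ (FreeGroup.of e)) =
      τ (x.Γ.src e) * FreeGroup.of e * (τ (x.Γ.tgt e))⁻¹ := fun e => hκ _ _ _ (of_mem_pathClass e)
  refine ⟨⟨p, fun e => (R (x.Γ.src e))⁻¹ * y.f (κ (FreeGroup.of e)) * R (x.Γ.tgt e), fun e => ?_, ?_⟩,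
    fun e => ?_⟩
  · exact mul_mem_pathClass (mul_mem_pathClass (inv_mem_pathClass (hR _)) (Y.f_mem _)) (hR _)
  · refine ⟨(R x.base)⁻¹ * y.f k₀, mul_mem_pathClass (inv_mem_pathClass (hR _)) (Y.f_mem _),
      fun g => ?_⟩
    have h1 : FreeGroup.lift (fun e => (R (x.Γ.src e))⁻¹ * y.f (κ (FreeGroup.of e)) *
        R (x.Γ.tgt e)) (x.f g) = (R x.base)⁻¹ * y.f (κ (x.f g)) * R x.base :=
      hom_gauge _ (y.f.comp κ) R (fun e => by rw [FreeGroup.lift_apply_of]; rfl) (X.f_mem g)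
    have h2 : κ (x.f g) = k₀ * g * k₀⁻¹ := hk₀ g
    rw [h1, h2, map_mul, map_mul, map_inv]
    group
  · refine (tightLength_mono hyℓ y.isMetric.nonneg _ _ _).trans ?_
    have h1 : (R (x.Γ.src e))⁻¹ * y.f (κ (FreeGroup.of e)) * R (x.Γ.tgt e) =
        (R (x.Γ.src e))⁻¹ * (y.f (κ (FreeGroup.of e)) * R (x.Γ.tgt e)) := mul_assoc _ _ _
    simp only [h1]
    -- The stretch functions at the two ends of a lift of `e` differ by at most `c' * x.ℓ e`, and
    -- hence so do their centres. Equivariance moves the second centre to the right lift.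
    refine tightLength_le (fun e => (hℓ e).le) _ _ _ _ (hcen (x.Γ.src e)) (s := r (x.Γ.tgt e))
      (g := MarkedMetricGraph.stretch x y ℓ c' (x.f (κ (FreeGroup.of e)) * τ (x.Γ.tgt e))) (fun z => ?_)
      fun z => ?_
    · have h2 : z = y.f (κ (FreeGroup.of e)) * ((y.f (κ (FreeGroup.of e)))⁻¹ * z) := by group
      rw [h2, MarkedMetricGraph.stretch_mul, hcen, pointDist_mul_left]
    · refine (MarkedMetricGraph.abs_stretch_sub_le hℓ hc0 hc1' hl _ _ z).trans_eq ?_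
      rw [hk, inv_mul_cancel_right, treeDist, inv_mul_cancel_left, wlen_of]


open FinGraph

/-! ### Bounds for the lengths of classes -/

lemma exists_eq_append_of_three_le_count {α : Type} [BEq α] [LawfulBEq α] {a : α} {L : List α}
    (h : 3 ≤ L.count a) : ∃ X A B C, L = X ++ (a :: A) ++ (a :: B) ++ (a :: C) := by
  have key : ∀ {k : ℕ} {L : List α}, k + 1 ≤ L.count a →
      ∃ X Y, L = X ++ a :: Y ∧ k ≤ Y.count a := by
    intro k L hk
    obtain ⟨X, Y, rfl, hX⟩ := List.eq_append_cons_of_mem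
      (List.count_pos_iff.1 (lt_of_lt_of_le (Nat.succ_pos k) hk))
    refine ⟨X, Y, rfl, ?_⟩
    rw [List.count_append, List.count_eq_zero.2 hX, List.count_cons_self] at hk
    omega
  obtain ⟨X, Y, rfl, h1⟩ := key h
  obtain ⟨A, Z, rfl, h2⟩ := key h1
  obtain ⟨B, C, rfl, -⟩ := key h2
  exact ⟨X, A, B, C, by simp⟩

/-- A loop whose lift closes up has the same mod 2 chain in both directions. -/
lemma inv_eq_self_of_right_eq_one {α : Type} (a : CoverGroup α) (h : a.right = 1) : a⁻¹ = a := by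
  have hz : ∀ x : Multiplicative (α → ZMod 2), x⁻¹ = x := fun x =>
    Multiplicative.toAdd.injective (funext fun i => ZMod.neg_eq_self_mod_two _)
  ext1
  · funext s
    rw [RegularWreathProduct.inv_left]
    simp only [Pi.inv_apply]
    rw [hz, h, one_mul]
  · rw [RegularWreathProduct.inv_right, h, inv_one]

namespace PreMarked

variable {n : ℕ} (M : PreMarked n)

/-- Every class of loops in double covers contains a loop that crosses each oriented edge at most
twice. -/
lemma exists_short_loop {i : CoverIndex n} (h : (classSet i).Nonempty) :
    ∃ g ∈ classSet i, ∃ L, (∀ d, L.count d ≤ 2) ∧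
      ∀ ℓ : M.Γ.E → ℝ, (∀ e, 0 ≤ ℓ e) → tl ℓ (M.f g) = lsum ℓ L := by
  set N : FreeGroup (Fin n) → ℕ :=
    fun g => (FreeGroup.reduceCyclically (M.f g).toWord).length with hN
  have hN' : ∀ g, tl (fun _ => 1) (M.f g) = N g := fun g => by
    rw [tl, lsum_const, one_mul]
  -- Choose an element of the class with the least number of edges. Three passages through `d` cut
  -- its loop into three closed paths.
  obtain ⟨g, hg, hmin⟩ := WellFounded.has_min (InvImage.wf N Nat.lt_wfRel.wf) _ h
  obtain ⟨L, w, hL, hw, p, hp, hgp⟩ := M.exists_loop (ne_one_of_mem_classSet hg)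
  have hl : ∀ ℓ : M.Γ.E → ℝ, (∀ e, 0 ≤ ℓ e) → tl ℓ (M.f g) = lsum ℓ L := fun ℓ hℓ => by
    rw [hgp, tl_conj hℓ, tl_mk_of_isCyclicallyReduced hℓ hL.isCyclicallyReduced]
  refine ⟨g, hg, L, fun d => ?_, hl⟩
  by_contra! hd
  obtain ⟨X, A, B, C, rfl⟩ := exists_eq_append_of_three_le_count (Nat.succ_le_of_lt hd)
  obtain ⟨u₃, hw3, hwC⟩ := isWalk_append.1 hw
  obtain ⟨u₂, hw2, hwB⟩ := isWalk_append.1 hw3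
  obtain ⟨u₁, hw1, hwA⟩ := isWalk_append.1 hw2
  obtain rfl : M.Γ.init d = u₁ := hwA.1
  obtain rfl : M.Γ.init d = u₂ := hwB.1
  obtain rfl : M.Γ.init d = u₃ := hwC.1
  set x := FreeGroup.mk X with hx
  set a := FreeGroup.mk A with ha
  set b := FreeGroup.mk B with hb
  set c := FreeGroup.mk C with hc
  set D := FreeGroup.mk [d] with hD
  have hq := mul_mem_pathClass hp (mk_mem_pathClass hw1)
  have hq' := inv_mem_pathClass hq
  obtain ⟨g₁, hg₁⟩ := M.exists_f_eq
    (mul_mem_pathClass (mul_mem_pathClass hq (mk_mem_pathClass hwA)) hq')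
  obtain ⟨g₂, hg₂⟩ := M.exists_f_eq
    (mul_mem_pathClass (mul_mem_pathClass hq (mk_mem_pathClass hwB)) hq')
  obtain ⟨g₃, hg₃⟩ := M.exists_f_eq (mul_mem_pathClass (mul_mem_pathClass hq
    (mul_mem_pathClass (mk_mem_pathClass hwC) (mk_mem_pathClass hw1))) hq')
  rw [mk_cons, ← hD, ← ha, ← hx] at hg₁
  rw [mk_cons, ← hD, ← hb, ← hx] at hg₂
  rw [mk_cons, ← hD, ← hc, ← hx] at hg₃
  have hg123 : g = g₁ * g₂ * g₃ := by
    apply M.f_injective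
    rw [map_mul, map_mul, hg₁, hg₂, hg₃, hgp, mk_append, mk_append, mk_append, mk_cons d A,
      mk_cons d B, mk_cons d C, ← hx, ← ha, ← hb, ← hc, ← hD]
    group
  have hcov : cover i.1 g₁ * cover i.1 g₂ * cover i.1 g₃ = ⟨i.2.1, 1⟩ := by
    rw [← map_mul, ← map_mul, ← hg123]; exact hg
  -- The three sheet changes multiply to the identity in a group of order two, so they cannot all be
  -- nontrivial.
  have hr : (cover i.1 g₁).right = 1 ∨ (cover i.1 g₂).right = 1 ∨ (cover i.1 g₃).right = 1 := by
    have h1 : (cover i.1 g₁).right * (cover i.1 g₂).right * (cover i.1 g₃).right = 1 :=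
      congrArg RegularWreathProduct.right hcov
    revert h1
    generalize (cover i.1 g₁).right = s₁
    generalize (cover i.1 g₂).right = s₂
    generalize (cover i.1 g₃).right = s₃
    revert s₁ s₂ s₃
    decide
  have h1 : ∀ e : M.Γ.E, (0 : ℝ) ≤ (fun _ => 1) e := fun _ => zero_le_one
  have hwl : ∀ Y : List (M.Γ.E × Bool), wlen (fun _ => 1) (FreeGroup.mk Y) ≤ Y.length := fun Y =>
    (wlen_mk_le h1 Y).trans_eq (by rw [lsum_const, one_mul])
  have hD1 : wlen (fun _ => 1) D ≤ 1 := by simpa using hwl [d]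
  have h5 : ∀ z v₁ v₂ v₃ v₄ v₅ : FreeGroup M.Γ.E,
      tl (fun _ => 1) (z * (v₁ * v₂ * v₃ * v₄ * v₅) * z⁻¹) ≤
        wlen (fun _ => 1) v₁ + wlen (fun _ => 1) v₂ + wlen (fun _ => 1) v₃ +
          wlen (fun _ => 1) v₄ + wlen (fun _ => 1) v₅ := by
    intro z v₁ v₂ v₃ v₄ v₅
    rw [tl_conj h1]
    have e0 := tl_le_wlen h1 (v₁ * v₂ * v₃ * v₄ * v₅)
    have e1 := wlen_mul_le h1 (v₁ * v₂ * v₃ * v₄) v₅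
    have e2 := wlen_mul_le h1 (v₁ * v₂ * v₃) v₄
    have e3 := wlen_mul_le h1 (v₁ * v₂) v₃
    have e4 := wlen_mul_le h1 v₁ v₂
    linarith
  have hNg : (N g : ℝ) = X.length + A.length + B.length + C.length + 3 := by
    rw [← hN', hl _ h1, lsum_const]
    simp only [List.length_append, List.length_cons]
    push_cast
    ring
  have hX := hwl X
  have hA := hwl A
  have hB := hwl B
  have hC := hwl C
  have hcontra : ∀ g' ∈ classSet i, (N g : ℝ) ≤ tl (fun _ => 1) (M.f g') := by
    intro g' hg'
    rw [hN']
    exact_mod_cast not_lt.1 (hmin g' hg')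
  -- Inverting the factor that lifts to a closed path keeps the class. It also creates backtracking
  -- along `d`, so the loop becomes shorter, against minimality.
  rcases hr with hr | hr | hr
  · have hm := hcontra (g₁⁻¹ * g₂ * g₃) (by
      change cover i.1 _ = _
      rw [map_mul, map_mul, map_inv, inv_eq_self_of_right_eq_one _ hr, hcov])
    have e : M.f (g₁⁻¹ * g₂ * g₃) = p * x * (a⁻¹ * b * D * c * x) * (p * x)⁻¹ := by
      rw [map_mul, map_mul, map_inv, hg₁, hg₂, hg₃]; group
    rw [e] at hm
    have := h5 (p * x) a⁻¹ b D c x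
    rw [wlen_inv] at this
    linarith
  · have hm := hcontra (g₁ * g₂⁻¹ * g₃) (by
      change cover i.1 _ = _
      rw [map_mul, map_mul, map_inv, inv_eq_self_of_right_eq_one _ hr, hcov])
    have e : M.f (g₁ * g₂⁻¹ * g₃) = p * x * (D * a * b⁻¹ * c * x) * (p * x)⁻¹ := by
      rw [map_mul, map_mul, map_inv, hg₁, hg₂, hg₃]; group
    rw [e] at hm
    have := h5 (p * x) D a b⁻¹ c x
    rw [wlen_inv] at this
    linarith
  · have hm := hcontra (g₁ * g₂ * g₃⁻¹) (by
      change cover i.1 _ = _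
      rw [map_mul, map_mul, map_inv, inv_eq_self_of_right_eq_one _ hr, hcov])
    have e : M.f (g₁ * g₂ * g₃⁻¹) =
        p * x * D * (a * D * b * x⁻¹ * c⁻¹) * (p * x * D)⁻¹ := by
      rw [map_mul, map_mul, map_inv, hg₁, hg₂, hg₃]; group
    rw [e] at hm
    have := h5 (p * x * D) a D b x⁻¹ c⁻¹
    rw [wlen_inv, wlen_inv] at this
    linarith

/-- Some loop of the class crosses each edge at most twice in each direction, and the volume is 1.
-/
lemma classLen_le_four {ℓ : M.Γ.E → ℝ} (hℓ : ∀ e, 0 ≤ ℓ e) (h1 : ∑ e, ℓ e = 1)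
    (i : CoverIndex n) : classLen (fun g => tl ℓ (M.f g)) i ≤ 4 := by
  by_cases hi : (classSet i).Nonempty
  · obtain ⟨g, hg, L, hL, hl⟩ := M.exists_short_loop hi
    refine (classLen_le (fun g => tl_nonneg hℓ _) hg).trans ?_
    rw [hl ℓ hℓ]
    have h2 : ∀ e, lsum (single e) L ≤ 4 := by
      intro e
      have h3 : ∀ L : List (M.Γ.E × Bool), L.countP (fun d => d.1 = e) =
          L.count (e, true) + L.count (e, false) := by
        intro L
        induction L with
        | nil => rfl
        | cons d L ih =>
          rw [List.countP_cons, List.count_cons, List.count_cons, ih]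
          obtain ⟨a, b⟩ := d
          cases b <;> by_cases ha : a = e <;> simp [ha] <;> omega
      rw [lsum_single, h3]
      have := hL (e, true)
      have := hL (e, false)
      exact_mod_cast (by omega : L.count (e, true) + L.count (e, false) ≤ 4)
    have h3 : lsum ℓ L = ∑ e, ℓ e * lsum (single e) L := by
      rw [← lsum_sum]
      congr 1
      funext e
      simp [single]
    rw [h3]
    calc _ ≤ ∑ e, ℓ e * 4 := Finset.sum_le_sum fun e _ => mul_le_mul_of_nonneg_left (h2 e) (hℓ e)
      _ = 4 := by rw [← Finset.sum_mul, h1, one_mul]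
  · rw [classLen, if_neg hi]; norm_num

end PreMarked

/-! ### Translation lengths on Outer space -/

namespace FinGraph.Collapse

variable {Γ Γ' : FinGraph} (c : Collapse Γ Γ')

/-- The weight that counts the edges that are not collapsed. -/
def weight (e : Γ.E) : ℝ := if c.onE e = none then 0 else 1

lemma weight_nonneg (e : Γ.E) : 0 ≤ c.weight e := by unfold weight; split_ifs <;> norm_num

lemma eq_one_of_wlen_eq_zero {v : Γ.V} {g : FreeGroup Γ.E} (hg : g ∈ Γ.pathClass v v)
    (h : wlen c.weight g ≤ 0) : g = 1 := by
  refine c.forest v g hg fun d hd => ?_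
  have h1 := (le_lsum_of_mem c.weight_nonneg hd).trans h
  change c.onE d.1 = none
  by_contra h2
  rw [weight, if_neg h2] at h1
  linarith

/-- A homotopy inverse of a collapse. -/
lemma exists_back : ∃ (back : FreeGroup Γ'.E →* FreeGroup Γ.E) (γ : Γ.V → FreeGroup Γ.E),
    (∀ v, wlen c.weight (γ v) ≤ 0) ∧
    (∀ e', ∃ e b u v, c.onE e = some (e', b) ∧
      back (FreeGroup.of e') = (γ u)⁻¹ * FreeGroup.mk [(e, b)] * γ v) ∧
    ∀ e, back (c.onPath (FreeGroup.of e)) =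
      (γ (Γ.src e))⁻¹ * FreeGroup.of e * γ (Γ.tgt e) := by
  choose s hs using c.onV_surjective
  have hγ : ∀ v, ∃ γ ∈ Γ.pathClass v (s (c.onV v)), wlen c.weight γ ≤ 0 := by
    intro v
    obtain ⟨L, hL, hL'⟩ := (c.onV_eq_iff v (s (c.onV v))).1 (hs _).symm
    refine ⟨_, mk_mem_pathClass hL, (wlen_mk_le c.weight_nonneg L).trans_eq ?_⟩
    exact lsum_eq_zero fun d hd => if_pos (hL' d hd)
  choose γ hγ hγ' using hγ
  have he : ∀ e', ∃ d : Γ.E × Bool, c.onE d.1 = some (e', d.2) := fun e' => by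
    obtain ⟨e, ⟨b, hb⟩, -⟩ := c.onE_bijective e'
    exact ⟨(e, b), hb⟩
  choose d hd using he
  have hback : ∀ e e' b, c.onE e = some (e', b) → d e' = (e, b) := by
    intro e e' b h
    obtain ⟨e₀, -, huniq⟩ := c.onE_bijective e'
    have h1 : (d e').1 = e := (huniq _ ⟨_, hd e'⟩).trans (huniq _ ⟨_, h⟩).symm
    have h2 := hd e'
    rw [h1, h] at h2
    refine Prod.ext h1 ?_
    have h3 := Option.some.inj h2
    exact (congrArg Prod.snd h3).symm
  refine ⟨FreeGroup.lift fun e' =>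
    (γ (Γ.init (d e')))⁻¹ * FreeGroup.mk [d e'] * γ (Γ.term (d e')), γ, hγ', fun e' =>
    ⟨(d e').1, (d e').2, Γ.init (d e'), Γ.term (d e'), hd e', by rw [FreeGroup.lift_apply_of]⟩,
    fun e => ?_⟩
  rw [onPath, FreeGroup.lift_apply_of]
  cases h : c.onE e with
  | none =>
    simp only
    rw [map_one]
    have hV : c.onV (Γ.src e) = c.onV (Γ.tgt e) := by
      rw [c.onV_eq_iff]
      refine ⟨[(e, true)], by simp [init, term], fun d hd => ?_⟩
      obtain rfl : d = (e, true) := by simpa using hd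
      exact h
    have hmem : (γ (Γ.src e))⁻¹ * FreeGroup.of e * γ (Γ.tgt e) ∈
        Γ.pathClass (s (c.onV (Γ.src e))) (s (c.onV (Γ.src e))) := by
      refine mul_mem_pathClass (mul_mem_pathClass (inv_mem_pathClass (hγ _))
        (of_mem_pathClass e)) ?_
      rw [hV]; exact hγ _
    -- A collapsed edge, closed up by the gauges, is a closed path in the forest and hence trivial.
    refine (c.eq_one_of_wlen_eq_zero hmem ?_).symm
    have e1 := wlen_mul_le c.weight_nonneg ((γ (Γ.src e))⁻¹ * FreeGroup.of e) (γ (Γ.tgt e))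
    have e2 := wlen_mul_le c.weight_nonneg (γ (Γ.src e))⁻¹ (FreeGroup.of e)
    have e3 : c.weight e = 0 := if_pos h
    rw [wlen_inv, wlen_of, e3] at e2
    have := hγ' (Γ.src e)
    have := hγ' (Γ.tgt e)
    linarith
  | some d' =>
    obtain ⟨e', b⟩ := d'
    simp only
    have h1 := hback e e' b h
    cases b with
    | true =>
      rw [mk_singleton_true, FreeGroup.lift_apply_of, h1]
      rfl
    | false =>
      rw [mk_singleton_false, map_inv, FreeGroup.lift_apply_of, h1, mk_singleton_false]
      simp only [init, term, Bool.false_eq_true, if_false]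
      group

end FinGraph.Collapse

/-- Neither the collapse nor its homotopy inverse lengthens edges, since the collapsed forest has
length zero. So translation lengths descend to Outer space. -/
lemma Collapses.tr_eq {n : ℕ} {x y : MarkedMetricGraph n} (h : Collapses x y) : x.tr = y.tr := by
  obtain ⟨c, h0, h1, p, -, hp⟩ := h
  funext g
  have hx := x.isMetric.nonneg
  have hy := y.isMetric.nonneg
  have h2 : y.tr g = tl y.ℓ (c.onPath (x.f g)) := by
    rw [MarkedMetricGraph.tr, hp, tl_conj_inv hy]
  rw [h2, MarkedMetricGraph.tr]
  refine le_antisymm ?_ ?_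
  · obtain ⟨back, γ, hγ, hb, hbo⟩ := c.exists_back
    have h3 : back (c.onPath (x.f g)) = (γ x.base)⁻¹ * x.f g * γ x.base :=
      hom_gauge (back.comp c.onPath) (MonoidHom.id _) γ hbo (x.toMarkedGraph.toPreMarked.f_mem g)
    have hw : ∀ w, wlen c.weight w ≤ 0 → wlen x.ℓ w ≤ 0 := by
      intro w hw
      refine (lsum_eq_zero fun d hd => ?_).le
      refine h0 _ ?_
      by_contra h4
      have h5 := (le_lsum_of_mem c.weight_nonneg hd).trans hw
      rw [Collapse.weight, if_neg h4] at h5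
      linarith
    have h4 := tl_hom_le (ℓ := y.ℓ) hx back (fun e' => ?_) (c.onPath (x.f g))
    · rwa [h3, tl_conj_inv hx] at h4
    · obtain ⟨e, b, u, v, he, hbe⟩ := hb e'
      rw [hbe]
      have e1 := wlen_mul_le hx ((γ u)⁻¹ * FreeGroup.mk [(e, b)]) (γ v)
      have e2 := wlen_mul_le hx (γ u)⁻¹ (FreeGroup.mk [(e, b)])
      have e3 := wlen_mk_le hx [(e, b)]
      rw [wlen_inv] at e2
      simp only [lsum_cons, lsum_nil, add_zero] at e3
      have e4 := h1 e _ he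
      simp only at e4
      have := hw _ (hγ u)
      have := hw _ (hγ v)
      linarith
  · refine tl_hom_le hy c.onPath (fun e => ?_) _
    rw [Collapse.onPath, FreeGroup.lift_apply_of]
    cases h : c.onE e with
    | none => simpa using hx e
    | some d =>
      refine (wlen_mk_le hy [d]).trans_eq ?_
      rw [h1 e d h]
      simp

/-- The translation lengths of a point of Outer space. -/
def OuterSpace.tr {n : ℕ} (x : OuterSpace n) : FreeGroup (Fin n) → ℝ :=
  Quot.lift MarkedMetricGraph.tr (fun _ _ h => h.tr_eq) x

@[simp] lemma MarkedMetricGraph.tr_toOuterSpace {n : ℕ} (x : MarkedMetricGraph n) :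
    x.toOuterSpace.tr = x.tr := rfl


open FinGraph

/-! ### The Lipschitz metric and translation lengths -/

namespace OuterSpace

variable {n : ℕ}

lemma exists_rep (x : OuterSpace n) : ∃ x' : MarkedMetricGraph n, x'.toOuterSpace = x :=
  Quot.exists_rep x

lemma prodLen_tr_pos (x : OuterSpace n) : 0 < prodLen x.tr := by
  obtain ⟨x, rfl⟩ := x.exists_rep; exact x.prodLen_tr_pos

/-- Any homomorphism between the graphs that respects the markings stretches by a finite factor,
because loops cross edges boundedly often relative to their length. This makes the set of slopes
nonempty, so the infimum in `lipDist` is a genuine one. -/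
lemma exists_tr_le (x y : OuterSpace n) : ∃ c > 0, ∀ g, y.tr g ≤ c * x.tr g := by
  obtain ⟨x, rfl⟩ := x.exists_rep
  obtain ⟨y, rfl⟩ := y.exists_rep
  simp only [MarkedMetricGraph.tr_toOuterSpace]
  set X := x.toMarkedGraph.toPreMarked with hX
  obtain ⟨τ, κ, k₀, -, -, hκ⟩ := X.exists_retraction
  obtain ⟨ε, hε, hx⟩ := x.exists_le_tr
  have hxℓ := x.isMetric.nonneg
  have hyℓ := y.isMetric.nonneg
  set w : x.Γ.E → ℝ := fun e => wlen y.ℓ (y.f (κ (FreeGroup.of e))) with hw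
  have hw0 : ∀ e, 0 ≤ w e := fun e => wlen_nonneg hyℓ _
  have hε' : 0 ≤ 2 / ε := by positivity
  refine ⟨(∑ e, w e) * (2 / ε) + 1,
    add_pos_of_nonneg_of_pos (mul_nonneg (Finset.sum_nonneg fun e _ => hw0 e) hε') one_pos,
    fun g => ?_⟩
  have h1 : y.tr g ≤ tl w (x.f g) := by
    have h2 := tl_hom_le hyℓ (y.f.comp κ) (ℓ := w) (fun e => le_rfl) (x.f g)
    have h3 : κ (x.f g) = k₀ * g * k₀⁻¹ := hκ g
    rwa [MonoidHom.comp_apply, h3, map_mul, map_mul, map_inv, tl_conj hyℓ] at h2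
  refine h1.trans ?_
  rcases eq_or_ne g 1 with rfl | hg
  · rw [map_one, tl_one]
    exact mul_nonneg (add_nonneg (mul_nonneg (Finset.sum_nonneg fun e _ => hw0 e) hε')
      zero_le_one) (x.tr_nonneg 1)
  obtain ⟨L, hL, hl⟩ := X.exists_tl_eq hg
  have e1 : tl w (x.f g) = lsum w L := hl w hw0
  have e2 : x.tr g = lsum x.ℓ L := hl x.ℓ hxℓ
  have e3 : lsum w L = ∑ e, w e * lsum (single e) L := by
    rw [← lsum_sum]
    congr 1
    funext e
    simp [single]
  have e4 : ∑ e, w e * lsum (single e) L ≤ ∑ e, w e * (2 / ε * lsum x.ℓ L) :=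
    Finset.sum_le_sum fun e _ => mul_le_mul_of_nonneg_left
      (X.lsum_single_le hxℓ hε hx hL e) (hw0 e)
  rw [e1, e2, e3]
  refine e4.trans ?_
  rw [← Finset.sum_mul]
  have := lsum_nonneg hxℓ L
  linarith

/-- The slopes of differences of markings, on a logarithmic scale. -/
def logSlopes (x y : OuterSpace n) : Set ℝ :=
  {r : ℝ | ∃ x' y' : MarkedMetricGraph n, x'.toOuterSpace = x ∧ y'.toOuterSpace = y ∧
    ∃ φ : DifferenceOfMarkings x' y', φ.SlopeLE (Real.exp r)}

lemma nonneg_of_mem_logSlopes {x y : OuterSpace n} {r : ℝ} (h : r ∈ logSlopes x y) : 0 ≤ r := by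
  obtain ⟨x', y', -, -, φ, hφ⟩ := h
  exact Real.one_le_exp_iff.1 hφ.one_le

lemma bddBelow_logSlopes (x y : OuterSpace n) : BddBelow (logSlopes x y) :=
  ⟨0, fun _ h => nonneg_of_mem_logSlopes h⟩

lemma mem_logSlopes {x y : OuterSpace n} {c : ℝ} (hc : 0 < c) (h : ∀ g, y.tr g ≤ c * x.tr g)
    {r : ℝ} (hr : Real.log c < r) : r ∈ logSlopes x y := by
  obtain ⟨x', hx⟩ := x.exists_rep
  obtain ⟨y', hy⟩ := y.exists_rep
  refine ⟨x', y', hx, hy, exists_slopeLE hc.le ((Real.log_lt_iff_lt_exp hc).1 hr) fun g => ?_⟩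
  have := h g
  rwa [← hx, ← hy] at this

lemma logSlopes_nonempty (x y : OuterSpace n) : (logSlopes x y).Nonempty := by
  obtain ⟨c, hc, h⟩ := exists_tr_le x y
  exact ⟨_, mem_logSlopes hc h (lt_add_one _)⟩

lemma lipDist_nonneg (x y : OuterSpace n) : 0 ≤ lipDist x y :=
  le_csInf (logSlopes_nonempty x y) fun _ h => nonneg_of_mem_logSlopes h

lemma lipDist_le {x y : OuterSpace n} {r : ℝ} (h : ∀ g, y.tr g ≤ Real.exp r * x.tr g) :
    lipDist x y ≤ r := by
  refine le_of_forall_gt_imp_ge_of_dense fun s hs => ?_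
  exact csInf_le (bddBelow_logSlopes x y)
    (mem_logSlopes (Real.exp_pos r) h (by rwa [Real.log_exp]))

/-- An inequality that holds for all differences of markings holds in the limit. -/
lemma le_of_forall_slopeLE {x y : OuterSpace n} {a : ℝ} {f : ℝ → ℝ} (hf : Continuous f)
    (h : ∀ x' y' : MarkedMetricGraph n, x'.toOuterSpace = x → y'.toOuterSpace = y →
      ∀ φ : DifferenceOfMarkings x' y', ∀ r, lipDist x y < r → φ.SlopeLE (Real.exp r) → a ≤ f r) :
    a ≤ f (lipDist x y) := by
  refine ge_of_tendsto (f := f) (x := nhdsWithin (lipDist x y) (Set.Ioi (lipDist x y)))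
    ((hf.tendsto (lipDist x y)).mono_left nhdsWithin_le_nhds) ?_
  refine eventually_nhdsWithin_of_forall fun r (hr : lipDist x y < r) => ?_
  obtain ⟨s, ⟨x', y', hx, hy, φ, hφ⟩, hs⟩ := exists_lt_of_csInf_lt (logSlopes_nonempty x y) hr
  exact h x' y' hx hy φ r hr fun e => (hφ e).trans
    (mul_le_mul_of_nonneg_right (Real.exp_le_exp.2 hs.le) (x'.isMetric.nonneg e))

lemma tr_le_exp_lipDist (x y : OuterSpace n) (g : FreeGroup (Fin n)) :
    y.tr g ≤ Real.exp (lipDist x y) * x.tr g := by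
  refine le_of_forall_slopeLE (f := fun r => Real.exp r * x.tr g) (by fun_prop) ?_
  rintro x' y' rfl rfl φ r - hφ
  exact hφ.tr_le g

lemma lipDist_triangle (x y z : OuterSpace n) : lipDist x z ≤ lipDist x y + lipDist y z := by
  refine lipDist_le fun g => ?_
  have h1 := tr_le_exp_lipDist x y g
  have h2 := tr_le_exp_lipDist y z g
  have h3 := mul_le_mul_of_nonneg_left h1 (Real.exp_pos (lipDist y z)).le
  rw [Real.exp_add]
  linarith

/-! ### The Lipschitz metric in the reverse direction -/

/-- The number of factors that are not controlled by the stretch of the reverse map. -/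
def exponent (n : ℕ) : ℕ := Fintype.card (CoverIndex n) - 1

/-- The function whose differences bound the asymmetry of the Lipschitz metric. -/
def potential (x : OuterSpace n) : ℝ := Real.log (prodLen x.tr)

/-- The logarithm of the inequality between the products of class lengths, with the slope replaced
by its infimum by continuity. -/
theorem lipDist_reverse_le (x y : OuterSpace n) :
    lipDist y x ≤ exponent n * lipDist x y + (x.potential - y.potential) := by
  refine lipDist_le fun g => ?_
  have h : x.tr g * prodLen y.tr ≤
      Real.exp (lipDist x y) ^ exponent n * (y.tr g * prodLen x.tr) := by
    refine le_of_forall_slopeLE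
      (f := fun r => Real.exp r ^ exponent n * (y.tr g * prodLen x.tr)) (by fun_prop) ?_
    rintro x' y' rfl rfl φ r - hφ
    exact hφ.tr_mul_prodLen_le g
  have hx := x.prodLen_tr_pos
  have hy := y.prodLen_tr_pos
  rw [Real.exp_add, Real.exp_sub, potential, potential, Real.exp_log hx, Real.exp_log hy,
    Real.exp_nat_mul, ← mul_div_assoc, div_mul_eq_mul_div, le_div_iff₀ hy]
  linarith

lemma classLen_le_four (x : OuterSpace n) (i : CoverIndex n) : classLen x.tr i ≤ 4 := by
  obtain ⟨x, rfl⟩ := x.exists_rep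
  exact x.toMarkedGraph.toPreMarked.classLen_le_four x.isMetric.nonneg x.isMetric.sum_eq_one i

lemma le_tr_of_mem_thickPart {ε : ℝ} {x : OuterSpace n} (h : x ∈ thickPart n ε)
    (g : FreeGroup (Fin n)) (hg : g ≠ 1) : ε ≤ x.tr g := by
  obtain ⟨x, rfl, h⟩ := h
  obtain ⟨L, w, hL, hw, p, -, hp⟩ := x.toMarkedGraph.toPreMarked.exists_loop hg
  have hr := hL.isCyclicallyReduced
  have hx := x.isMetric.nonneg
  have h1 : x.tr g = lsum x.ℓ L := by
    rw [MarkedMetricGraph.tr]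
    refine Eq.trans (congrArg _ hp) ?_
    rw [tl_conj hx, tl_mk_of_isCyclicallyReduced hx hr]
  rw [MarkedMetricGraph.tr_toOuterSpace, h1, ← wlen_mk_of_isReduced _ hr.isReduced]
  refine h w _ (mk_mem_pathClass hw) fun h2 => hL.1 ?_
  have h3 := congrArg FreeGroup.toWord h2
  rwa [FreeGroup.toWord_mk, hr.isReduced.reduce_eq, FreeGroup.toWord_one] at h3

/-- On the thick part every factor of the product lies between `min ε 1` and 4; the 1 accounts for
empty classes. -/
lemma exists_abs_potential_le (n : ℕ) {ε : ℝ} (hε : 0 < ε) :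
    ∃ b, 0 ≤ b ∧ ∀ x ∈ thickPart n ε, |potential x| ≤ b := by
  set δ := min ε 1
  have hδ : 0 < δ := lt_min hε one_pos
  set T := Fintype.card (CoverIndex n)
  refine ⟨|Real.log (δ ^ T)| + |Real.log (4 ^ T)|,
    add_nonneg (abs_nonneg _) (abs_nonneg _), fun x hx => ?_⟩
  have h1 : ∀ i, δ ≤ classLen x.tr i := fun i =>
    le_classLen (min_le_right _ _) (fun g hg => (min_le_left _ _).trans
      (le_tr_of_mem_thickPart hx g hg)) i
  have h2 : δ ^ T ≤ prodLen x.tr := by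
    have := Finset.prod_le_prod (s := Finset.univ) (fun _ _ => hδ.le) fun i _ => h1 i
    rwa [Finset.prod_const, Finset.card_univ] at this
  have h3 : prodLen x.tr ≤ 4 ^ T := by
    have := Finset.prod_le_prod (s := Finset.univ)
      (fun i _ => hδ.le.trans (h1 i)) fun i _ => x.classLen_le_four i
    rwa [Finset.prod_const, Finset.card_univ] at this
  have h4 := Real.log_le_log (pow_pos hδ T) h2
  have h5 := Real.log_le_log x.prodLen_tr_pos h3
  have h6 := neg_abs_le (Real.log (δ ^ T))
  have h7 := le_abs_self (Real.log (4 ^ T))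
  have h8 := abs_nonneg (Real.log (δ ^ T))
  have h9 := abs_nonneg (Real.log ((4 : ℝ) ^ T))
  exact abs_le.2 ⟨by rw [potential]; linarith, by rw [potential]; linarith⟩

/-- The Lipschitz metric on the thick part, for points near to each other. -/
lemma lipDist_reverse_le_of_small {ε : ℝ} (hε : 0 < ε) {x y : OuterSpace n}
    (hx : x ∈ thickPart n ε) (hy : y ∈ thickPart n ε) (h1 : lipDist x y < 1)
    (h2 : lipDist x y < ε / 8) : lipDist y x ≤ 16 / ε * lipDist x y := by
  set d := lipDist x y with hd
  have hd0 : 0 ≤ d := lipDist_nonneg x y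
  have hexp : ∀ r, 0 ≤ r → r ≤ 1 → Real.exp r - 1 ≤ 2 * r := fun r h0 hr => by
    have := Real.abs_exp_sub_one_le (x := r) (by rwa [abs_of_nonneg h0])
    rw [abs_of_nonneg h0] at this
    exact (le_abs_self _).trans this
  set u := 2 / ε * (Real.exp d - 1) with hu
  have hε' : 0 < 2 / ε := by positivity
  have hu0 : 0 ≤ u := mul_nonneg hε'.le (by linarith [Real.add_one_le_exp d])
  have hu1 : u ≤ 4 / ε * d := by
    have := mul_le_mul_of_nonneg_left (hexp d hd0 h1.le) hε'.le
    refine this.trans_eq ?_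
    ring
  have hu2 : u ≤ 1 / 2 := by
    refine hu1.trans ?_
    have : 4 / ε * d ≤ 4 / ε * (ε / 8) := mul_le_mul_of_nonneg_left h2.le (by positivity)
    refine this.trans_eq ?_
    field_simp
    norm_num
  have key : ∀ g, x.tr g * (1 - u) ^ 2 ≤ y.tr g := by
    intro g
    have hlim : -(y.tr g) ≤ -(x.tr g * (1 - u) ^ 2) := by
      refine ge_of_tendsto (f := fun r => -(x.tr g * (1 - 2 / ε * (Real.exp r - 1)) ^ 2))
        (x := nhdsWithin d (Set.Ioi d)) ?_ ?_
      · exact ((by fun_prop : Continuous fun r : ℝ =>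
          -(x.tr g * (1 - 2 / ε * (Real.exp r - 1)) ^ 2)).tendsto d).mono_left
          nhdsWithin_le_nhds
      -- The estimate for slope `exp r` needs `2 / ε * (exp r - 1) ≤ 1`, which holds for `r` below
      -- `min 1 (ε / 8)`. Such `r` suffice for the limit at `d`.
      · have hmem : Set.Ioo d (min 1 (ε / 8)) ∈ nhdsWithin d (Set.Ioi d) :=
          Ioo_mem_nhdsGT (lt_min h1 h2)
        refine Filter.mem_of_superset hmem fun r hr => ?_
        obtain ⟨s, ⟨x', y', hx', hy', φ, hφ⟩, hs⟩ :=
          exists_lt_of_csInf_lt (logSlopes_nonempty x y) hr.1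
        have hφ' : φ.SlopeLE (Real.exp r) := fun e => (hφ e).trans
          (mul_le_mul_of_nonneg_right (Real.exp_le_exp.2 hs.le) (x'.isMetric.nonneg e))
        have hr1 : r ≤ 1 := hr.2.le.trans (min_le_left _ _)
        have hr2 : r ≤ ε / 8 := hr.2.le.trans (min_le_right _ _)
        have hb : 2 / ε * (Real.exp r - 1) ≤ 1 := by
          have e1 := mul_le_mul_of_nonneg_left (hexp r (hd0.trans hr.1.le) hr1) hε'.le
          have e2 : 2 / ε * (2 * r) ≤ 2 / ε * (2 * (ε / 8)) :=
            mul_le_mul_of_nonneg_left (by linarith) hε'.le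
          have e3 : 2 / ε * (2 * (ε / 8)) = 1 / 2 := by field_simp; norm_num
          linarith
        subst hx' hy'
        exact neg_le_neg (hφ'.tr_mul_le hε (le_tr_of_mem_thickPart hx)
          (le_tr_of_mem_thickPart hy) hb g)
    linarith
  have hpos : 0 < 1 - u := by linarith
  have h3 : lipDist y x ≤ -(2 * Real.log (1 - u)) := by
    refine lipDist_le fun g => ?_
    rw [Real.exp_neg, two_mul, Real.exp_add, Real.exp_log hpos, ← div_eq_inv_mul,
      le_div_iff₀ (mul_pos hpos hpos), ← sq]
    exact key g
  -- `-2 log (1 - u) ≤ 2 ((1 - u)⁻¹ - 1) ≤ 4 u`, where the second inequality uses `u ≤ 1 / 2`.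
  have h4 := Real.one_sub_inv_le_log_of_pos hpos
  have h5 : (1 - u)⁻¹ ≤ 1 + 2 * u := by
    rw [inv_le_iff_one_le_mul₀ hpos]
    nlinarith
  have h6 : 16 / ε * d = 4 * (4 / ε * d) := by ring
  linarith

end OuterSpace

/-! ### Piecewise linear paths -/

section Paths

variable {n : ℕ}

/-- The length of a loop is affine in the parameter, so a lower bound at both ends of the interval
holds throughout. Then the number of crossings of each edge, and with it the rate of change of the
length, is bounded by a multiple of the length. -/
lemma exists_lipDist_le_of_affine (M : MarkedGraph n) (a b : M.Γ.E → ℝ) (γ : I → OuterSpace n)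
    {s₀ s₁ : I} (h01 : s₀ ≤ s₁)
    (h : ∀ s : I, s₀ ≤ s → s ≤ s₁ → ∃ h : M.Γ.IsMetric (fun e => a e + (s : ℝ) * b e),
      γ s = MarkedMetricGraph.toOuterSpace ⟨M, fun e => a e + (s : ℝ) * b e, h⟩) :
    ∃ C, 0 ≤ C ∧ ∀ s t : I, s₀ ≤ s → s ≤ s₁ → s₀ ≤ t → t ≤ s₁ →
      lipDist (γ s) (γ t) ≤ C * |(t : ℝ) - s| := by
  set ℓ : I → M.Γ.E → ℝ := fun s e => a e + (s : ℝ) * b e with hℓ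
  obtain ⟨hm0, -⟩ := h s₀ le_rfl h01
  obtain ⟨hm1, -⟩ := h s₁ h01 le_rfl
  obtain ⟨δ₀, hδ₀, h0⟩ := hm0.exists_le_lsum
  obtain ⟨δ₁, hδ₁, h1⟩ := hm1.exists_le_lsum
  have hlsum : ∀ (s : I) L, lsum (ℓ s) L = lsum a L + (s : ℝ) * lsum b L := fun s L => by
    rw [← lsum_smul, ← lsum_add]
  have hδ : 0 < min δ₀ δ₁ := lt_min hδ₀ hδ₁
  have hsys : ∀ s : I, s₀ ≤ s → s ≤ s₁ → ∀ L, M.Γ.IsLoop L → min δ₀ δ₁ ≤ lsum (ℓ s) L := by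
    intro s hs0 hs1 L hL
    have e0 := (min_le_left δ₀ δ₁).trans (h0 L hL)
    have e1 := (min_le_right δ₀ δ₁).trans (h1 L hL)
    have e0' := hlsum s₀ L
    have e1' := hlsum s₁ L
    simp only [hℓ] at e0' e1'
    rw [e0'] at e0
    rw [e1'] at e1
    rw [hlsum]
    have hs0' : (s₀ : ℝ) ≤ s := hs0
    have hs1' : (s : ℝ) ≤ s₁ := hs1
    rcases le_total 0 (lsum b L) with hb | hb
    · have := mul_le_mul_of_nonneg_right hs0' hb
      linarith
    · have := mul_le_mul_of_nonpos_right hs1' hb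
      linarith
  set C := (∑ e, |b e|) * (2 / min δ₀ δ₁) with hC
  have hC0 : 0 ≤ C := by positivity
  refine ⟨C, hC0, fun s t hs0 hs1 ht0 ht1 => ?_⟩
  obtain ⟨hs, hγs⟩ := h s hs0 hs1
  obtain ⟨ht, hγt⟩ := h t ht0 ht1
  rw [hγs, hγt]
  refine OuterSpace.lipDist_le fun g => ?_
  rw [MarkedMetricGraph.tr_toOuterSpace, MarkedMetricGraph.tr_toOuterSpace]
  rcases eq_or_ne g 1 with rfl | hg
  · simp [MarkedMetricGraph.tr]
  obtain ⟨L, hL, hl⟩ := M.toPreMarked.exists_tl_eq hg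
  have e1 : tl (ℓ s) (M.f g) = lsum (ℓ s) L := hl _ hs.nonneg
  have e2 : tl (ℓ t) (M.f g) = lsum (ℓ t) L := hl _ ht.nonneg
  change tl (ℓ t) (M.f g) ≤ _ * tl (ℓ s) (M.f g)
  rw [e1, e2]
  have hsingle : ∀ e, lsum (single e) L ≤ 2 / min δ₀ δ₁ * lsum (ℓ s) L := by
    refine M.toPreMarked.lsum_single_le hs.nonneg hδ (fun g hg => ?_) hL
    obtain ⟨L', hL', hl'⟩ := M.toPreMarked.exists_tl_eq hg
    exact (hsys s hs0 hs1 L' hL').trans_eq (hl' _ hs.nonneg).symm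
  have hb : |lsum b L| ≤ C * lsum (ℓ s) L := by
    have h3 : lsum b L = ∑ e, b e * lsum (single e) L := by
      rw [← lsum_sum]
      congr 1
      funext e
      simp [single]
    rw [h3, hC, mul_assoc, Finset.sum_mul]
    refine (Finset.abs_sum_le_sum_abs _ _).trans (Finset.sum_le_sum fun e _ => ?_)
    rw [abs_mul, abs_of_nonneg (lsum_nonneg (single_nonneg e) L)]
    exact mul_le_mul_of_nonneg_left (hsingle e) (abs_nonneg _)
  have h4 : lsum (ℓ t) L = lsum (ℓ s) L + ((t : ℝ) - s) * lsum b L := by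
    rw [hlsum, hlsum]; ring
  have h5 : ((t : ℝ) - s) * lsum b L ≤ |(t : ℝ) - s| * (C * lsum (ℓ s) L) := by
    refine (le_abs_self _).trans ?_
    rw [abs_mul]
    exact mul_le_mul_of_nonneg_left hb (abs_nonneg _)
  have h6 := Real.add_one_le_exp (C * |(t : ℝ) - s|)
  have h7 := mul_le_mul_of_nonneg_right h6 (lsum_nonneg hs.nonneg L)
  rw [h4]
  linarith

/-- The pieces are glued by the triangle inequality. Since the bound holds for both orders of the
parameters, both lengths are finite. -/
lemma IsPiecewiseLinear.exists_lipDist_le {γ : I → OuterSpace n} (h : IsPiecewiseLinear γ) :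
    ∃ C, 0 ≤ C ∧ ∀ s t : I, lipDist (γ s) (γ t) ≤ C * |(t : ℝ) - s| := by
  obtain ⟨k, t, ht, h0, h1, hp⟩ := h
  have key : ∀ i : Fin (k + 1), ∃ C, 0 ≤ C ∧ ∀ r s : I, r ≤ t i → s ≤ t i →
      lipDist (γ r) (γ s) ≤ C * |(s : ℝ) - r| := by
    intro i
    induction i using Fin.induction with
    | zero =>
      refine ⟨0, le_rfl, fun r s hr hs => ?_⟩
      rw [h0] at hr hs
      have hr' : r = 0 := le_antisymm hr bot_le
      have hs' : s = 0 := le_antisymm hs bot_le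
      rw [hr', hs', zero_mul]
      exact OuterSpace.lipDist_le fun g => by rw [Real.exp_zero, one_mul]
    | succ i ih =>
      obtain ⟨C₁, hC₁, hd₁⟩ := ih
      obtain ⟨M, a, b, hM⟩ := hp i
      have hlt : t i.castSucc ≤ t i.succ := ht.monotone (Fin.castSucc_lt_succ).le
      obtain ⟨C₂, hC₂, hd₂⟩ := exists_lipDist_le_of_affine M a b γ hlt hM
      have hm1 : ∀ u : ℝ, 0 ≤ u → C₁ * u ≤ max C₁ C₂ * u := fun u hu =>
        mul_le_mul_of_nonneg_right (le_max_left _ _) hu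
      have hm2 : ∀ u : ℝ, 0 ≤ u → C₂ * u ≤ max C₁ C₂ * u := fun u hu =>
        mul_le_mul_of_nonneg_right (le_max_right _ _) hu
      refine ⟨max C₁ C₂, hC₁.trans (le_max_left _ _), fun r s hr hs => ?_⟩
      set p := t i.castSucc with hpdef
      rcases le_total r p with hrp | hrp <;> rcases le_total s p with hsp | hsp
      · exact (hd₁ r s hrp hsp).trans (hm1 _ (abs_nonneg _))
      · have e1 := (hd₁ r p hrp le_rfl).trans (hm1 _ (abs_nonneg _))
        have e2 := (hd₂ p s le_rfl hlt hsp hs).trans (hm2 _ (abs_nonneg _))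
        have e3 := OuterSpace.lipDist_triangle (γ r) (γ p) (γ s)
        have h1' : (r : ℝ) ≤ p := hrp
        have h2' : (p : ℝ) ≤ s := hsp
        rw [abs_of_nonneg (by linarith)] at e1 e2 ⊢
        linarith
      · have e1 := (hd₂ r p hrp hr le_rfl hlt).trans (hm2 _ (abs_nonneg _))
        have e2 := (hd₁ p s le_rfl hsp).trans (hm1 _ (abs_nonneg _))
        have e3 := OuterSpace.lipDist_triangle (γ r) (γ p) (γ s)
        have h1' : (p : ℝ) ≤ r := hrp
        have h2' : (s : ℝ) ≤ p := hsp
        rw [abs_of_nonpos (by linarith)] at e1 e2 ⊢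
        linarith
      · exact (hd₂ r s hrp hr hsp hs).trans (hm2 _ (abs_nonneg _))
  obtain ⟨C, hC, hd⟩ := key (Fin.last k)
  refine ⟨C, hC, fun s t => hd s t ?_ ?_⟩ <;> rw [h1] <;> exact le_top

lemma sum_fin_sub (p : ℕ) (f : Fin (p + 1) → ℝ) :
    ∑ i : Fin p, (f i.succ - f i.castSucc) = f (Fin.last p) - f 0 := by
  induction p with
  | zero => simp
  | succ p ih =>
    rw [Fin.sum_univ_castSucc]
    have := ih fun i => f i.castSucc
    simp only [Fin.succ_castSucc] at this ⊢
    rw [this, Fin.succ_last]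
    simp

lemma bddAbove_lipSums {γ : I → OuterSpace n} {C : ℝ}
    (h : ∀ s t : I, lipDist (γ s) (γ t) ≤ C * |(t : ℝ) - s|) : BddAbove (lipSums γ) := by
  refine ⟨C, ?_⟩
  rintro _ ⟨p, t, ht, h0, h1, rfl⟩
  calc _ ≤ ∑ i : Fin p, C * ((t i.succ : ℝ) - t i.castSucc) := by
        refine Finset.sum_le_sum fun i _ => (h _ _).trans_eq ?_
        have hle : (t i.castSucc : ℝ) ≤ t i.succ := (ht (Fin.castSucc_lt_succ)).le
        rw [abs_of_nonneg (sub_nonneg.2 hle)]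
    _ = C := by
        rw [← Finset.mul_sum, sum_fin_sub p fun i => (t i : ℝ), h0, h1]
        simp

lemma reversePath_reversePath (γ : I → OuterSpace n) : reversePath (reversePath γ) = γ := by
  funext t; simp [reversePath]

lemma lipSums_nonempty (γ : I → OuterSpace n) : (lipSums γ).Nonempty := by
  refine ⟨_, 1, ![0, 1], ?_, rfl, rfl, rfl⟩
  rw [Fin.strictMono_iff_lt_succ]
  intro i
  fin_cases i
  simp

lemma lipLength_nonneg (γ : I → OuterSpace n) : 0 ≤ lipLength γ := by
  refine Real.sSup_nonneg ?_
  rintro _ ⟨p, t, -, -, -, rfl⟩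
  exact Finset.sum_nonneg fun i _ => OuterSpace.lipDist_nonneg _ _

/-- The length of the reverse path is controlled by the length of the path. -/
theorem lipLength_reversePath_le {γ : I → OuterSpace n} (h : BddAbove (lipSums γ)) :
    lipLength (reversePath γ) ≤ OuterSpace.exponent n * lipLength γ +
      ((γ 0).potential - (γ 1).potential) := by
  refine csSup_le (lipSums_nonempty _) ?_
  rintro _ ⟨p, t, ht, h0, h1, rfl⟩
  -- The reflected subdivision, in increasing order, so that its sum is one of the sums for `γ`.
  set u : Fin (p + 1) → I := fun i => σ (t i.rev) with hu
  have hmem : ∑ i : Fin p, lipDist (γ (u i.castSucc)) (γ (u i.succ)) ∈ lipSums γ := by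
    refine ⟨p, u, fun i j hij => ?_, ?_, ?_, rfl⟩
    · exact unitInterval.strictAnti_symm (ht (Fin.rev_lt_rev.2 hij))
    · simp [hu, Fin.rev_zero, h1]
    · simp [hu, Fin.rev_last, h0]
  have hsum : ∑ i : Fin p, lipDist (γ (u i.castSucc)) (γ (u i.succ)) =
      ∑ i : Fin p, lipDist (γ (σ (t i.succ))) (γ (σ (t i.castSucc))) := by
    refine Fintype.sum_equiv Fin.revPerm _ _ fun i => ?_
    simp only [hu, Fin.revPerm_apply, Fin.rev_castSucc, Fin.rev_succ]
  have hle : ∑ i : Fin p, lipDist (γ (σ (t i.succ))) (γ (σ (t i.castSucc))) ≤ lipLength γ := by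
    rw [← hsum]; exact le_csSup h hmem
  -- Estimate each term by the reverse distance; the potentials telescope to their values at the
  -- ends of the path.
  calc _ ≤ ∑ i : Fin p, (OuterSpace.exponent n *
          lipDist (γ (σ (t i.succ))) (γ (σ (t i.castSucc))) +
            ((γ (σ (t i.succ))).potential - (γ (σ (t i.castSucc))).potential)) :=
        Finset.sum_le_sum fun i _ => OuterSpace.lipDist_reverse_le _ _
    _ = OuterSpace.exponent n *
          (∑ i : Fin p, lipDist (γ (σ (t i.succ))) (γ (σ (t i.castSucc)))) +
            ((γ 0).potential - (γ 1).potential) := by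
        rw [Finset.sum_add_distrib, ← Finset.mul_sum,
          sum_fin_sub p fun i => (γ (σ (t i))).potential, h0, h1]
        simp
    _ ≤ _ := by
        have := mul_le_mul_of_nonneg_left hle (Nat.cast_nonneg (α := ℝ) (OuterSpace.exponent n))
        linarith

end Paths

/-! ### The constants -/

lemma card_coverIndex (n : ℕ) : Fintype.card (CoverIndex n) = 2 ^ n * ((2 ^ n) ^ 2 - 1) := by
  rw [Fintype.card_prod, Fintype.card_subtype_compl]
  simp

lemma one_le_constA (n : ℕ) : 1 ≤ constA n := by
  have h1 : (1 : ℝ) ≤ 2 ^ n := one_le_pow₀ one_le_two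
  have h2 : (1 : ℝ) ≤ 2 ^ (2 * n - 1) := one_le_pow₀ one_le_two
  have := mul_nonneg (sub_nonneg.2 h1) (sub_nonneg.2 h2)
  rw [constA, constK]
  linarith

/-- With `a = 2 ^ n` the claim is `a (a² - 1) - 1 ≤ 3 ((a - 1) (a² / 2 - 1) + 1)`. The factor 3
absorbs the additional indices: the trivial cover and the chains that are not cycles. -/
lemma exponent_le_constA (n : ℕ) : (OuterSpace.exponent n : ℝ) ≤ constA n := by
  rw [OuterSpace.exponent, card_coverIndex]
  rcases Nat.eq_zero_or_pos n with rfl | hn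
  -- In rank zero there are no indices, and the exponent is zero by truncated subtraction.
  · simp only [pow_zero, one_pow, Nat.sub_self, mul_zero, Nat.zero_sub, Nat.cast_zero]
    linarith [one_le_constA 0]
  have h2 : (2 : ℝ) * 2 ^ (2 * n - 1) = (2 ^ n) ^ 2 := by
    rw [← pow_succ', ← pow_mul]; congr 1; omega
  have hcast : ((2 ^ n * ((2 ^ n) ^ 2 - 1) - 1 : ℕ) : ℝ) = 2 ^ n * ((2 ^ n) ^ 2 - 1) - 1 := by
    have e1 : 1 ≤ (2 ^ n) ^ 2 := Nat.one_le_pow _ _ (by positivity)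
    have e2 : 2 ^ 1 ≤ 2 ^ n := Nat.pow_le_pow_right (by norm_num) hn
    have e3 : 1 ≤ 2 ^ n * ((2 ^ n) ^ 2 - 1) := by
      refine Nat.one_le_iff_ne_zero.2 (Nat.mul_ne_zero (by positivity) ?_)
      have : 2 ^ 2 ≤ (2 ^ n) ^ 2 := Nat.pow_le_pow_left (by omega) 2
      omega
    rw [Nat.cast_sub e3, Nat.cast_mul, Nat.cast_sub e1]
    push_cast
    ring
  rw [hcast, constA, constK]
  set a : ℝ := 2 ^ n with ha
  have h3 : (2 : ℝ) ^ (2 * n - 1) = a ^ 2 / 2 := by linarith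
  rw [h3]
  rcases Nat.lt_or_ge n 2 with h | h
  · have : n = 1 := by omega
    subst this
    rw [ha]; norm_num
  · have h4 : 4 ≤ a := by
      rw [ha]
      calc (4 : ℝ) = 2 ^ 2 := by norm_num
        _ ≤ 2 ^ n := pow_le_pow_right₀ one_le_two h
    nlinarith [mul_nonneg (sub_nonneg.2 h4) (sq_nonneg a), mul_nonneg (sub_nonneg.2 h4) (sub_nonneg.2 h4)]

end LipOuter
end

/-! ### Quasi-symmetry of lengths and distances -/

theorem mainTheorem3 (n : ℕ) (ε : ℝ) (hε : 0 < ε) :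
    (∃ B : ℝ, ∀ x ∈ LipOuter.thickPart n ε, ∀ y ∈ LipOuter.thickPart n ε,
      ∀ γ : unitInterval → LipOuter.OuterSpace n,
        LipOuter.IsPiecewiseLinear γ → γ 0 = x → γ 1 = y →
          BddAbove (LipOuter.lipSums γ) ∧
          BddAbove (LipOuter.lipSums (LipOuter.reversePath γ)) ∧
          (1 / LipOuter.constA n) * LipOuter.lipLength γ - B ≤
            LipOuter.lipLength (LipOuter.reversePath γ) ∧
          LipOuter.lipLength (LipOuter.reversePath γ) ≤
            LipOuter.constA n * LipOuter.lipLength γ + B) ∧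
    (∃ D : ℝ, ∀ x ∈ LipOuter.thickPart n ε, ∀ y ∈ LipOuter.thickPart n ε,
      LipOuter.lipDist y x ≤ D * LipOuter.lipDist x y) := by
  obtain ⟨b, hb, hpot⟩ := LipOuter.OuterSpace.exists_abs_potential_le n hε
  have hdiff : ∀ x ∈ LipOuter.thickPart n ε, ∀ y ∈ LipOuter.thickPart n ε,
      x.potential - y.potential ≤ 2 * b := fun x hx y hy => by
    have h1 := (abs_le.1 (hpot x hx)).2
    have h2 := (abs_le.1 (hpot y hy)).1
    linarith
  have hA1 := LipOuter.one_le_constA n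
  have hA := LipOuter.exponent_le_constA n
  have hA0 : 0 < LipOuter.constA n := one_pos.trans_le hA1
  -- `2 * b` bounds the difference of the potentials of two thick points. The lower estimate is the
  -- upper one applied to the reverse path and divided by `constA n ≥ 1`.
  refine ⟨⟨2 * b, ?_⟩, ?_⟩
  · rintro _ hx _ hy γ hγ rfl rfl
    obtain ⟨C, -, hd⟩ := hγ.exists_lipDist_le
    have hbdd := LipOuter.bddAbove_lipSums hd
    have hbdd' : BddAbove (LipOuter.lipSums (LipOuter.reversePath γ)) :=
      LipOuter.bddAbove_lipSums (C := C) fun s t => by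
        refine (hd _ _).trans_eq ?_
        rw [unitInterval.coe_symm_eq, unitInterval.coe_symm_eq, sub_sub_sub_cancel_left,
          abs_sub_comm]
    have hL := LipOuter.lipLength_nonneg γ
    have hL' := LipOuter.lipLength_nonneg (LipOuter.reversePath γ)
    have h1 := LipOuter.lipLength_reversePath_le hbdd
    have h2 := LipOuter.lipLength_reversePath_le hbdd'
    have e0 : LipOuter.reversePath γ 0 = γ 1 := by simp [LipOuter.reversePath]
    have e1 : LipOuter.reversePath γ 1 = γ 0 := by simp [LipOuter.reversePath]
    rw [LipOuter.reversePath_reversePath, e0, e1] at h2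
    have h3 := hdiff _ hx _ hy
    have h4 := hdiff _ hy _ hx
    have h5 := mul_le_mul_of_nonneg_right hA hL
    have h6 := mul_le_mul_of_nonneg_right hA hL'
    refine ⟨hbdd, hbdd', ?_, by linarith⟩
    rw [sub_le_iff_le_add, one_div, inv_mul_le_iff₀ hA0]
    have h7 := mul_le_mul_of_nonneg_right hA1 (mul_nonneg zero_le_two hb)
    linarith
  · have hδ : 0 < min 1 (ε / 8) := lt_min one_pos (by positivity)
    have hb' : 0 ≤ 2 * b / min 1 (ε / 8) := div_nonneg (by linarith) hδ.le
    have hε' : 0 ≤ 16 / ε := by positivity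
    -- Distances of at least `min 1 (ε / 8)` absorb the additive error `2 * b` into the second
    -- summand. For smaller distances the last summand suffices.
    refine ⟨LipOuter.OuterSpace.exponent n + 2 * b / min 1 (ε / 8) + 16 / ε,
      fun x hx y hy => ?_⟩
    have hd := LipOuter.OuterSpace.lipDist_nonneg x y
    have h1 := mul_nonneg (Nat.cast_nonneg (α := ℝ) (LipOuter.OuterSpace.exponent n)) hd
    have h2 := mul_nonneg hb' hd
    have h3 := mul_nonneg hε' hd
    rw [add_mul, add_mul]
    rcases lt_or_ge (LipOuter.lipDist x y) (min 1 (ε / 8)) with h | h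
    · have := LipOuter.OuterSpace.lipDist_reverse_le_of_small hε hx hy
        (h.trans_le (min_le_left _ _)) (h.trans_le (min_le_right _ _))
      linarith
    · have h4 := LipOuter.OuterSpace.lipDist_reverse_le x y
      have h5 := hdiff x hx y hy
      have h6 := mul_le_mul_of_nonneg_left h hb'
      rw [div_mul_cancel₀ _ hδ.ne'] at h6
      linarith
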